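/- Work over a field $\mathbb K$ with $\mathbb Z$-graded vector spaces, homogeneous maps and Koszul signs. For a graded vector space $A$ let $T^c(A)=\bigoplus_{k\ge 0}A^{\otimes k}$ be the tensor coalgebra, with deconcatenation $\Delta$, counit $\varepsilon$ the projection to $A^{\otimes 0}$, and unit $1$ the empty word. A $B_\infty$ structure on $A$ is a differential graded bialgebra structure on this unital coalgebra, that is, an associative product $\mu: T^c(A)\otimes T^c(A)\to T^c(A)$ with unit $1$ which is a coalgebra map of degree $0$, and a coderivation $d$ of degree $-1$ with $d^2=0$ which is a derivation of $\mu$. A homomorphism of $B_\infty$ algebras is a linear map $f:A\to B$ of degree $0$ such that $T(f):T^c(A)\to T^c(B)$ commutes with $\mu$ and $d$. A 2-associative differential algebra $(V,\partial,\bullet,\circ,1)$ is a differential graded algebra $(V,\partial,\bullet,1)$ (with $\partial$ of degree $-1$) with a second graded associative multiplication $\circ$ with the same unit. A 2-associative differential bialgebra ($d\mathcal As^{1,1}$ bialgebra) has in addition a comultiplication $\Delta$ with counit $\varepsilon$ such that $(V,\partial,\bullet,1,\Delta,\varepsilon)$ is a differential graded bialgebra and $\Delta(x\circ y)=x_{(1)}\otimes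 (x_{(2)}\circ y)+(x\circ y_{(1)})\otimes y_{(2)}-x\otimes y$. Homomorphisms preserve all the structure. For a graded coalgebra with group-like unit $1$ put $\bar\Delta(x)=\Delta(x)-x\otimes 1-1\otimes x$ on $\ker\varepsilon$; $\mathrm{Prim}(V)=\ker\bar\Delta\subseteq \ker\varepsilon$; $V$ is conilpotent if each $x\in\ker\varepsilon$ is killed by some iterate $\bar\Delta^{(r)}$; and the conilpotent radical is $R(V)=\bigcup_r F_rV$, where $F_0V=\mathbb K1$ and $F_rV=\mathbb K1\oplus\{x\in\ker\varepsilon\mid\bar\Delta(x)\in F_{r-1}V\otimes F_{r-1}V\}$ for $r\ge 1$. Every 2-associative differential algebra $V$ has a unique $B_\infty$ structure $(\mu,d)$ on $V$ such that $\tau_1\mu(x,y)=\tau_1(x)\bullet\tau_1(y)$ and $\tau_1 d(x)=\partial\tau_1(x)$ for all $x,y\in\ker(\varepsilon:T^c(V)\to\mathbb K)$, where $\tau_1(v_1\cdots v_k)=v_1\circ\cdots\circ v_k$; it is called the underlying $B_\infty$ structure of $V$. For a $B_\infty$ algebra $A$ let $U(A)=(T^c(A),d,\mu,\circ,\Delta,1)$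 with $\circ$ the concatenation of words; this is a $d\mathcal As^{1,1}$ bialgebra, functorial in $A$, and it is the universal enveloping 2-associative differential algebra of $A$: for each 2-associative differential algebra $V$ every $B_\infty$ homomorphism from $A$ to the underlying $B_\infty$ algebra of $V$ extends uniquely to a homomorphism $U(A)\to V$ of 2-associative differential algebras, and every homomorphism $U(A)\to V$ restricts to a $B_\infty$ homomorphism on $A$. **Theorem.** The underlying $B_\infty$ structure on a 2-associative differential bialgebra $V$ restricts to $\mathrm{Prim}(V)$: there is a $B_\infty$ structure on $\mathrm{Prim}(V)$ for which the inclusion into $V$ is a $B_\infty$ homomorphism. With restriction of homomorphisms this gives a functor $$\mathrm{Prim}: d\mathcal As^{1,1}\text{-bialg}\longrightarrow B_\infty\text{-alg},$$ which is right adjoint to $U$. The unit of the adjunction is a natural isomorphism $\eta_A:A\to\mathrm{Prim}(U(A))$, given by the inclusion of the words of length one. The counit $\varepsilon_V:U(\mathrm{Prim}(V))\to V$, which extends the inclusion $\mathrm{Prim}(V)\to V$, is an injective map, in particular a monomorphism; its image is $R(V)$; and it is an isomorphism if and only if $V$ is conilpotent. In particular, the conilpotent $d\mathcal As^{1,1}$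 bialgebras form a full coreflective subcategory of $d\mathcal As^{1,1}\text{-bialg}$, and $U$ and $\mathrm{Prim}$ restrict to an adjoint equivalence (with the same unit and counit) between $B_\infty$ algebras and this subcategory. -/

import Mathlib

open TensorProduct CategoryTheory

universe u

namespace BInf

noncomputable section

/-! ### The tensor coalgebra -/

section TensorCoalgebra
variable (K : Type u) [Field K] (M : Type u) [AddCommGroup M] [Module K M]

/-- The values on letters of the auxiliary algebra map `deconcMat`. -/
def deconcGen : M →ₗ[K] Matrix (Fin 2) (Fin 2) (TensorAlgebra K M ⊗[K] (TensorAlgebra K M)) where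
  toFun v := !![TensorAlgebra.ι K v ⊗ₜ[K] 1, 1 ⊗ₜ[K] TensorAlgebra.ι K v;
                0, 1 ⊗ₜ[K] TensorAlgebra.ι K v]
  map_add' v w := by
    ext i j; fin_cases i <;> fin_cases j <;> simp [add_tmul, tmul_add]
  map_smul' r v := by
    ext i j; fin_cases i <;> fin_cases j <;> simp [smul_tmul']

/-- The algebra map `x ↦ !![x ⊗ 1, D x; 0, 1 ⊗ x]`, where `D` is the derivation from the tensor
algebra `T` to the bimodule `T ⊗ T` with `D v = 1 ⊗ v` on letters. -/
def deconcMat : (TensorAlgebra K M) →ₐ[K] Matrix (Fin 2) (Fin 2) (TensorAlgebra K M ⊗[K] (TensorAlgebra K M)) :=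
  TensorAlgebra.lift K (deconcGen K M)

/-- The deconcatenation comultiplication on the tensor algebra, `Δ x = x ⊗ 1 + D x`;
see `deconc_word` for its values on words. -/
def deconc : (TensorAlgebra K M) →ₗ[K] (TensorAlgebra K M) ⊗[K] (TensorAlgebra K M) :=
  Matrix.entryLinearMap K (TensorAlgebra K M ⊗[K] (TensorAlgebra K M)) (0 : Fin 2) (0 : Fin 2) ∘ₗ (deconcMat K M).toLinearMap +
  Matrix.entryLinearMap K (TensorAlgebra K M ⊗[K] (TensorAlgebra K M)) (0 : Fin 2) (1 : Fin 2) ∘ₗ (deconcMat K M).toLinearMap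

variable {K M}

theorem deconcMat_entries (x : (TensorAlgebra K M)) :
    deconcMat K M x 0 0 = x ⊗ₜ 1 ∧ deconcMat K M x 1 0 = 0 ∧ deconcMat K M x 1 1 = 1 ⊗ₜ x := by
  induction x using TensorAlgebra.induction with
  | algebraMap r =>
    have h : (algebraMap K (TensorAlgebra K M) r) ⊗ₜ[K] (1 : TensorAlgebra K M) =
        1 ⊗ₜ[K] (algebraMap K (TensorAlgebra K M) r) := by
      rw [Algebra.algebraMap_eq_smul_one, smul_tmul]
    simp [Matrix.algebraMap_matrix_apply, Algebra.TensorProduct.algebraMap_apply, h]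
  | ι v => simp [deconcMat, deconcGen]
  | mul a b ha hb =>
    obtain ⟨h1, h2, h3⟩ := ha
    obtain ⟨k1, k2, k3⟩ := hb
    simp [Matrix.mul_apply, Fin.sum_univ_two, h1, h2, h3, k1, k2, k3]
  | add a b ha hb =>
    obtain ⟨h1, h2, h3⟩ := ha
    obtain ⟨k1, k2, k3⟩ := hb
    simp [h1, h2, h3, k1, k2, k3, add_tmul, tmul_add]

theorem deconc_apply (x : (TensorAlgebra K M)) : deconc K M x = x ⊗ₜ 1 + deconcMat K M x 0 1 := by
  simp [deconc, (deconcMat_entries x).1]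

@[simp] theorem deconc_one : deconc K M 1 = 1 ⊗ₜ 1 := by
  simp [deconc_apply]

@[simp] theorem deconc_ι (v : M) : deconc K M (TensorAlgebra.ι K v) =
    TensorAlgebra.ι K v ⊗ₜ 1 + 1 ⊗ₜ TensorAlgebra.ι K v := by
  rw [deconc_apply]; simp [deconcMat, deconcGen]

theorem deconc_mul (x y : (TensorAlgebra K M)) : deconc K M (x * y) =
    deconc K M x * (1 ⊗ₜ y) + (x ⊗ₜ 1) * deconc K M y - x ⊗ₜ y := by
  simp only [deconc_apply, map_mul, Matrix.mul_apply, Fin.sum_univ_two, (deconcMat_entries x).1,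
    (deconcMat_entries y).2.2, mul_add, add_mul, Algebra.TensorProduct.tmul_mul_tmul, mul_one,
    one_mul]
  abel

theorem tensor_left_induction {p : (TensorAlgebra K M) → Prop} (one : p 1)
    (mul : ∀ (v : M) (x : (TensorAlgebra K M)), p x → p (TensorAlgebra.ι K v * x))
    (add : ∀ x y, p x → p y → p (x + y)) (smul : ∀ (r : K) x, p x → p (r • x)) (x : (TensorAlgebra K M)) : p x := by
  suffices h : ∀ y, p y → p (x * y) by simpa using h 1 one
  induction x using TensorAlgebra.induction with
  | algebraMap r => intro y hy; rw [← Algebra.smul_def]; exact smul r y hy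
  | ι v => exact fun y hy => mul v y hy
  | mul a b ha hb => intro y hy; rw [mul_assoc]; exact ha _ (hb _ hy)
  | add a b ha hb => intro y hy; rw [add_mul]; exact add _ _ (ha _ hy) (hb _ hy)

theorem deconc_ι_mul (v : M) (y : (TensorAlgebra K M)) : deconc K M (TensorAlgebra.ι K v * y) =
    1 ⊗ₜ (TensorAlgebra.ι K v * y) +
      (LinearMap.mulLeft K (TensorAlgebra.ι K v)).rTensor (TensorAlgebra K M) (deconc K M y) := by
  rw [deconc_mul, deconc_ι]
  have : ∀ t : TensorAlgebra K M ⊗[K] TensorAlgebra K M, (TensorAlgebra.ι K v ⊗ₜ[K] (1 : (TensorAlgebra K M))) * t =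
      (LinearMap.mulLeft K (TensorAlgebra.ι K v)).rTensor (TensorAlgebra K M) t := by
    intro t
    induction t with
    | zero => simp
    | tmul a b => simp
    | add a b ha hb => rw [mul_add, ha, hb, map_add]
  rw [this]
  simp only [add_mul, Algebra.TensorProduct.tmul_mul_tmul, one_mul, mul_one]
  abel

/-- `Δ (v₁ ⋯ v_k) = ∑ i, v₁ ⋯ v_i ⊗ v_{i+1} ⋯ v_k`. -/
theorem deconc_word (l : List M) :
    deconc K M (l.map (TensorAlgebra.ι K)).prod =
      ∑ i ∈ Finset.range (l.length + 1),
        ((l.take i).map (TensorAlgebra.ι K)).prod ⊗ₜ ((l.drop i).map (TensorAlgebra.ι K)).prod := by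
  induction l with
  | nil => simp
  | cons v l ih =>
    rw [List.map_cons, List.prod_cons, deconc_ι_mul, ih, List.length_cons,
      Finset.sum_range_succ' _ (l.length + 1)]
    simp [add_comm]

theorem deconc_counit_left : (TensorAlgebra.algebraMapInv : (TensorAlgebra K M) →ₐ[K] K).toLinearMap.rTensor (TensorAlgebra K M) ∘ₗ
    deconc K M = TensorProduct.mk K K (TensorAlgebra K M) 1 := by
  ext x
  induction x using tensor_left_induction with
  | one => simp
  | add x y hx hy => rw [map_add, map_add, hx, hy]
  | smul r x hx => rw [map_smul, map_smul, hx]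
  | mul v y hy =>
    have : ∀ t : TensorAlgebra K M ⊗[K] TensorAlgebra K M, (TensorAlgebra.algebraMapInv : (TensorAlgebra K M) →ₐ[K] K).toLinearMap.rTensor (TensorAlgebra K M)
        ((LinearMap.mulLeft K (TensorAlgebra.ι K v)).rTensor (TensorAlgebra K M) t) = 0 := by
      intro t
      induction t with
      | zero => simp
      | tmul a b => simp [TensorAlgebra.algebraMapInv]
      | add a b ha hb => simp only [map_add, ha, hb, add_zero]
    rw [LinearMap.comp_apply, deconc_ι_mul, map_add, this]
    simp

theorem deconc_counit_right : (TensorAlgebra.algebraMapInv : (TensorAlgebra K M) →ₐ[K] K).toLinearMap.lTensor (TensorAlgebra K M) ∘ₗ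
    deconc K M = (TensorProduct.mk K (TensorAlgebra K M) K).flip 1 := by
  ext x
  induction x using tensor_left_induction with
  | one => simp
  | add x y hx hy => rw [map_add, map_add, hx, hy]
  | smul r x hx => rw [map_smul, map_smul, hx]
  | mul v y hy =>
    have : ∀ t : TensorAlgebra K M ⊗[K] TensorAlgebra K M, (TensorAlgebra.algebraMapInv : (TensorAlgebra K M) →ₐ[K] K).toLinearMap.lTensor (TensorAlgebra K M)
        ((LinearMap.mulLeft K (TensorAlgebra.ι K v)).rTensor (TensorAlgebra K M) t) =
        (LinearMap.mulLeft K (TensorAlgebra.ι K v)).rTensor K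
          ((TensorAlgebra.algebraMapInv : (TensorAlgebra K M) →ₐ[K] K).toLinearMap.lTensor (TensorAlgebra K M) t) := by
      intro t
      induction t with
      | zero => simp
      | tmul a b => simp
      | add a b ha hb => simp only [map_add, ha, hb]
    rw [LinearMap.comp_apply] at hy
    rw [LinearMap.comp_apply, deconc_ι_mul, map_add, this, hy]
    simp [TensorAlgebra.algebraMapInv]

theorem deconc_coassoc : TensorProduct.assoc K (TensorAlgebra K M) (TensorAlgebra K M) (TensorAlgebra K M) ∘ₗ (deconc K M).rTensor (TensorAlgebra K M) ∘ₗ deconc K M =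
    (deconc K M).lTensor (TensorAlgebra K M) ∘ₗ deconc K M := by
  ext x
  induction x using tensor_left_induction with
  | one => simp
  | add x y hx hy => rw [map_add, map_add, hx, hy]
  | smul r x hx => rw [map_smul, map_smul, hx]
  | mul v y hy =>
    have h1 : ∀ t : TensorAlgebra K M ⊗[K] TensorAlgebra K M, TensorProduct.assoc K (TensorAlgebra K M) (TensorAlgebra K M) (TensorAlgebra K M) ((deconc K M).rTensor (TensorAlgebra K M)
        ((LinearMap.mulLeft K (TensorAlgebra.ι K v)).rTensor (TensorAlgebra K M) t)) =
        1 ⊗ₜ ((LinearMap.mulLeft K (TensorAlgebra.ι K v)).rTensor (TensorAlgebra K M) t) +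
        (LinearMap.mulLeft K (TensorAlgebra.ι K v)).rTensor (TensorAlgebra K M ⊗[K] (TensorAlgebra K M))
          (TensorProduct.assoc K (TensorAlgebra K M) (TensorAlgebra K M) (TensorAlgebra K M) ((deconc K M).rTensor (TensorAlgebra K M) t)) := by
      intro t
      induction t with
      | zero => simp
      | tmul a b =>
        simp only [LinearMap.rTensor_tmul, LinearMap.mulLeft_apply, deconc_ι_mul, add_tmul, map_add,
          TensorProduct.assoc_tmul, add_right_inj]
        generalize deconc K M a = s
        induction s with
        | zero => simp
        | tmul a b => simp
        | add a b ha hb => simp only [map_add, add_tmul, ha, hb]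
      | add a b ha hb => simp only [map_add, ha, hb, tmul_add]; abel
    have h2 : ∀ t : TensorAlgebra K M ⊗[K] TensorAlgebra K M, (deconc K M).lTensor (TensorAlgebra K M)
        ((LinearMap.mulLeft K (TensorAlgebra.ι K v)).rTensor (TensorAlgebra K M) t) =
        (LinearMap.mulLeft K (TensorAlgebra.ι K v)).rTensor (TensorAlgebra K M ⊗[K] (TensorAlgebra K M))
          ((deconc K M).lTensor (TensorAlgebra K M) t) := by
      intro t
      induction t with
      | zero => simp
      | tmul a b => simp
      | add a b ha hb => simp only [map_add, ha, hb]
    simp only [LinearMap.comp_apply, LinearEquiv.coe_coe] at hy ⊢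
    rw [deconc_ι_mul, map_add, map_add, map_add, h1, h2, hy, LinearMap.lTensor_tmul,
      deconc_ι_mul, LinearMap.rTensor_tmul, deconc_one, TensorProduct.assoc_tmul, tmul_add, add_assoc]

variable (K M) in
/-- The tensor coalgebra: deconcatenation, with counit the projection to words of length `0`. -/
abbrev tensorCoalgebra : Coalgebra K (TensorAlgebra K M) where
  comul := deconc K M
  counit := (TensorAlgebra.algebraMapInv : (TensorAlgebra K M) →ₐ[K] K).toLinearMap
  coassoc := deconc_coassoc
  rTensor_counit_comp_comul := deconc_counit_left
  lTensor_counit_comp_comul := deconc_counit_right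

variable {N P : Type u} [AddCommGroup N] [Module K N] [AddCommGroup P] [Module K P]

/-- The map `T(f)` of tensor algebras induced by a linear map `f`, applying `f` letterwise. -/
def tensorMap (f : M →ₗ[K] N) : (TensorAlgebra K M) →ₐ[K] TensorAlgebra K N :=
  TensorAlgebra.lift K (TensorAlgebra.ι K ∘ₗ f)

@[simp] theorem tensorMap_ι (f : M →ₗ[K] N) (v : M) :
    tensorMap f (TensorAlgebra.ι K v) = TensorAlgebra.ι K (f v) := by
  simp [tensorMap]

theorem tensorMap_id (x : (TensorAlgebra K M)) : tensorMap (LinearMap.id : M →ₗ[K] M) x = x := by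
  have : tensorMap (LinearMap.id : M →ₗ[K] M) = AlgHom.id K _ := by ext; simp
  rw [this]; rfl

theorem tensorMap_comp (g : N →ₗ[K] P) (f : M →ₗ[K] N) (x : (TensorAlgebra K M)) :
    tensorMap (g ∘ₗ f) x = tensorMap g (tensorMap f x) := by
  have : tensorMap (g ∘ₗ f) = (tensorMap g).comp (tensorMap f) := by ext; simp
  rw [this]; rfl

theorem tensorMap_deconc (f : M →ₗ[K] N) (x : (TensorAlgebra K M)) : deconc K N (tensorMap f x) =
    TensorProduct.map (tensorMap f).toLinearMap (tensorMap f).toLinearMap (deconc K M x) := by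
  induction x using tensor_left_induction with
  | one => simp
  | add x y hx hy => simp [hx, hy]
  | smul r x hx => simp [hx]
  | mul v y hy =>
    have : ∀ t : TensorAlgebra K M ⊗[K] TensorAlgebra K M,
        (LinearMap.mulLeft K (TensorAlgebra.ι K (f v))).rTensor (TensorAlgebra K N)
          (TensorProduct.map (tensorMap f).toLinearMap (tensorMap f).toLinearMap t) =
        TensorProduct.map (tensorMap f).toLinearMap (tensorMap f).toLinearMap
          ((LinearMap.mulLeft K (TensorAlgebra.ι K v)).rTensor (TensorAlgebra K M) t) := by
      intro t
      induction t with
      | zero => simp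
      | tmul a b => simp
      | add a b ha hb => simp only [map_add, ha, hb]
    rw [map_mul, tensorMap_ι, deconc_ι_mul, hy, this, deconc_ι_mul, map_add]
    simp

theorem tensorMap_counit (f : M →ₗ[K] N) (x : (TensorAlgebra K M)) :
    TensorAlgebra.algebraMapInv (tensorMap f x) = TensorAlgebra.algebraMapInv x := by
  have : (TensorAlgebra.algebraMapInv : TensorAlgebra K N →ₐ[K] K).comp (tensorMap f) =
    TensorAlgebra.algebraMapInv := by ext; simp [TensorAlgebra.algebraMapInv]
  exact DFunLike.congr_fun this x

end TensorCoalgebra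

section WordGrading
variable {K : Type u} [Field K] {M : Type u} [AddCommGroup M] [Module K M]

/-- The words of homogeneous letters of total degree `n` span the degree `n` part of the tensor
algebra. -/
def wordGr (𝒱 : ℤ → Submodule K M) (n : ℤ) : Submodule K (TensorAlgebra K M) :=
  Submodule.span K {x | ∃ l : List (Σ i, 𝒱 i), (l.map Sigma.fst).sum = n ∧
    (l.map fun p => TensorAlgebra.ι K (p.2 : M)).prod = x}

theorem ι_mem_wordGr (𝒱 : ℤ → Submodule K M) {n : ℤ} {v : M} (hv : v ∈ 𝒱 n) :
    TensorAlgebra.ι K v ∈ wordGr 𝒱 n :=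
  Submodule.subset_span ⟨[⟨n, ⟨v, hv⟩⟩], by simp⟩

instance wordGr_gradedMonoid (𝒱 : ℤ → Submodule K M) : SetLike.GradedMonoid (wordGr 𝒱) where
  one_mem := Submodule.subset_span ⟨[], by simp⟩
  mul_mem := by
    intro i j a b ha hb
    have h : wordGr 𝒱 i * wordGr 𝒱 j ≤ wordGr 𝒱 (i + j) := by
      unfold wordGr
      rw [Submodule.span_mul_span, Submodule.span_le]
      rintro _ ⟨_, ⟨l, hl, rfl⟩, _, ⟨l', hl', rfl⟩, rfl⟩
      exact Submodule.subset_span ⟨l ++ l', by simp [hl, hl'], by simp⟩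
    exact h (Submodule.mul_mem_mul ha hb)

theorem wordGr_isInternal (𝒱 : ℤ → Submodule K M) (h𝒱 : DirectSum.IsInternal 𝒱) :
    DirectSum.IsInternal (wordGr 𝒱) := by
  let _ := h𝒱.chooseDecomposition
  let g : M →ₗ[K] DirectSum ℤ (fun i => wordGr 𝒱 i) :=
    DirectSum.toModule K ℤ _ (fun i => DirectSum.lof K ℤ (fun i => wordGr 𝒱 i) i ∘ₗ
      ((TensorAlgebra.ι K).restrict (p := 𝒱 i) (q := wordGr 𝒱 i)
        (fun v hv => ι_mem_wordGr 𝒱 hv))) ∘ₗ (DirectSum.decomposeLinearEquiv 𝒱).toLinearMap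
  have hg : ∀ (i : ℤ) (v : 𝒱 i), g v = DirectSum.of (fun i => wordGr 𝒱 i) i
      ⟨TensorAlgebra.ι K (v : M), ι_mem_wordGr 𝒱 v.2⟩ := by
    intro i v
    simp only [g, LinearMap.comp_apply, LinearEquiv.coe_coe, DirectSum.decomposeLinearEquiv_apply,
      DirectSum.decompose_coe]
    erw [DirectSum.toModule_lof]
    rfl
  have hr : (DirectSum.coeAlgHom (wordGr 𝒱)).comp (TensorAlgebra.lift K g) = AlgHom.id K _ := by
    ext v
    simp only [LinearMap.comp_apply, AlgHom.toLinearMap_apply, AlgHom.comp_apply,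
      TensorAlgebra.lift_ι_apply, AlgHom.id_apply]
    induction v using DirectSum.Decomposition.inductionOn 𝒱 with
    | zero => simp
    | homogeneous v => rw [hg]; erw [DirectSum.coeAlgHom_of]
    | add a b ha hb => simp only [map_add, ha, hb]
  have hl : ∀ i (x : wordGr 𝒱 i), TensorAlgebra.lift K g (x : TensorAlgebra K M) =
      DirectSum.of (fun i => wordGr 𝒱 i) i x := by
    rintro i ⟨x, hx⟩
    induction hx using Submodule.span_induction with
    | mem x hx =>
      obtain ⟨l, hl, rfl⟩ := hx
      induction l generalizing i with
      | nil => 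
        obtain rfl : 0 = i := by simpa using hl
        simp; rfl
      | cons p l ih =>
        obtain rfl : p.1 + (l.map Sigma.fst).sum = i := by simpa using hl
        have := ih _ rfl
        simp only [List.map_cons, List.prod_cons, map_mul, TensorAlgebra.lift_ι_apply] at this ⊢
        rw [hg, this, DirectSum.of_mul_of]
        rfl
    | zero => erw [map_zero]; exact (map_zero _).symm
    | add x y hx hy h1 h2 =>
      simp only [map_add] at h1 h2 ⊢
      rw [h1, h2, ← map_add]; rfl
    | smul r x hx h1 =>
      simp only [map_smul] at h1 ⊢
      rw [h1]; erw [← DirectSum.lof_eq_of K, ← DirectSum.lof_eq_of K, ← map_smul]; rfl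
  let _ := GradedAlgebra.ofAlgHom (wordGr 𝒱) (TensorAlgebra.lift K g) hr hl
  exact DirectSum.Decomposition.isInternal _
end WordGrading

/-! ### Graded vector spaces and Koszul signs -/

variable {K : Type u} [Field K]

variable (K) in
/-- A `ℤ`-graded vector space over `K`. -/
structure GrVect where
  carrier : Type u
  [addCommGroup : AddCommGroup carrier]
  [module : Module K carrier]
  gr : ℤ → Submodule K carrier
  isInternal : DirectSum.IsInternal gr

attribute [instance] GrVect.addCommGroup GrVect.module

instance : CoeSort (GrVect K) (Type u) := ⟨GrVect.carrier⟩


instance (V : GrVect K) : DirectSum.Decomposition V.gr := V.isInternal.chooseDecomposition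

/-- The linear map `f` is homogeneous of degree `n`. -/
def HasDegree {V W : GrVect K} (n : ℤ) (f : V →ₗ[K] W) : Prop :=
  ∀ i, ∀ v ∈ V.gr i, f v ∈ W.gr (i + n)

/-- The grading of the tensor product: `|a ⊗ b| = |a| + |b|`. -/
def tensorGr (V W : GrVect K) (n : ℤ) : Submodule K (V ⊗[K] W) :=
  Submodule.span K {t | ∃ i j, i + j = n ∧ ∃ a ∈ V.gr i, ∃ b ∈ W.gr j, a ⊗ₜ[K] b = t}

/-- The operator `v ↦ (-1)^|v| v`. -/
def signOp (V : GrVect K) : V →ₗ[K] V :=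
  DirectSum.toModule K ℤ V (fun i => ((-1 : ℤˣ) ^ i) • (V.gr i).subtype) ∘ₗ
    (DirectSum.decomposeLinearEquiv V.gr).toLinearMap

theorem signOp_apply (V : GrVect K) {i : ℤ} {v : V} (hv : v ∈ V.gr i) :
    signOp V v = ((-1 : ℤˣ) ^ i) • v := by
  lift v to V.gr i using hv
  simp only [signOp, LinearMap.comp_apply, LinearEquiv.coe_coe,
    DirectSum.decomposeLinearEquiv_apply, DirectSum.decompose_coe]
  erw [DirectSum.toModule_lof]
  rfl

/-- The symmetry `v ⊗ w ↦ (-1)^(|v| |w|) w ⊗ v`. -/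
def braid (V W : GrVect K) : V ⊗[K] W →ₗ[K] W ⊗[K] V :=
  (TensorProduct.congr (DirectSum.decomposeLinearEquiv W.gr).symm
      (DirectSum.decomposeLinearEquiv V.gr).symm).toLinearMap ∘ₗ
    (TensorProduct.gradedComm K (fun i => V.gr i) (fun i => W.gr i)).toLinearMap ∘ₗ
    (TensorProduct.congr (DirectSum.decomposeLinearEquiv V.gr)
      (DirectSum.decomposeLinearEquiv W.gr)).toLinearMap

theorem braid_tmul (V W : GrVect K) {i j : ℤ} {v : V} {w : W} (hv : v ∈ V.gr i) (hw : w ∈ W.gr j) :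
    braid V W (v ⊗ₜ w) = ((-1 : ℤˣ) ^ (i * j)) • (w ⊗ₜ[K] v) := by
  lift v to V.gr i using hv
  lift w to W.gr j using hw
  simp only [braid, LinearMap.comp_apply, LinearEquiv.coe_coe, TensorProduct.congr_tmul,
    DirectSum.decomposeLinearEquiv_apply, DirectSum.decompose_coe, ← DirectSum.lof_eq_of K]
  rw [TensorProduct.gradedComm_of_tmul_of, mul_comm j i]
  rw [Units.smul_def, Units.smul_def, map_zsmul, TensorProduct.congr_tmul]
  simp only [DirectSum.lof_eq_of]
  erw [DirectSum.decompose_symm_of, DirectSum.decompose_symm_of]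

/-- The interchange of the two inner factors, with its Koszul sign:
`(a ⊗ b) ⊗ (c ⊗ d) ↦ (-1)^(|b| |c|) (a ⊗ c) ⊗ (b ⊗ d)`. -/
def midSwap (V : GrVect K) :
    (V ⊗[K] V) ⊗[K] (V ⊗[K] V) →ₗ[K] (V ⊗[K] V) ⊗[K] (V ⊗[K] V) :=
  (TensorProduct.assoc K V V (V ⊗[K] V)).symm.toLinearMap ∘ₗ
    ((TensorProduct.assoc K V V V).toLinearMap ∘ₗ (braid V V).rTensor V ∘ₗ
      (TensorProduct.assoc K V V V).symm.toLinearMap).lTensor V ∘ₗ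
    (TensorProduct.assoc K V V (V ⊗[K] V)).toLinearMap

theorem midSwap_tmul (V : GrVect K) {i j : ℤ} (a d : V) {b c : V}
    (hb : b ∈ V.gr i) (hc : c ∈ V.gr j) :
    midSwap V ((a ⊗ₜ b) ⊗ₜ (c ⊗ₜ d)) = ((-1 : ℤˣ) ^ (i * j)) • ((a ⊗ₜ[K] c) ⊗ₜ[K] (b ⊗ₜ[K] d)) := by
  rcases Int.units_eq_one_or ((-1 : ℤˣ) ^ (i * j)) with h | h <;>
    simp [midSwap, braid_tmul V V hb hc, h, neg_tmul, tmul_neg]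

/-! ### Graded unital coalgebras -/

variable (K) in
/-- A graded coassociative counital coalgebra with a group-like unit (coaugmentation) `1`. -/
structure GrCoalg extends GrVect K where
  [coalgebra : Coalgebra K carrier]
  one : carrier
  comul_mem : ∀ n, ∀ x ∈ gr n, Coalgebra.comul (R := K) x ∈ tensorGr toGrVect toGrVect n
  counit_eq_zero : ∀ n, n ≠ 0 → ∀ x ∈ gr n, Coalgebra.counit (R := K) x = 0
  one_mem : one ∈ gr 0
  comul_one : Coalgebra.comul (R := K) one = one ⊗ₜ[K] one
  counit_one : Coalgebra.counit (R := K) one = 1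

attribute [instance] GrCoalg.coalgebra

instance : CoeSort (GrCoalg K) (Type u) := ⟨fun C => C.carrier⟩

namespace GrCoalg
variable (C : GrCoalg K)

/-- The comultiplication `Δ`. -/
abbrev comul : C →ₗ[K] C ⊗[K] C := Coalgebra.comul
/-- The counit `ε`. -/
abbrev counit : C →ₗ[K] K := Coalgebra.counit

/-- The reduced comultiplication `Δ̄ x = Δ x - x ⊗ 1 - 1 ⊗ x`; it is only meant for `x ∈ ker ε`. -/
def redComul : C →ₗ[K] C ⊗[K] C :=
  C.comul - (TensorProduct.mk K C C).flip C.one - TensorProduct.mk K C C C.one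

theorem redComul_apply (x : C) : C.redComul x = C.comul x - x ⊗ₜ C.one - C.one ⊗ₜ x := rfl

/-- The primitive elements: the kernel of `Δ̄` on `ker ε`. -/
def primitives : Submodule K C := LinearMap.ker C.counit ⊓ LinearMap.ker C.redComul

/-- The primitive filtration: `F₀ = K 1`, and
`F_{r+1} = K 1 + {x ∈ ker ε | Δ̄ x ∈ F_r ⊗ F_r}`. -/
def filt : ℕ → Submodule K C
  | 0 => Submodule.span K {C.one}
  | r + 1 => Submodule.span K {C.one} ⊔ (LinearMap.ker C.counit ⊓
      (LinearMap.range (TensorProduct.map (filt r).subtype (filt r).subtype)).comap C.redComul)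

/-- The conilpotent radical, the union of the increasing filtration `F_r`. -/
def radical : Submodule K C := ⨆ r, C.filt r

/-- The iterated reduced comultiplication `Δ̄^(r) : C → C^{⊗ (r+1)}`, with `Δ̄^(0) = id` and
`Δ̄^(r+1) = (id ⊗ Δ̄^(r)) Δ̄`. Its values are regarded as elements of the tensor algebra on `C`,
which contains `C^{⊗ (r+1)}` as the words of length `r + 1`. -/
def iterRedComul : ℕ → C →ₗ[K] TensorAlgebra K C
  | 0 => TensorAlgebra.ι K
  | r + 1 => LinearMap.mul' K (TensorAlgebra K C) ∘ₗ
      TensorProduct.map (TensorAlgebra.ι K) (iterRedComul r) ∘ₗ C.redComul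

/-- Every `x ∈ ker ε` is killed by some iterated reduced comultiplication. -/
def IsConilpotent : Prop := ∀ x : C, C.counit x = 0 → ∃ r, C.iterRedComul r x = 0

end GrCoalg


section Proj
variable (V : GrVect K)

/-- The projection of a graded vector space onto its part of degree `a`. -/
def GrVect.proj (a : ℤ) : V →ₗ[K] V :=
  (V.gr a).subtype ∘ₗ DirectSum.component K ℤ (fun i => V.gr i) a ∘ₗ
    (DirectSum.decomposeLinearEquiv V.gr).toLinearMap

theorem GrVect.proj_apply (a : ℤ) (v : V) : V.proj a v = (DirectSum.decompose V.gr v a : V) := rfl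

theorem GrVect.proj_mem (a : ℤ) (v : V) : V.proj a v ∈ V.gr a := by
  rw [GrVect.proj_apply]; exact Subtype.property _

theorem GrVect.proj_same {a : ℤ} {v : V} (hv : v ∈ V.gr a) : V.proj a v = v :=
  DirectSum.decompose_of_mem_same _ hv

theorem GrVect.proj_ne {a b : ℤ} {v : V} (hv : v ∈ V.gr a) (h : a ≠ b) : V.proj b v = 0 :=
  DirectSum.decompose_of_mem_ne _ hv h

theorem GrVect.sum_proj (v : V) : ∃ s : Finset ℤ, ∀ s', s ⊆ s' → ∑ a ∈ s', V.proj a v = v := by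
  classical
  refine ⟨(DirectSum.decompose V.gr v).support, fun s' hs => ?_⟩
  conv_rhs => rw [← DirectSum.sum_support_decompose V.gr v]
  symm
  refine Finset.sum_subset hs fun a _ ha => ?_
  simpa using ha

theorem GrVect.proj_tensor_sum (t : V ⊗[K] V) : ∃ s : Finset ℤ, ∀ s', s ⊆ s' →
    ∑ a ∈ s', ∑ b ∈ s', TensorProduct.map (V.proj a) (V.proj b) t = t := by
  classical
  induction t with
  | zero => exact ⟨∅, by simp⟩
  | tmul x y =>
    obtain ⟨s, hs⟩ := V.sum_proj x
    obtain ⟨s', hs'⟩ := V.sum_proj y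
    refine ⟨s ∪ s', fun u hu => ?_⟩
    simp only [TensorProduct.map_tmul, ← tmul_sum, ← sum_tmul]
    rw [hs u (Finset.union_subset_left hu), hs' u (Finset.union_subset_right hu)]
  | add x y hx hy =>
    obtain ⟨s, hs⟩ := hx
    obtain ⟨s', hs'⟩ := hy
    refine ⟨s ∪ s', fun u hu => ?_⟩
    simp only [map_add, Finset.sum_add_distrib]
    rw [hs u (Finset.union_subset_left hu), hs' u (Finset.union_subset_right hu)]

theorem GrVect.proj_tensorGr {n a b : ℤ} (h : a + b ≠ n) {t : V ⊗[K] V} (ht : t ∈ tensorGr V V n) :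
    TensorProduct.map (V.proj a) (V.proj b) t = 0 := by
  have : tensorGr V V n ≤ LinearMap.ker (TensorProduct.map (V.proj a) (V.proj b)) := by
    refine Submodule.span_le.2 ?_
    rintro _ ⟨i, j, hij, x, hx, y, hy, rfl⟩
    simp only [SetLike.mem_coe, LinearMap.mem_ker, TensorProduct.map_tmul]
    by_cases hi : i = a
    · rw [V.proj_ne hy (b := b) (by omega), tmul_zero]
    · rw [V.proj_ne hx hi, zero_tmul]
  exact this ht

/-- If a sum of homogeneous tensors of distinct degrees vanishes, each of them vanishes. -/
theorem GrVect.tensorGr_eq_zero {s : Finset ℤ} {f : ℤ → V ⊗[K] V}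
    (hf : ∀ n, f n ∈ tensorGr V V n) (h : ∑ n ∈ s, f n = 0) {n : ℤ} (hn : n ∈ s) : f n = 0 := by
  have key : ∀ a b, TensorProduct.map (V.proj a) (V.proj b) (f n) = 0 := by
    intro a b
    by_cases hab : a + b = n
    · have h0 := congrArg (TensorProduct.map (V.proj a) (V.proj b)) h
      rw [map_sum, map_zero, Finset.sum_eq_single n] at h0
      · exact h0
      · exact fun m _ hm => V.proj_tensorGr (fun h => hm (h.symm.trans hab)) (hf m)
      · exact fun h => absurd hn h
    · exact V.proj_tensorGr hab (hf n)
  obtain ⟨u, hu⟩ := V.proj_tensor_sum (f n)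
  rw [← hu u subset_rfl]
  exact Finset.sum_eq_zero fun a _ => Finset.sum_eq_zero fun b _ => key a b

/-- A subspace which contains the homogeneous components of its elements, with the induced
grading. -/
abbrev GrVect.sub (P : Submodule K V) (hP : ∀ x ∈ P, ∀ a, V.proj a x ∈ P) : GrVect K where
  carrier := P
  gr n := (V.gr n).comap P.subtype
  isInternal := by
    classical
    rw [DirectSum.isInternal_submodule_iff_iSupIndep_and_iSup_eq_top]
    constructor
    · intro i
      rw [Submodule.disjoint_def]
      intro x hx hx'
      have hle : ⨆ j, ⨆ (_ : j ≠ i), (V.gr j).comap P.subtype ≤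
          LinearMap.ker (V.proj i ∘ₗ P.subtype) :=
        iSup₂_le fun j hj y hy => V.proj_ne hy hj
      have h1 : V.proj i (x : V) = 0 := hle hx'
      rw [V.proj_same (show (x : V) ∈ V.gr i from hx)] at h1
      exact Subtype.ext h1
    · rw [eq_top_iff]
      rintro ⟨x, hx⟩ -
      obtain ⟨s, hs⟩ := V.sum_proj x
      have : (⟨x, hx⟩ : P) = ∑ a ∈ s, ⟨V.proj a x, hP x hx a⟩ := by
        ext; simpa using (hs s subset_rfl).symm
      rw [this]
      exact Submodule.sum_mem _ fun a _ => Submodule.mem_iSup_of_mem a (V.proj_mem a x)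

end Proj

theorem GrCoalg.counit_proj (C : GrCoalg K) {x : C} (hx : C.counit x = 0) (a : ℤ) :
    C.counit (C.proj a x) = 0 := by
  obtain ⟨s, hs⟩ := C.sum_proj x
  by_cases ha : a = 0
  · subst ha
    have h := congrArg C.counit (hs (insert 0 s) (Finset.subset_insert _ _))
    rw [hx, map_sum, Finset.sum_eq_single 0] at h
    · exact h
    · exact fun b _ hb => C.counit_eq_zero b hb _ (C.proj_mem b x)
    · exact fun h => absurd (Finset.mem_insert_self _ _) h
  · exact C.counit_eq_zero a ha _ (C.proj_mem a x)

theorem GrCoalg.redComul_mem (C : GrCoalg K) (n : ℤ) {x : C} (hx : x ∈ C.gr n) :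
    C.redComul x ∈ tensorGr C.toGrVect C.toGrVect n := by
  rw [GrCoalg.redComul_apply]
  refine Submodule.sub_mem _ (Submodule.sub_mem _ (C.comul_mem n x hx) ?_) ?_
  · exact Submodule.subset_span ⟨n, 0, by simp, x, hx, C.one, C.one_mem, rfl⟩
  · exact Submodule.subset_span ⟨0, n, by simp, C.one, C.one_mem, x, hx, rfl⟩

theorem GrCoalg.primitives_proj (C : GrCoalg K) (x : C) (hx : x ∈ C.primitives) (a : ℤ) :
    C.proj a x ∈ C.primitives := by
  classical
  refine ⟨C.counit_proj hx.1 a, ?_⟩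
  obtain ⟨s, hs⟩ := C.sum_proj x
  have h := congrArg C.redComul (hs (insert a s) (Finset.subset_insert _ _))
  rw [show C.redComul x = 0 from hx.2, map_sum] at h
  exact C.tensorGr_eq_zero (f := fun n => C.redComul (C.proj n x))
    (fun n => C.redComul_mem n (C.proj_mem n x)) h (Finset.mem_insert_self _ _)

/-- The graded vector space of primitive elements. -/
abbrev GrCoalg.prim (C : GrCoalg K) : GrVect K := C.toGrVect.sub C.primitives C.primitives_proj


/-- The tensor algebra of a graded vector space, with `|v₁ ⋯ v_k| = |v₁| + ⋯ + |v_k|`. -/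
abbrev tensorVect (A : GrVect K) : GrVect K where
  carrier := TensorAlgebra K A
  gr := wordGr A.gr
  isInternal := wordGr_isInternal A.gr A.isInternal

theorem word_mem (A : GrVect K) (l : List (Σ i, A.gr i)) :
    ((l.map fun p => (p.2 : A)).map (TensorAlgebra.ι K)).prod ∈
      wordGr A.gr (l.map Sigma.fst).sum :=
  Submodule.subset_span ⟨l, rfl, by simp [List.map_map, Function.comp_def]⟩

/-- The tensor coalgebra `T^c(A)` of a graded vector space, with unit the empty word. -/
abbrev tensorCoalg (A : GrVect K) : GrCoalg K where
  toGrVect := tensorVect A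
  coalgebra := tensorCoalgebra K A
  one := (1 : TensorAlgebra K A)
  comul_mem := by
    intro n x hx
    have : wordGr A.gr n ≤ (tensorGr (tensorVect A) (tensorVect A) n).comap (deconc K A) := by
      refine Submodule.span_le.2 ?_
      rintro _ ⟨l, hl, rfl⟩
      have h : (l.map fun p => TensorAlgebra.ι K (p.2 : A)).prod =
        ((l.map fun p => (p.2 : A)).map (TensorAlgebra.ι K)).prod := by
        simp [List.map_map, Function.comp_def]
      rw [SetLike.mem_coe, Submodule.mem_comap, h, deconc_word]
      refine Submodule.sum_mem _ fun i _ => Submodule.subset_span ?_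
      refine ⟨((l.take i).map Sigma.fst).sum, ((l.drop i).map Sigma.fst).sum, ?_, _,
        word_mem A (l.take i), _, word_mem A (l.drop i), ?_⟩
      · rw [← List.sum_append, ← List.map_append, List.take_append_drop, hl]
      · rw [List.map_take, List.map_drop]
    exact this hx
  counit_eq_zero := by
    intro n hn x hx
    have : wordGr A.gr n ≤
        LinearMap.ker (TensorAlgebra.algebraMapInv : TensorAlgebra K A →ₐ[K] K).toLinearMap := by
      refine Submodule.span_le.2 ?_
      rintro _ ⟨l, hl, rfl⟩
      cases l with
      | nil => exact absurd (by simpa using hl) hn.symm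
      | cons p l => simp [TensorAlgebra.algebraMapInv]
    exact this hx
  one_mem := SetLike.GradedOne.one_mem
  comul_one := deconc_one
  counit_one := map_one (TensorAlgebra.algebraMapInv : TensorAlgebra K A →ₐ[K] K)

/-! ### Algebras, bialgebras and B-infinity algebras -/

/-- A graded associative multiplication on `V` with unit `e`. -/
structure GrAlgStr (V : GrVect K) (e : V) where
  mul : V →ₗ[K] V →ₗ[K] V
  mul_mem : ∀ i j, ∀ x ∈ V.gr i, ∀ y ∈ V.gr j, mul x y ∈ V.gr (i + j)
  one_mem : e ∈ V.gr 0
  mul_assoc : ∀ x y z, mul (mul x y) z = mul x (mul y z)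
  one_mul : ∀ x, mul e x = x
  mul_one : ∀ x, mul x e = x

/-- A differential graded algebra structure on `V` with unit `e`:
`∂` has degree `-1`, `∂² = 0` and `∂(x y) = (∂ x) y + (-1)^|x| x (∂ y)`. -/
structure DGAlgStr (V : GrVect K) (e : V) extends GrAlgStr V e where
  d : V →ₗ[K] V
  d_degree : HasDegree (-1) d
  d_d : ∀ x, d (d x) = 0
  d_mul : ∀ x y, d (mul x y) = mul (d x) y + mul (signOp V x) (d y)

/-- A differential graded bialgebra structure on the unital coalgebra `C`: a differential graded
algebra such that the multiplication `C ⊗ C → C` is a coalgebra map (for the tensor product coalgebra,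
with its Koszul signs) and the differential is a coderivation,
`Δ ∂ = (∂ ⊗ id + id ⊗ ∂) Δ`. (The unit law and the Leibniz rule give `∂ 1 = 0`.) -/
structure DGBialgStr (C : GrCoalg K) extends DGAlgStr C.toGrVect C.one where
  comul_mul : ∀ x y, C.comul (mul x y) = TensorProduct.map (TensorProduct.lift mul)
    (TensorProduct.lift mul) (midSwap C.toGrVect (C.comul x ⊗ₜ[K] C.comul y))
  counit_mul : ∀ x y, C.counit (mul x y) = C.counit x * C.counit y
  comul_d : ∀ x, C.comul (d x) = d.rTensor C (C.comul x) +
    TensorProduct.map (signOp C.toGrVect) d (C.comul x)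

/-- A (shifted) B-infinity structure on a graded vector space `A`: a differential graded bialgebra
structure on the tensor coalgebra `T^c(A)`. -/
abbrev BInfStr (A : GrVect K) := DGBialgStr (tensorCoalg A)

/-- A linear map of degree zero is a homomorphism of B-infinity algebras if the induced map
`T(f) : T^c(A) → T^c(B)` commutes with the products and the differentials. (As `T(f)` is a map of
cofree coalgebras, this amounts to `f` commuting with all structure maps `m_{i,j}` and `m_n`.) -/
structure IsBInfHom {A B : GrVect K} (S : BInfStr A) (R : BInfStr B) (f : A →ₗ[K] B) : Prop where
  degree : HasDegree 0 f
  map_mul : ∀ x y, tensorMap f (S.mul x y) = R.mul (tensorMap f x) (tensorMap f y)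
  map_d : ∀ x, tensorMap f (S.d x) = R.d (tensorMap f x)

variable (K) in
/-- A B-infinity algebra. -/
structure BInfAlg where
  space : GrVect K
  str : BInfStr space

theorem HasDegree.id (V : GrVect K) : HasDegree (V := V) (W := V) 0 LinearMap.id :=
  fun i v hv => by simpa using hv

theorem HasDegree.comp_zero {U V W : GrVect K} {g : V →ₗ[K] W} {f : U →ₗ[K] V}
    (hg : HasDegree 0 g) (hf : HasDegree 0 f) : HasDegree (V := U) (W := W) 0 (g ∘ₗ f) := by
  intro i v hv
  have := hg _ _ (hf i v hv)
  simpa using this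

/-- Homomorphisms of B-infinity algebras. -/
@[ext] structure BInfAlg.Hom (A B : BInfAlg K) where
  toLin : A.space →ₗ[K] B.space
  isHom : IsBInfHom A.str B.str toLin

instance : Category (BInfAlg K) where
  Hom := BInfAlg.Hom
  id A := ⟨LinearMap.id, HasDegree.id _, fun x y => by simp only [tensorMap_id],
    fun x => by simp only [tensorMap_id]⟩
  comp f g := ⟨g.toLin ∘ₗ f.toLin, g.isHom.degree.comp_zero f.isHom.degree,
    fun x y => by simp only [tensorMap_comp, f.isHom.map_mul, g.isHom.map_mul],
    fun x => by simp only [tensorMap_comp, f.isHom.map_d, g.isHom.map_d]⟩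

/-! ### 2-associative differential algebras and bialgebras -/

variable (K) in
/-- A 2-associative differential algebra `(V, ∂, •, ∘, 1)`: the field `dg` holds `•` and `∂`, the
field `circ` the second associative multiplication `∘`, with the same unit. -/
structure DAsAlg where
  space : GrVect K
  one : space
  dg : DGAlgStr space one
  circ : GrAlgStr space one

/-- Homomorphisms of 2-associative differential algebras. -/
structure DAsAlg.IsHom (V W : DAsAlg K) (f : V.space →ₗ[K] W.space) : Prop where
  degree : HasDegree 0 f
  map_one : f V.one = W.one
  map_bullet : ∀ x y, f (V.dg.mul x y) = W.dg.mul (f x) (f y)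
  map_circ : ∀ x y, f (V.circ.mul x y) = W.circ.mul (f x) (f y)
  map_d : ∀ x, f (V.dg.d x) = W.dg.d (f x)

/-- The linear map `T(V) → V`, `v₁ ⋯ v_k ↦ v₁ ∘ ⋯ ∘ v_k` and `1 ↦ 1`. On words of positive length
it is the projection `τ₁` of the twisting `τ` of `T^c(V)` that is determined by `∘`. -/
def DAsAlg.circProd (V : DAsAlg K) : TensorAlgebra K V.space →ₗ[K] V.space :=
  LinearMap.applyₗ V.one ∘ₗ (TensorAlgebra.lift K
    (V.circ.mul : V.space →ₗ[K] Module.End K V.space)).toLinearMap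

theorem DAsAlg.circProd_one (V : DAsAlg K) : V.circProd 1 = V.one := by
  simp [circProd]

theorem DAsAlg.circProd_ι_mul (V : DAsAlg K) (v : V.space) (x : TensorAlgebra K V.space) :
    V.circProd (TensorAlgebra.ι K v * x) = V.circ.mul v (V.circProd x) := by
  simp [circProd]

/-- `S` is the underlying B-infinity structure of `(V, ∂, •, ∘, 1)`: on the reduced tensor coalgebra,
`τ₁ (μ (x, y)) = τ₁ x • τ₁ y` and `τ₁ (d x) = ∂ (τ₁ x)`. -/
structure DAsAlg.IsUnderlying (V : DAsAlg K) (S : BInfStr V.space) : Prop where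
  mul : ∀ x y : TensorAlgebra K V.space, TensorAlgebra.algebraMapInv x = 0 →
    TensorAlgebra.algebraMapInv y = 0 →
    V.circProd (S.mul x y) = V.dg.mul (V.circProd x) (V.circProd y)
  d : ∀ x : TensorAlgebra K V.space, TensorAlgebra.algebraMapInv x = 0 →
    V.circProd (S.d x) = V.dg.d (V.circProd x)

variable (K) in
/-- A 2-associative differential bialgebra: `(V, ∂, •, Δ, 1)` is a differential graded bialgebra
and `(V, ∘, Δ, 1)` is a unital infinitesimal bialgebra,
`Δ (x ∘ y) = x₁ ⊗ (x₂ ∘ y) + (x ∘ y₁) ⊗ y₂ - x ⊗ y`. -/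
structure DAsBialg where
  coalg : GrCoalg K
  dg : DGBialgStr coalg
  circ : GrAlgStr coalg.toGrVect coalg.one
  comul_circ : ∀ x y, coalg.comul (circ.mul x y) =
    (circ.mul.flip y).lTensor coalg (coalg.comul x) +
      (circ.mul x).rTensor coalg (coalg.comul y) - x ⊗ₜ[K] y

/-- The underlying 2-associative differential algebra. -/
abbrev DAsBialg.toDAsAlg (V : DAsBialg K) : DAsAlg K where
  space := V.coalg.toGrVect
  one := V.coalg.one
  dg := V.dg.toDGAlgStr
  circ := V.circ

/-- Homomorphisms of 2-associative differential bialgebras. -/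
@[ext] structure DAsBialg.Hom (V W : DAsBialg K) where
  toLin : V.coalg →ₗ[K] W.coalg
  isHom : DAsAlg.IsHom V.toDAsAlg W.toDAsAlg toLin
  map_comul : ∀ x, W.coalg.comul (toLin x) = TensorProduct.map toLin toLin (V.coalg.comul x)
  map_counit : ∀ x, W.coalg.counit (toLin x) = V.coalg.counit x

instance : Category (DAsBialg K) where
  Hom := DAsBialg.Hom
  id V := ⟨LinearMap.id, ⟨HasDegree.id _, rfl, fun _ _ => rfl, fun _ _ => rfl, fun _ => rfl⟩,
    fun x => by simp, fun _ => rfl⟩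
  comp f g := ⟨g.toLin ∘ₗ f.toLin,
    ⟨g.isHom.degree.comp_zero f.isHom.degree,
      by simp only [LinearMap.comp_apply]; rw [f.isHom.map_one, g.isHom.map_one],
      fun x y => by simp only [LinearMap.comp_apply]; rw [f.isHom.map_bullet, g.isHom.map_bullet],
      fun x y => by simp only [LinearMap.comp_apply]; rw [f.isHom.map_circ, g.isHom.map_circ],
      fun x => by simp only [LinearMap.comp_apply]; rw [f.isHom.map_d, g.isHom.map_d]⟩,
    fun x => by
      rw [LinearMap.comp_apply, g.map_comul, f.map_comul, TensorProduct.map_comp]; rfl,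
    fun x => by rw [LinearMap.comp_apply, g.map_counit, f.map_counit]⟩

/-- Concatenation of words. -/
abbrev concat (A : GrVect K) : GrAlgStr (tensorVect A) (1 : TensorAlgebra K A) where
  mul := LinearMap.mul K (TensorAlgebra K A)
  mul_mem _ _ _ hx _ hy := SetLike.GradedMul.mul_mem hx hy
  one_mem := SetLike.GradedOne.one_mem
  mul_assoc := _root_.mul_assoc
  one_mul := _root_.one_mul
  mul_one := _root_.mul_one

theorem tensorMap_degree {A B : GrVect K} {f : A →ₗ[K] B} (hf : HasDegree 0 f) :
    HasDegree (V := tensorVect A) (W := tensorVect B) 0 (tensorMap f).toLinearMap := by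
  intro n x hx
  rw [add_zero]
  have : wordGr A.gr n ≤ (wordGr B.gr n).comap (tensorMap f).toLinearMap := by
    refine Submodule.span_le.2 ?_
    rintro _ ⟨l, rfl, rfl⟩
    clear hx
    induction l with
    | nil => simpa using (SetLike.GradedOne.one_mem : (1 : TensorAlgebra K B) ∈ wordGr B.gr 0)
    | cons p l ih =>
      have h := hf p.1 _ p.2.2
      rw [add_zero] at h
      have := SetLike.GradedMul.mul_mem (ι_mem_wordGr B.gr h) ih
      simpa using this
  exact this hx

theorem deconc_mul' (A : GrVect K) (x y : TensorAlgebra K A) : deconc K A (x * y) =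
    ((LinearMap.mul K (TensorAlgebra K A)).flip y).lTensor _ (deconc K A x) +
      ((LinearMap.mul K (TensorAlgebra K A)) x).rTensor _ (deconc K A y) - x ⊗ₜ[K] y := by
  rw [deconc_mul]
  congr 2
  · generalize deconc K A x = t
    induction t with
    | zero => simp
    | tmul a b => simp
    | add a b ha hb => rw [add_mul, ha, hb, map_add]
  · generalize deconc K A y = t
    induction t with
    | zero => simp
    | tmul a b => simp
    | add a b ha hb => rw [mul_add, ha, hb, map_add]

/-- `U(A) = (T^c(A), d, μ, ∘, Δ, 1)`, where `d` and `μ` are the B-infinity structure of `A`, `∘` is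
concatenation and `Δ` is deconcatenation. -/
abbrev envObj (A : BInfAlg K) : DAsBialg K where
  coalg := tensorCoalg A.space
  dg := A.str
  circ := concat A.space
  comul_circ x y := deconc_mul' A.space x y

variable (K) in
/-- The functor `U` from B-infinity algebras to 2-associative differential bialgebras. -/
def env : BInfAlg K ⥤ DAsBialg K where
  obj A := envObj A
  map f :=
    { toLin := (tensorMap f.toLin).toLinearMap
      isHom := ⟨tensorMap_degree f.isHom.degree, map_one (tensorMap f.toLin), f.isHom.map_mul,
        map_mul (tensorMap f.toLin), f.isHom.map_d⟩
      map_comul := tensorMap_deconc f.toLin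
      map_counit := tensorMap_counit f.toLin }
  map_id _ := DAsBialg.Hom.ext (LinearMap.ext fun x => tensorMap_id x)
  map_comp f g := DAsBialg.Hom.ext (LinearMap.ext fun x => tensorMap_comp g.toLin f.toLin x)

/-! ### Primitives -/

theorem DAsBialg.Hom.map_primitives {V W : DAsBialg K} (f : V ⟶ W) (x : V.coalg)
    (hx : x ∈ V.coalg.primitives) : f.toLin x ∈ W.coalg.primitives := by
  have h1 : V.coalg.counit x = 0 := hx.1
  have h2 : V.coalg.redComul x = 0 := hx.2
  have h3 : f.toLin V.coalg.one = W.coalg.one := f.isHom.map_one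
  refine ⟨(f.map_counit x).trans h1, ?_⟩
  change W.coalg.redComul (f.toLin x) = 0
  rw [GrCoalg.redComul_apply, f.map_comul]
  rw [GrCoalg.redComul_apply] at h2
  have := congrArg (TensorProduct.map f.toLin f.toLin) h2
  simpa [h3] using this

/-- The graded vector space of primitive elements of a bialgebra. -/
abbrev DAsBialg.prim (V : DAsBialg K) : GrVect K := V.coalg.prim

/-- The inclusion of the primitives. -/
def DAsBialg.primIncl (V : DAsBialg K) : V.prim →ₗ[K] V.coalg := V.coalg.primitives.subtype

/-- The restriction of a bialgebra homomorphism to primitives. -/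
def DAsBialg.primMap {V W : DAsBialg K} (f : V ⟶ W) : V.prim →ₗ[K] W.prim :=
  f.toLin.restrict f.map_primitives

/-- The functor `Prim` obtained from B-infinity structures on the spaces of primitives for which the
restrictions of bialgebra homomorphisms are B-infinity homomorphisms. -/
def primFunctor (P : ∀ V : DAsBialg K, BInfStr V.prim)
    (hP : ∀ {V W : DAsBialg K} (f : V ⟶ W), IsBInfHom (P V) (P W) (DAsBialg.primMap f)) :
    DAsBialg K ⥤ BInfAlg K where
  obj V := ⟨V.prim, P V⟩
  map f := ⟨DAsBialg.primMap f, hP f⟩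
  map_id _ := rfl
  map_comp _ _ := rfl

variable (K) in
/-- The conilpotent 2-associative differential bialgebras. -/
def isConil : ObjectProperty (DAsBialg K) := fun V => V.coalg.IsConilpotent

end

end BInf

open BInf

/-! The argument rests on the primitive filtration. A coalgebra whose radical is everything supports
induction along F_r, because the reduced comultiplication sends F_{r+1} into F_r ⊗ F_r. The tensor
coalgebra has this property, and so do its tensor products, since F_i ⊗ F_j lies in F_{i+j}
(`tensorCoalg_radical`, `GrCoalg.tmul_mem_filt`).

Uniqueness: the primitives of T^c(V) are the letters, and `circProd` is the identity on letters. So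
a coderivation along two coalgebra maps, from such a coalgebra to T^c(V), vanishes once `circProd`
kills it (`eq_zero_of_circProd_eq_zero`). A difference of two coalgebra maps is of this kind
(`coalgHom_ext`). Existence: T^c(V) is cofree with `circProd` in the role of the projection to
cogenerators (`exists_coalgHom`, `exists_coderivation`). The maps are given by convolution equations
that are contractions for the filtration, and identities between them follow from uniqueness of the
fixed point. Thus • and ∂ on V lift to μ and d, and associativity, Leibniz rule and d² = 0 may be
checked after `circProd`, where they are axioms of V. The same principle compares homomorphisms U(A)
→ V with B-infinity homomorphisms from A.

For a bialgebra V the map E = `ofPrim`, p₁ ⋯ p_k ↦ p₁ ∘ ⋯ ∘ p_k, is a coalgebra map: for primitive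
p, the infinitesimal relation for Δ(p ∘ w) is the recursion of deconcatenation. It is injective
because it is so on primitives. Its image is the radical (`range_ofPrim`): given x in F_{r+1} ∩ ker
ε, lift Δ̄x to a tensor t over T^c(Prim V). Coassociativity makes t a cocycle, cofreeness produces y
with Δ̄y = t, and x − E(y) is primitive.

The radical is closed under • and ∂, so these transport along E to a B-infinity structure on Prim(V)
(`exists_primStr`), and E is a bialgebra map U(Prim V) → V. It is the counit. The unit is the
inclusion of letters, bijective onto Prim(U(A)), and the triangle identities hold on letters.
Finally `GrCoalg.isConilpotent_iff` identifies conilpotence with the radical being everything, so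
the counit is invertible exactly at conilpotent objects. The equivalence and the coreflection then
follow formally. -/

namespace BInf
noncomputable section
variable {K : Type u} [Field K]

/-! ### Koszul signs -/

variable (K) in
/-- The sign `(-1)^n` as a scalar. -/
def ksgn (n : ℤ) : K := (((-1 : ℤˣ) ^ n : ℤˣ) : ℤ)

theorem ksgn_add (m n : ℤ) : ksgn K (m + n) = ksgn K m * ksgn K n := by
  simp [ksgn, zpow_add]

@[simp] theorem ksgn_zero : ksgn K 0 = 1 := by simp [ksgn]

theorem ksgn_mul_self (n : ℤ) : ksgn K n * ksgn K n = 1 := by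
  rcases Int.units_eq_one_or ((-1 : ℤˣ) ^ n) with h | h <;> simp [ksgn, h]

theorem ksgn_neg (n : ℤ) : ksgn K (-n) = ksgn K n := by
  simp [ksgn]

theorem ksgn_neg_one : ksgn K (-1) = -1 := by simp [ksgn]

theorem neg_one_zpow_smul {M : Type*} [AddCommGroup M] [Module K M] (n : ℤ) (x : M) :
    ((-1 : ℤˣ) ^ n) • x = ksgn K n • x := by
  rcases Int.units_eq_one_or ((-1 : ℤˣ) ^ n) with h | h <;> simp [ksgn, h]

theorem signOp_eq (V : GrVect K) {i : ℤ} {v : V} (hv : v ∈ V.gr i) :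
    signOp V v = ksgn K i • v := by
  rw [signOp_apply V hv, neg_one_zpow_smul (K := K)]

theorem braid_eq (V W : GrVect K) {i j : ℤ} {v : V} {w : W} (hv : v ∈ V.gr i) (hw : w ∈ W.gr j) :
    braid V W (v ⊗ₜ w) = ksgn K (i * j) • (w ⊗ₜ[K] v) := by
  rw [braid_tmul V W hv hw, neg_one_zpow_smul (K := K)]

/-! ### Homogeneous elements and maps -/

namespace GrVect

/-- Every element is a finite sum of its homogeneous components. This reduces each Koszul sign
identity to homogeneous arguments, where the sign is an explicit scalar. -/
theorem hom_ext {V : GrVect K} {X : Type*} [AddCommMonoid X] [Module K X] {f g : V →ₗ[K] X}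
    (h : ∀ i, ∀ v ∈ V.gr i, f v = g v) : f = g := by
  ext v
  obtain ⟨s, hs⟩ := V.sum_proj v
  rw [← hs s subset_rfl, map_sum, map_sum]
  exact Finset.sum_congr rfl fun a _ => h a _ (V.proj_mem a v)

theorem proj_comp {V W : GrVect K} {n : ℤ} {f : V →ₗ[K] W} (hf : HasDegree n f) (a : ℤ) (v : V) :
    W.proj (a + n) (f v) = f (V.proj a v) := by
  have : W.proj (a + n) ∘ₗ f = f ∘ₗ V.proj a := by
    refine hom_ext fun i v hv => ?_
    by_cases h : i = a
    · subst h
      simp [W.proj_same (hf _ _ hv), V.proj_same hv]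
    · simp [W.proj_ne (hf _ _ hv) (b := a + n) (by omega), V.proj_ne hv h]
  exact DFunLike.congr_fun this v

/-- A map of degree zero commutes with the projections to homogeneous parts, so an injective one
reflects degrees. Inverses and transported structures get their degrees from this. -/
theorem mem_of_injective {V W : GrVect K} {f : V →ₗ[K] W} (hf : HasDegree 0 f)
    (hinj : Function.Injective f) {n : ℤ} {v : V} (h : f v ∈ W.gr n) : v ∈ V.gr n := by
  have h1 := proj_comp hf n v
  rw [add_zero, W.proj_same h] at h1
  rw [hinj h1]
  exact V.proj_mem n v

theorem tmul_mem_tensorGr {V W : GrVect K} {i j n : ℤ} (h : i + j = n) {v : V} {w : W}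
    (hv : v ∈ V.gr i) (hw : w ∈ W.gr j) : v ⊗ₜ[K] w ∈ tensorGr V W n :=
  Submodule.subset_span ⟨i, j, h, v, hv, w, hw, rfl⟩

theorem proj_tensor_sum' {V W : GrVect K} (t : V ⊗[K] W) : ∃ s : Finset ℤ, ∀ s', s ⊆ s' →
    ∑ a ∈ s', ∑ b ∈ s', TensorProduct.map (V.proj a) (W.proj b) t = t := by
  classical
  induction t with
  | zero => exact ⟨∅, by simp⟩
  | tmul x y =>
    obtain ⟨s, hs⟩ := V.sum_proj x
    obtain ⟨s', hs'⟩ := W.sum_proj y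
    refine ⟨s ∪ s', fun u hu => ?_⟩
    simp only [TensorProduct.map_tmul, ← tmul_sum, ← sum_tmul]
    rw [hs u (Finset.union_subset_left hu), hs' u (Finset.union_subset_right hu)]
  | add x y hx hy =>
    obtain ⟨s, hs⟩ := hx
    obtain ⟨s', hs'⟩ := hy
    refine ⟨s ∪ s', fun u hu => ?_⟩
    simp only [map_add, Finset.sum_add_distrib]
    rw [hs u (Finset.union_subset_left hu), hs' u (Finset.union_subset_right hu)]

theorem map_proj_mem {V W : GrVect K} (a b : ℤ) (t : V ⊗[K] W) :
    TensorProduct.map (V.proj a) (W.proj b) t ∈ tensorGr V W (a + b) := by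
  induction t with
  | zero => simp
  | tmul x y => exact tmul_mem_tensorGr rfl (V.proj_mem a x) (W.proj_mem b y)
  | add x y hx hy => rw [map_add]; exact Submodule.add_mem _ hx hy

theorem map_proj_tensorGr {V W : GrVect K} {n a b : ℤ} (h : a + b ≠ n) {t : V ⊗[K] W}
    (ht : t ∈ tensorGr V W n) : TensorProduct.map (V.proj a) (W.proj b) t = 0 := by
  have : tensorGr V W n ≤ LinearMap.ker (TensorProduct.map (V.proj a) (W.proj b)) := by
    refine Submodule.span_le.2 ?_
    rintro _ ⟨i, j, hij, x, hx, y, hy, rfl⟩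
    simp only [SetLike.mem_coe, LinearMap.mem_ker, TensorProduct.map_tmul]
    by_cases hi : i = a
    · rw [W.proj_ne hy (b := b) (by omega), tmul_zero]
    · rw [V.proj_ne hx hi, zero_tmul]
  exact this ht

/-- The tensor product of graded vector spaces. -/
abbrev tensor (V W : GrVect K) : GrVect K where
  carrier := V ⊗[K] W
  gr := tensorGr V W
  isInternal := by
    classical
    rw [DirectSum.isInternal_submodule_iff_iSupIndep_and_iSup_eq_top]
    constructor
    · intro n
      rw [Submodule.disjoint_def]
      intro x hx hx'
      -- Split into bidegrees (a, b): a component with a + b ≠ n vanishes since x has degree n, one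
      -- with a + b = n since x lies in the sum of the other degrees.
      obtain ⟨s, hs⟩ := proj_tensor_sum' x
      rw [← hs s subset_rfl]
      refine Finset.sum_eq_zero fun a _ => Finset.sum_eq_zero fun b _ => ?_
      by_cases h : a + b = n
      · have hle : ⨆ j, ⨆ (_ : j ≠ n), tensorGr V W j ≤
            LinearMap.ker (TensorProduct.map (V.proj a) (W.proj b)) :=
          iSup₂_le fun j hj y hy => map_proj_tensorGr (by omega) hy
        exact hle hx'
      · exact map_proj_tensorGr h hx
    · rw [eq_top_iff]
      rintro x -
      obtain ⟨s, hs⟩ := proj_tensor_sum' x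
      rw [← hs s subset_rfl]
      exact Submodule.sum_mem _ fun a _ => Submodule.sum_mem _ fun b _ =>
        Submodule.mem_iSup_of_mem (a + b) (map_proj_mem a b x)

end GrVect

theorem HasDegree.comp {U V W : GrVect K} {m n : ℤ} {g : V →ₗ[K] W} {f : U →ₗ[K] V}
    (hg : HasDegree n g) (hf : HasDegree m f) :
    HasDegree (V := U) (W := W) (m + n) (g ∘ₗ f) := by
  intro i v hv
  rw [← add_assoc]
  exact hg _ _ (hf i v hv)

theorem HasDegree.map {V V' W W' : GrVect K} {m n : ℤ} {f : V →ₗ[K] V'} {g : W →ₗ[K] W'}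
    (hf : HasDegree m f) (hg : HasDegree n g) :
    HasDegree (V := V.tensor W) (W := V'.tensor W') (m + n) (TensorProduct.map f g) := by
  intro k t ht
  have : tensorGr V W k ≤ (tensorGr V' W' (k + (m + n))).comap (TensorProduct.map f g) := by
    refine Submodule.span_le.2 ?_
    rintro _ ⟨i, j, hij, x, hx, y, hy, rfl⟩
    exact GrVect.tmul_mem_tensorGr (by omega) (hf _ _ hx) (hg _ _ hy)
  exact this ht

theorem HasDegree.map_zero {V V' W W' : GrVect K} {f : V →ₗ[K] V'} {g : W →ₗ[K] W'}
    (hf : HasDegree 0 f) (hg : HasDegree 0 g) :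
    HasDegree (V := V.tensor W) (W := V'.tensor W') 0 (TensorProduct.map f g) := by
  simpa using hf.map hg

theorem signOp_comp {V W : GrVect K} {n : ℤ} {f : V →ₗ[K] W} (hf : HasDegree n f) (v : V) :
    signOp W (f v) = ksgn K n • f (signOp V v) := by
  have : signOp W ∘ₗ f = ksgn K n • f ∘ₗ signOp V := by
    refine GrVect.hom_ext fun i v hv => ?_
    simp [signOp_eq V hv, signOp_eq W (hf _ _ hv), ksgn_add, smul_smul, mul_comm]
  exact DFunLike.congr_fun this v

theorem signOp_comp_zero {V W : GrVect K} {f : V →ₗ[K] W} (hf : HasDegree 0 f) (v : V) :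
    signOp W (f v) = f (signOp V v) := by
  rw [signOp_comp hf, ksgn_zero, one_smul]

theorem signOp_signOp (V : GrVect K) (v : V) : signOp V (signOp V v) = v := by
  have : signOp V ∘ₗ signOp V = LinearMap.id := by
    refine GrVect.hom_ext fun i v hv => ?_
    simp [signOp_eq V hv, smul_smul, ksgn_mul_self]
  exact DFunLike.congr_fun this v

theorem signOp_degree (V : GrVect K) : HasDegree 0 (signOp V) := by
  intro i v hv
  rw [signOp_eq V hv, add_zero]
  exact Submodule.smul_mem _ _ hv

theorem signOp_tensor (V W : GrVect K) :
    signOp (V.tensor W) = TensorProduct.map (signOp V) (signOp W) := by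
  refine TensorProduct.ext (GrVect.hom_ext fun i v hv => GrVect.hom_ext fun j w hw => ?_)
  change signOp (V.tensor W) (v ⊗ₜ w) = signOp V v ⊗ₜ signOp W w
  rw [signOp_eq (V.tensor W) (GrVect.tmul_mem_tensorGr rfl hv hw), signOp_eq V hv, signOp_eq W hw,
    ksgn_add, smul_tmul_smul]

/-! ### The interchange of the inner factors -/

/-- The interchange of the two inner factors, with its Koszul sign:
`(a ⊗ b) ⊗ (c ⊗ d) ↦ (-1)^(|b| |c|) (a ⊗ c) ⊗ (b ⊗ d)`. -/
def gswap (V V' W W' : GrVect K) :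
    (V ⊗[K] V') ⊗[K] (W ⊗[K] W') →ₗ[K] (V ⊗[K] W) ⊗[K] (V' ⊗[K] W') :=
  (TensorProduct.assoc K V W (V' ⊗[K] W')).symm.toLinearMap ∘ₗ
    ((TensorProduct.assoc K W V' W').toLinearMap ∘ₗ (braid V' W).rTensor W' ∘ₗ
      (TensorProduct.assoc K V' W W').symm.toLinearMap).lTensor V ∘ₗ
    (TensorProduct.assoc K V V' (W ⊗[K] W')).toLinearMap

theorem midSwap_eq_gswap (V : GrVect K) : midSwap V = gswap V V V V := rfl

theorem gswap_tmul (V V' W W' : GrVect K) {i j : ℤ} (a : V) (d : W') {b : V'} {c : W}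
    (hb : b ∈ V'.gr i) (hc : c ∈ W.gr j) :
    gswap V V' W W' ((a ⊗ₜ b) ⊗ₜ (c ⊗ₜ d)) = ksgn K (i * j) • ((a ⊗ₜ[K] c) ⊗ₜ[K] (b ⊗ₜ[K] d)) := by
  simp [gswap, braid_eq V' W hb hc, ← smul_tmul']

/-- The sign depends only on the two inner factors, so only the maps on these have to preserve
degrees. -/
theorem gswap_map {V V' W W' X X' Y Y' : GrVect K} (f : V →ₗ[K] X) {f' : V' →ₗ[K] X'}
    {g : W →ₗ[K] Y} (g' : W' →ₗ[K] Y') (hf' : HasDegree 0 f') (hg : HasDegree 0 g)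
    (t : V ⊗[K] V') (s : W ⊗[K] W') :
    gswap X X' Y Y' (TensorProduct.map f f' t ⊗ₜ TensorProduct.map g g' s) =
      TensorProduct.map (TensorProduct.map f g) (TensorProduct.map f' g')
        (gswap V V' W W' (t ⊗ₜ s)) := by
  have : gswap X X' Y Y' ∘ₗ TensorProduct.map (TensorProduct.map f f') (TensorProduct.map g g') =
      TensorProduct.map (TensorProduct.map f g) (TensorProduct.map f' g') ∘ₗ gswap V V' W W' := by
    refine TensorProduct.ext (TensorProduct.ext (LinearMap.ext fun a => GrVect.hom_ext
      fun i b hb => TensorProduct.ext (GrVect.hom_ext fun j c hc => LinearMap.ext fun d => ?_)))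
    have hb' := hf' _ _ hb
    have hc' := hg _ _ hc
    rw [add_zero] at hb' hc'
    change gswap X X' Y Y' ((f a ⊗ₜ f' b) ⊗ₜ (g c ⊗ₜ g' d)) = TensorProduct.map _ _
      (gswap V V' W W' ((a ⊗ₜ b) ⊗ₜ (c ⊗ₜ d)))
    rw [gswap_tmul _ _ _ _ _ _ hb hc, gswap_tmul _ _ _ _ _ _ hb' hc']
    simp
  exact DFunLike.congr_fun this (t ⊗ₜ s)

theorem gswap_degree (V V' W W' : GrVect K) :
    HasDegree (V := (V.tensor V').tensor (W.tensor W')) (W := (V.tensor W).tensor (V'.tensor W'))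
      0 (gswap V V' W W') := by
  intro n t ht
  rw [add_zero]
  revert t
  change tensorGr (V.tensor V') (W.tensor W') n ≤
    (tensorGr (V.tensor W) (V'.tensor W') n).comap (gswap V V' W W')
  refine Submodule.span_le.2 ?_
  rintro _ ⟨i, j, hij, x, hx, y, hy, rfl⟩
  have h1 : tensorGr V V' i ≤ ((tensorGr (V.tensor W) (V'.tensor W') n).comap
      (gswap V V' W W')).comap ((TensorProduct.mk K (V ⊗[K] V') (W ⊗[K] W')).flip y) := by
    refine Submodule.span_le.2 ?_
    rintro _ ⟨p, q, rfl, a, ha, b, hb, rfl⟩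
    revert y
    change tensorGr W W' j ≤ ((tensorGr (V.tensor W) (V'.tensor W') n).comap
      (gswap V V' W W')).comap (TensorProduct.mk K (V ⊗[K] V') (W ⊗[K] W') (a ⊗ₜ b))
    refine Submodule.span_le.2 ?_
    rintro _ ⟨r, s, rfl, c, hc, d, hd, rfl⟩
    change gswap V V' W W' ((a ⊗ₜ b) ⊗ₜ (c ⊗ₜ d)) ∈ tensorGr (V.tensor W) (V'.tensor W') _
    rw [gswap_tmul _ _ _ _ _ _ hb hc]
    exact Submodule.smul_mem _ _ (GrVect.tmul_mem_tensorGr (i := p + r) (j := q + s) (by omega)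
      (GrVect.tmul_mem_tensorGr rfl ha hc) (GrVect.tmul_mem_tensorGr rfl hb hd))
  exact h1 hx

/-- The coherence behind the coassociativity of tensor products of coalgebras. -/
theorem gswap_coassoc (A B C X Y Z : GrVect K) (t : (A ⊗[K] B) ⊗[K] C) (s : (X ⊗[K] Y) ⊗[K] Z) :
    TensorProduct.assoc K _ _ _ ((gswap A B X Y).rTensor _
      (gswap (A.tensor B) C (X.tensor Y) Z (t ⊗ₜ s))) =
    (gswap B C Y Z).lTensor _ (gswap A (B.tensor C) X (Y.tensor Z)
      (TensorProduct.assoc K A B C t ⊗ₜ TensorProduct.assoc K X Y Z s)) := by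
  have : (TensorProduct.assoc K _ _ _).toLinearMap ∘ₗ (gswap A B X Y).rTensor _ ∘ₗ
      gswap (A.tensor B) C (X.tensor Y) Z = (gswap B C Y Z).lTensor _ ∘ₗ
      gswap A (B.tensor C) X (Y.tensor Z) ∘ₗ TensorProduct.map
      (TensorProduct.assoc K A B C).toLinearMap (TensorProduct.assoc K X Y Z).toLinearMap := by
    refine TensorProduct.ext (TensorProduct.ext (TensorProduct.ext (GrVect.hom_ext fun i a ha =>
      GrVect.hom_ext fun j b hb => GrVect.hom_ext fun k c hc => TensorProduct.ext
      (TensorProduct.ext (GrVect.hom_ext fun l x hx => GrVect.hom_ext fun m y hy =>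
      LinearMap.ext fun z => ?_)))))
    change TensorProduct.assoc K _ _ _ ((gswap A B X Y).rTensor _
      (gswap (A.tensor B) C (X.tensor Y) Z (((a ⊗ₜ b) ⊗ₜ c) ⊗ₜ ((x ⊗ₜ y) ⊗ₜ z)))) =
      (gswap B C Y Z).lTensor _ (gswap A (B.tensor C) X (Y.tensor Z)
      ((a ⊗ₜ (b ⊗ₜ c)) ⊗ₜ (x ⊗ₜ (y ⊗ₜ z))))
    rw [gswap_tmul (A.tensor B) C (X.tensor Y) Z _ _ hc (GrVect.tmul_mem_tensorGr rfl hx hy),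
      gswap_tmul A (B.tensor C) X (Y.tensor Z) _ _ (GrVect.tmul_mem_tensorGr rfl hb hc) hx]
    simp only [map_smul, LinearMap.rTensor_tmul, LinearMap.lTensor_tmul]
    rw [gswap_tmul _ _ _ _ _ _ hb hx, gswap_tmul _ _ _ _ _ _ hc hy]
    simp only [← smul_tmul', map_smul, tmul_smul, smul_smul, assoc_tmul, ← ksgn_add]
    -- Only the exponents are left to compare: k(l + m) + jl against (j + k)l + km.
    congr 2
    ring
  exact DFunLike.congr_fun this (t ⊗ₜ s)

/-- The coherence behind the associativity of tensor products of coalgebras. -/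
theorem gswap_assoc (A A' B B' C C' : GrVect K) (t : A ⊗[K] A') (s : B ⊗[K] B') (r : C ⊗[K] C') :
    TensorProduct.map (TensorProduct.assoc K A B C).toLinearMap
      (TensorProduct.assoc K A' B' C').toLinearMap
      (gswap (A.tensor B) (A'.tensor B') C C' (gswap A A' B B' (t ⊗ₜ s) ⊗ₜ r)) =
    gswap A A' (B.tensor C) (B'.tensor C') (t ⊗ₜ gswap B B' C C' (s ⊗ₜ r)) := by
  have : TensorProduct.map (TensorProduct.assoc K A B C).toLinearMap
      (TensorProduct.assoc K A' B' C').toLinearMap ∘ₗ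
      gswap (A.tensor B) (A'.tensor B') C C' ∘ₗ (gswap A A' B B').rTensor _ =
      gswap A A' (B.tensor C) (B'.tensor C') ∘ₗ (gswap B B' C C').lTensor _ ∘ₗ
        (TensorProduct.assoc K _ _ _).toLinearMap := by
    refine TensorProduct.ext (TensorProduct.ext (TensorProduct.ext (LinearMap.ext fun a =>
      GrVect.hom_ext fun i a' ha => TensorProduct.ext (GrVect.hom_ext fun j b hb =>
      GrVect.hom_ext fun k b' hb' => TensorProduct.ext (GrVect.hom_ext fun l c hc =>
      LinearMap.ext fun c' => ?_)))))
    change TensorProduct.map (TensorProduct.assoc K A B C).toLinearMap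
      (TensorProduct.assoc K A' B' C').toLinearMap (gswap (A.tensor B) (A'.tensor B') C C'
      (gswap A A' B B' ((a ⊗ₜ a') ⊗ₜ (b ⊗ₜ b')) ⊗ₜ (c ⊗ₜ c'))) = gswap A A' (B.tensor C)
      (B'.tensor C') ((a ⊗ₜ a') ⊗ₜ gswap B B' C C' ((b ⊗ₜ b') ⊗ₜ (c ⊗ₜ c')))
    rw [gswap_tmul _ _ _ _ _ _ ha hb, gswap_tmul _ _ _ _ _ _ hb' hc, ← smul_tmul', tmul_smul,
      map_smul, map_smul, map_smul,
      gswap_tmul (A.tensor B) (A'.tensor B') C C' _ _ (GrVect.tmul_mem_tensorGr rfl ha hb') hc,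
      gswap_tmul A A' (B.tensor C) (B'.tensor C') _ _ ha (GrVect.tmul_mem_tensorGr rfl hb hc)]
    simp only [map_smul, smul_smul, ← ksgn_add, TensorProduct.map_tmul, LinearEquiv.coe_coe,
      assoc_tmul]
    congr 2
    ring
  exact DFunLike.congr_fun this ((t ⊗ₜ s) ⊗ₜ r)

end
end BInf

namespace BInf
noncomputable section
variable {K : Type u} [Field K]

/-! ### Tensor products of graded coalgebras -/

/-- The sign disappears because one of the two interchanged factors is evaluated by a counit, which
vanishes outside degree zero. -/
theorem counit_gswap (C D : GrCoalg K) (t : C ⊗[K] C) (s : D ⊗[K] D) :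
    (LinearMap.mul' K K ∘ₗ TensorProduct.map C.counit D.counit).rTensor (C ⊗[K] D)
      (gswap C.toGrVect C.toGrVect D.toGrVect D.toGrVect (t ⊗ₜ s)) =
    (LinearMap.mul' K K).rTensor (C ⊗[K] D) (TensorProduct.tensorTensorTensorComm K K C K D
      (C.counit.rTensor C t ⊗ₜ D.counit.rTensor D s)) := by
  have : (LinearMap.mul' K K ∘ₗ TensorProduct.map C.counit D.counit).rTensor (C ⊗[K] D) ∘ₗ
      gswap C.toGrVect C.toGrVect D.toGrVect D.toGrVect =
    (LinearMap.mul' K K).rTensor (C ⊗[K] D) ∘ₗ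
      (TensorProduct.tensorTensorTensorComm K K C K D).toLinearMap ∘ₗ
      TensorProduct.map (C.counit.rTensor C) (D.counit.rTensor D) := by
    refine TensorProduct.ext (TensorProduct.ext (LinearMap.ext fun a => GrVect.hom_ext
      fun i b hb => TensorProduct.ext (GrVect.hom_ext fun j c hc => LinearMap.ext fun d => ?_)))
    change (LinearMap.mul' K K ∘ₗ TensorProduct.map C.counit D.counit).rTensor (C ⊗[K] D)
      (gswap C.toGrVect C.toGrVect D.toGrVect D.toGrVect ((a ⊗ₜ b) ⊗ₜ (c ⊗ₜ d))) =
      (C.counit a * D.counit c) ⊗ₜ (b ⊗ₜ d)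
    rw [gswap_tmul _ _ _ _ _ _ hb hc, map_smul]
    change ksgn K (i * j) • ((C.counit a * D.counit c) ⊗ₜ[K] (b ⊗ₜ[K] d)) = _
    by_cases h : j = 0
    · simp [h]
    · simp [show D.counit c = 0 from D.counit_eq_zero j h c hc]
  exact DFunLike.congr_fun this (t ⊗ₜ s)

theorem counit_gswap' (C D : GrCoalg K) (t : C ⊗[K] C) (s : D ⊗[K] D) :
    (LinearMap.mul' K K ∘ₗ TensorProduct.map C.counit D.counit).lTensor (C ⊗[K] D)
      (gswap C.toGrVect C.toGrVect D.toGrVect D.toGrVect (t ⊗ₜ s)) =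
    (LinearMap.mul' K K).lTensor (C ⊗[K] D) (TensorProduct.tensorTensorTensorComm K C K D K
      (C.counit.lTensor C t ⊗ₜ D.counit.lTensor D s)) := by
  have : (LinearMap.mul' K K ∘ₗ TensorProduct.map C.counit D.counit).lTensor (C ⊗[K] D) ∘ₗ
      gswap C.toGrVect C.toGrVect D.toGrVect D.toGrVect =
    (LinearMap.mul' K K).lTensor (C ⊗[K] D) ∘ₗ
      (TensorProduct.tensorTensorTensorComm K C K D K).toLinearMap ∘ₗ
      TensorProduct.map (C.counit.lTensor C) (D.counit.lTensor D) := by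
    refine TensorProduct.ext (TensorProduct.ext (LinearMap.ext fun a => GrVect.hom_ext
      fun i b hb => TensorProduct.ext (GrVect.hom_ext fun j c hc => LinearMap.ext fun d => ?_)))
    change (LinearMap.mul' K K ∘ₗ TensorProduct.map C.counit D.counit).lTensor (C ⊗[K] D)
      (gswap C.toGrVect C.toGrVect D.toGrVect D.toGrVect ((a ⊗ₜ b) ⊗ₜ (c ⊗ₜ d))) =
      (a ⊗ₜ c) ⊗ₜ (C.counit b * D.counit d)
    rw [gswap_tmul _ _ _ _ _ _ hb hc, map_smul]
    change ksgn K (i * j) • ((a ⊗ₜ[K] c) ⊗ₜ[K] (C.counit b * D.counit d)) = _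
    by_cases h : i = 0
    · simp [h]
    · simp [show C.counit b = 0 from C.counit_eq_zero i h b hb]
  exact DFunLike.congr_fun this (t ⊗ₜ s)

namespace GrCoalg

theorem comul_degree (C : GrCoalg K) :
    HasDegree (V := C.toGrVect) (W := C.toGrVect.tensor C.toGrVect) 0 C.comul := by
  intro n x hx
  rw [add_zero]
  exact C.comul_mem n x hx

variable (C D : GrCoalg K)

/-- The comultiplication of a tensor product of graded coalgebras. -/
def tensorComul : C ⊗[K] D →ₗ[K] (C ⊗[K] D) ⊗[K] (C ⊗[K] D) :=
  gswap C.toGrVect C.toGrVect D.toGrVect D.toGrVect ∘ₗ TensorProduct.map C.comul D.comul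

theorem tensorComul_tmul (x : C) (y : D) : tensorComul C D (x ⊗ₜ y) =
    gswap C.toGrVect C.toGrVect D.toGrVect D.toGrVect (C.comul x ⊗ₜ D.comul y) := rfl

/-- Pulling the second comultiplication through the interchange (`h1`, `h2`) separates the signs
from the coalgebras: what remains is `gswap_coassoc` and coassociativity of each factor. -/
theorem tensorComul_coassoc : TensorProduct.assoc K (C ⊗[K] D) (C ⊗[K] D) (C ⊗[K] D) ∘ₗ
    (tensorComul C D).rTensor (C ⊗[K] D) ∘ₗ tensorComul C D =
      (tensorComul C D).lTensor (C ⊗[K] D) ∘ₗ tensorComul C D := by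
  refine TensorProduct.ext' fun x y => ?_
  have h1 : ∀ t s, (TensorProduct.map C.comul D.comul).rTensor _
      (gswap C.toGrVect C.toGrVect D.toGrVect D.toGrVect (t ⊗ₜ s)) =
      gswap (C.toGrVect.tensor C.toGrVect) C.toGrVect (D.toGrVect.tensor D.toGrVect) D.toGrVect
        (C.comul.rTensor C t ⊗ₜ D.comul.rTensor D s) := by
    intro t s
    refine Eq.trans ?_ (gswap_map (X := C.toGrVect.tensor C.toGrVect)
      (Y := D.toGrVect.tensor D.toGrVect) C.comul LinearMap.id (HasDegree.id _)
      D.comul_degree t s).symm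
    rw [LinearMap.rTensor, TensorProduct.map_id]
  have h2 : ∀ t s, (TensorProduct.map C.comul D.comul).lTensor _
      (gswap C.toGrVect C.toGrVect D.toGrVect D.toGrVect (t ⊗ₜ s)) =
      gswap C.toGrVect (C.toGrVect.tensor C.toGrVect) D.toGrVect (D.toGrVect.tensor D.toGrVect)
        (C.comul.lTensor C t ⊗ₜ D.comul.lTensor D s) := by
    intro t s
    refine Eq.trans ?_ (gswap_map (X' := C.toGrVect.tensor C.toGrVect)
      (Y' := D.toGrVect.tensor D.toGrVect) LinearMap.id D.comul C.comul_degree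
      (HasDegree.id _) t s).symm
    rw [LinearMap.lTensor, TensorProduct.map_id]
  simp only [LinearMap.comp_apply, LinearEquiv.coe_coe, tensorComul_tmul]
  rw [tensorComul, LinearMap.rTensor_comp, LinearMap.lTensor_comp, LinearMap.comp_apply,
    LinearMap.comp_apply, h1, h2]
  refine (gswap_coassoc _ _ _ _ _ _ _ _).trans ?_
  have hC := DFunLike.congr_fun (Coalgebra.coassoc (R := K) (A := C)) x
  have hD := DFunLike.congr_fun (Coalgebra.coassoc (R := K) (A := D)) y
  simp only [LinearMap.comp_apply, LinearEquiv.coe_coe] at hC hD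
  rw [hC, hD]

theorem rTensor_counit (x : C) : C.counit.rTensor C (C.comul x) = 1 ⊗ₜ x :=
  Coalgebra.rTensor_counit_comul x

theorem lTensor_counit (x : C) : C.counit.lTensor C (C.comul x) = x ⊗ₜ 1 :=
  Coalgebra.lTensor_counit_comul x

theorem tensorComul_rTensor :
    (LinearMap.mul' K K ∘ₗ TensorProduct.map C.counit D.counit).rTensor (C ⊗[K] D) ∘ₗ
      tensorComul C D = TensorProduct.mk K K (C ⊗[K] D) 1 := by
  refine TensorProduct.ext' fun x y => ?_
  rw [LinearMap.comp_apply, tensorComul_tmul, counit_gswap, rTensor_counit, rTensor_counit]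
  simp

theorem tensorComul_lTensor :
    (LinearMap.mul' K K ∘ₗ TensorProduct.map C.counit D.counit).lTensor (C ⊗[K] D) ∘ₗ
      tensorComul C D = (TensorProduct.mk K (C ⊗[K] D) K).flip 1 := by
  refine TensorProduct.ext' fun x y => ?_
  rw [LinearMap.comp_apply, tensorComul_tmul, counit_gswap', lTensor_counit, lTensor_counit]
  simp

/-- The coalgebra structure of a tensor product of graded coalgebras. -/
abbrev tensorCoalg : Coalgebra K (C ⊗[K] D) where
  comul := tensorComul C D
  counit := LinearMap.mul' K K ∘ₗ TensorProduct.map C.counit D.counit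
  coassoc := tensorComul_coassoc C D
  rTensor_counit_comp_comul := tensorComul_rTensor C D
  lTensor_counit_comp_comul := tensorComul_lTensor C D

/-- The tensor product of graded coalgebras, with the Koszul sign rule. -/
abbrev tensor : GrCoalg K where
  toGrVect := C.toGrVect.tensor D.toGrVect
  coalgebra := tensorCoalg C D
  one := C.one ⊗ₜ D.one
  comul_mem := by
    intro n x hx
    have h := (gswap_degree C.toGrVect C.toGrVect D.toGrVect D.toGrVect).comp_zero
      (C.comul_degree.map_zero D.comul_degree) n x hx
    rwa [add_zero] at h
  counit_eq_zero := by
    intro n hn x hx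
    have : tensorGr C.toGrVect D.toGrVect n ≤
        LinearMap.ker (LinearMap.mul' K K ∘ₗ TensorProduct.map C.counit D.counit) := by
      refine Submodule.span_le.2 ?_
      rintro _ ⟨i, j, hij, a, ha, b, hb, rfl⟩
      change C.counit a * D.counit b = 0
      by_cases hi : i = 0
      · rw [show D.counit b = 0 from D.counit_eq_zero j (by omega) b hb, mul_zero]
      · rw [show C.counit a = 0 from C.counit_eq_zero i hi a ha, zero_mul]
    exact this hx
  one_mem := GrVect.tmul_mem_tensorGr (add_zero 0) C.one_mem D.one_mem
  comul_one := by
    change tensorComul C D _ = _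
    rw [tensorComul_tmul, show C.comul C.one = _ from C.comul_one,
      show D.comul D.one = _ from D.comul_one, gswap_tmul _ _ _ _ _ _ C.one_mem D.one_mem]
    simp
  counit_one := by
    change C.counit C.one * D.counit D.one = 1
    rw [show C.counit C.one = 1 from C.counit_one, show D.counit D.one = 1 from D.counit_one,
      mul_one]

theorem tensor_comul_tmul (x : C) (y : D) : (C.tensor D).comul (x ⊗ₜ y) =
    gswap C.toGrVect C.toGrVect D.toGrVect D.toGrVect (C.comul x ⊗ₜ D.comul y) := rfl

theorem tensor_counit_tmul (x : C) (y : D) :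
    (C.tensor D).counit (x ⊗ₜ y) = C.counit x * D.counit y := rfl

end GrCoalg

/-- Homomorphisms of graded coalgebras with unit. -/
structure IsCoalgHom {C D : GrCoalg K} (f : C →ₗ[K] D) : Prop where
  degree : HasDegree 0 f
  comul : ∀ x, D.comul (f x) = TensorProduct.map f f (C.comul x)
  counit : ∀ x, D.counit (f x) = C.counit x
  one : f C.one = D.one

namespace IsCoalgHom

theorem id (C : GrCoalg K) : IsCoalgHom (LinearMap.id : C →ₗ[K] C) :=
  ⟨HasDegree.id _, fun x => by simp, fun _ => rfl, rfl⟩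

theorem comp {C D E : GrCoalg K} {g : D →ₗ[K] E} {f : C →ₗ[K] D} (hg : IsCoalgHom g)
    (hf : IsCoalgHom f) : IsCoalgHom (g ∘ₗ f) where
  degree := hg.degree.comp_zero hf.degree
  comul x := by
    rw [LinearMap.comp_apply, hg.comul, hf.comul, TensorProduct.map_comp, LinearMap.comp_apply]
  counit x := by rw [LinearMap.comp_apply, hg.counit, hf.counit]
  one := by rw [LinearMap.comp_apply, hf.one, hg.one]

theorem tensor {C D C' D' : GrCoalg K} {f : C →ₗ[K] C'} {g : D →ₗ[K] D'} (hf : IsCoalgHom f)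
    (hg : IsCoalgHom g) :
    IsCoalgHom (C := C.tensor D) (D := C'.tensor D') (TensorProduct.map f g) where
  degree := hf.degree.map_zero hg.degree
  comul := by
    refine DFunLike.congr_fun (f := (C'.tensor D').comul ∘ₗ TensorProduct.map f g) (g :=
      TensorProduct.map (TensorProduct.map f g) (TensorProduct.map f g) ∘ₗ (C.tensor D).comul) ?_
    refine TensorProduct.ext' fun x y => ?_
    rw [LinearMap.comp_apply, TensorProduct.map_tmul, GrCoalg.tensor_comul_tmul, hf.comul, hg.comul,
      gswap_map _ _ hf.degree hg.degree]
    rfl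
  counit := by
    refine DFunLike.congr_fun (f := (C'.tensor D').counit ∘ₗ TensorProduct.map f g)
      (g := (C.tensor D).counit) ?_
    refine TensorProduct.ext' fun x y => ?_
    change C'.counit (f x) * D'.counit (g y) = C.counit x * D.counit y
    rw [hf.counit, hg.counit]
  one := by rw [TensorProduct.map_tmul, hf.one, hg.one]

theorem assoc (C D E : GrCoalg K) : IsCoalgHom (C := (C.tensor D).tensor E)
    (D := C.tensor (D.tensor E)) (TensorProduct.assoc K C D E).toLinearMap where
  degree := by
    intro n t ht
    rw [add_zero]
    revert t
    change tensorGr (C.tensor D).toGrVect E.toGrVect n ≤ (tensorGr C.toGrVect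
      (D.tensor E).toGrVect n).comap (TensorProduct.assoc K C D E).toLinearMap
    refine Submodule.span_le.2 ?_
    rintro _ ⟨i, j, hij, x, hx, c, hc, rfl⟩
    have h1 : tensorGr C.toGrVect D.toGrVect i ≤ ((tensorGr C.toGrVect
        (D.tensor E).toGrVect n).comap (TensorProduct.assoc K C D E).toLinearMap).comap
          ((TensorProduct.mk K (C ⊗[K] D) E).flip c) := by
      refine Submodule.span_le.2 ?_
      rintro _ ⟨p, q, rfl, a, ha, b, hb, rfl⟩
      exact GrVect.tmul_mem_tensorGr (i := p) (j := q + j) (W := (D.tensor E).toGrVect) (by omega)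
        ha (GrVect.tmul_mem_tensorGr rfl hb hc)
    exact h1 hx
  comul := by
    refine DFunLike.congr_fun
      (f := (C.tensor (D.tensor E)).comul ∘ₗ (TensorProduct.assoc K C D E).toLinearMap)
      (g := TensorProduct.map (TensorProduct.assoc K C D E).toLinearMap
        (TensorProduct.assoc K C D E).toLinearMap ∘ₗ ((C.tensor D).tensor E).comul) ?_
    refine TensorProduct.ext_threefold fun x y z => ?_
    exact (gswap_assoc _ _ _ _ _ _ (C.comul x) (D.comul y) (E.comul z)).symm
  counit := by
    refine DFunLike.congr_fun
      (f := (C.tensor (D.tensor E)).counit ∘ₗ (TensorProduct.assoc K C D E).toLinearMap)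
      (g := ((C.tensor D).tensor E).counit) ?_
    refine TensorProduct.ext_threefold fun x y z => ?_
    exact (mul_assoc (C.counit x) (D.counit y) (E.counit z)).symm
  one := rfl

end IsCoalgHom

/-! ### Tensor products of subspaces -/

section Tens
variable {V W : Type u} [AddCommGroup V] [Module K V] [AddCommGroup W] [Module K W]

/-- The subspace `F ⊗ G` of `V ⊗ W`. -/
abbrev tens (F : Submodule K V) (G : Submodule K W) : Submodule K (V ⊗[K] W) :=
  LinearMap.range (TensorProduct.map F.subtype G.subtype)

theorem tmul_mem_tens {F : Submodule K V} {G : Submodule K W} {a : V} {b : W} (ha : a ∈ F)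
    (hb : b ∈ G) : a ⊗ₜ[K] b ∈ tens F G :=
  ⟨⟨a, ha⟩ ⊗ₜ ⟨b, hb⟩, rfl⟩

theorem tens_le {F : Submodule K V} {G : Submodule K W} {S : Submodule K (V ⊗[K] W)}
    (h : ∀ a ∈ F, ∀ b ∈ G, a ⊗ₜ[K] b ∈ S) : tens F G ≤ S := by
  rintro _ ⟨t, rfl⟩
  induction t using TensorProduct.induction_on with
  | zero => simp
  | tmul a b => exact h _ a.2 _ b.2
  | add x y hx hy => rw [map_add]; exact S.add_mem hx hy

theorem tens_mono {F F' : Submodule K V} {G G' : Submodule K W} (hF : F ≤ F') (hG : G ≤ G') :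
    tens F G ≤ tens F' G' :=
  tens_le fun _ ha _ hb => tmul_mem_tens (hF ha) (hG hb)

theorem map_mem_tens {V' W' : Type u} [AddCommGroup V'] [Module K V'] [AddCommGroup W']
    [Module K W'] {F : Submodule K V} {G : Submodule K W} {F' : Submodule K V'}
    {G' : Submodule K W'} {f : V →ₗ[K] V'} {g : W →ₗ[K] W'} (hf : ∀ a ∈ F, f a ∈ F')
    (hg : ∀ b ∈ G, g b ∈ G') {t : V ⊗[K] W} (ht : t ∈ tens F G) :
    TensorProduct.map f g t ∈ tens F' G' :=
  tens_le (S := (tens F' G').comap (TensorProduct.map f g))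
    (fun _ ha _ hb => tmul_mem_tens (hf _ ha) (hg _ hb)) ht

/-- Two linear maps on a tensor product agree on `F ⊗ G` if they agree on its pure tensors. -/
theorem eq_of_mem_tens {X : Type*} [AddCommGroup X] [Module K X] {F : Submodule K V}
    {G : Submodule K W} {f g : V ⊗[K] W →ₗ[K] X}
    (h : ∀ a ∈ F, ∀ b ∈ G, f (a ⊗ₜ b) = g (a ⊗ₜ b)) {t : V ⊗[K] W} (ht : t ∈ tens F G) :
    f t = g t :=
  tens_le (S := LinearMap.eqLocus f g) h ht

end Tens

/-! ### The primitive filtration -/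

/-- The interchange is computed on homogeneous inner factors. Closure of B and C under homogeneous
components allows these factors to be split without leaving the subspaces. -/
theorem gswap_mem_tens {V V' W W' : GrVect K} {A : Submodule K V} {B : Submodule K V'}
    {C : Submodule K W} {D : Submodule K W'} (hB : ∀ x ∈ B, ∀ a, V'.proj a x ∈ B)
    (hC : ∀ x ∈ C, ∀ a, W.proj a x ∈ C) {H : Submodule K (V ⊗[K] W)} {H' : Submodule K (V' ⊗[K] W')}
    (h : ∀ a ∈ A, ∀ c ∈ C, a ⊗ₜ[K] c ∈ H) (h' : ∀ b ∈ B, ∀ d ∈ D, b ⊗ₜ[K] d ∈ H')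
    {t : V ⊗[K] V'} {s : W ⊗[K] W'} (ht : t ∈ tens A B) (hs : s ∈ tens C D) :
    gswap V V' W W' (t ⊗ₜ s) ∈ tens H H' := by
  refine tens_le (S := ((tens H H').comap (gswap V V' W W')).comap
    ((TensorProduct.mk K (V ⊗[K] V') (W ⊗[K] W')).flip s)) (fun a ha b hb => ?_) ht
  refine tens_le (S := ((tens H H').comap (gswap V V' W W')).comap
    (TensorProduct.mk K (V ⊗[K] V') (W ⊗[K] W') (a ⊗ₜ b))) (fun c hc d hd => ?_) hs
  change gswap V V' W W' ((a ⊗ₜ b) ⊗ₜ (c ⊗ₜ d)) ∈ tens H H'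
  obtain ⟨p, hp⟩ := V'.sum_proj b
  obtain ⟨q, hq⟩ := W.sum_proj c
  rw [← hp p subset_rfl, ← hq q subset_rfl]
  simp only [tmul_sum, sum_tmul, map_sum]
  refine Submodule.sum_mem _ fun i _ => Submodule.sum_mem _ fun j _ => ?_
  rw [gswap_tmul _ _ _ _ _ _ (V'.proj_mem j b) (W.proj_mem i c)]
  exact Submodule.smul_mem _ _ (tmul_mem_tens (h _ ha _ (hC c hc i)) (h' _ (hB b hb j) _ hd))

namespace GrCoalg
variable (C : GrCoalg K)

theorem redComul_one : C.redComul C.one = -(C.one ⊗ₜ C.one) := by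
  rw [redComul_apply, show C.comul C.one = _ from C.comul_one]
  abel

theorem comul_eq (x : C) : C.comul x = x ⊗ₜ C.one + C.one ⊗ₜ x + C.redComul x := by
  rw [redComul_apply]; abel

theorem one_mem_filt (r : ℕ) : C.one ∈ C.filt r := by
  cases r with
  | zero => exact Submodule.mem_span_singleton_self _
  | succ r => exact Submodule.mem_sup_left (Submodule.mem_span_singleton_self _)

theorem mem_filt_zero {x : C} : x ∈ C.filt 0 ↔ ∃ c : K, c • C.one = x :=
  Submodule.mem_span_singleton

/-- No condition on the counit is needed: Δ̄1 = −1 ⊗ 1 already lies in F_r ⊗ F_r, so a multiple of 1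
can be subtracted from x. All inductions along the filtration use this form. -/
theorem mem_filt_succ {r : ℕ} {x : C} :
    x ∈ C.filt (r + 1) ↔ C.redComul x ∈ tens (C.filt r) (C.filt r) := by
  have hone : C.redComul C.one ∈ tens (C.filt r) (C.filt r) := by
    rw [redComul_one]
    exact Submodule.neg_mem _ (tmul_mem_tens (C.one_mem_filt r) (C.one_mem_filt r))
  constructor
  · have : C.filt (r + 1) ≤ (tens (C.filt r) (C.filt r)).comap C.redComul := by
      refine sup_le ?_ inf_le_right
      rw [Submodule.span_le, Set.singleton_subset_iff]
      exact hone
    exact fun h => this h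
  · intro h
    have : x = C.counit x • C.one + (x - C.counit x • C.one) := by abel
    rw [this]
    refine Submodule.add_mem_sup (Submodule.smul_mem _ _ (Submodule.mem_span_singleton_self _))
      ⟨?_, ?_⟩
    · simp [show C.counit C.one = 1 from C.counit_one]
    · change C.redComul _ ∈ tens (C.filt r) (C.filt r)
      rw [map_sub, map_smul]
      exact Submodule.sub_mem _ h (Submodule.smul_mem _ _ hone)

theorem filt_mono : Monotone C.filt := by
  refine monotone_nat_of_le_succ fun r => ?_
  induction r with
  | zero =>
    intro x hx
    obtain ⟨c, rfl⟩ := C.mem_filt_zero.1 hx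
    exact Submodule.smul_mem _ _ (C.one_mem_filt 1)
  | succ r ih =>
    intro x hx
    rw [mem_filt_succ] at hx ⊢
    exact tens_mono ih ih hx

theorem mem_radical {x : C} : x ∈ C.radical ↔ ∃ r, x ∈ C.filt r :=
  Submodule.mem_iSup_of_directed _ C.filt_mono.directed_le

theorem redComul_degree :
    HasDegree (V := C.toGrVect) (W := C.toGrVect.tensor C.toGrVect) 0 C.redComul := by
  intro n x hx
  rw [add_zero]
  exact C.redComul_mem n hx

theorem filt_proj (r : ℕ) : ∀ x ∈ C.filt r, ∀ a, C.proj a x ∈ C.filt r := by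
  induction r with
  | zero =>
    intro x hx a
    obtain ⟨c, rfl⟩ := C.mem_filt_zero.1 hx
    rw [map_smul]
    refine Submodule.smul_mem _ _ ?_
    by_cases h : a = 0
    · rw [h, C.proj_same C.one_mem]; exact C.one_mem_filt 0
    · rw [C.proj_ne C.one_mem (Ne.symm h)]; exact Submodule.zero_mem _
  | succ r ih =>
    intro x hx a
    rw [mem_filt_succ] at hx ⊢
    rw [← GrVect.proj_comp C.redComul_degree, add_zero]
    refine tens_le (S := (tens (C.filt r) (C.filt r)).comap
      ((C.toGrVect.tensor C.toGrVect).proj a)) (fun b hb c hc => ?_) hx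
    rw [Submodule.mem_comap]
    obtain ⟨p, hp⟩ := C.sum_proj b
    obtain ⟨q, hq⟩ := C.sum_proj c
    rw [← hp p subset_rfl, ← hq q subset_rfl]
    simp only [tmul_sum, sum_tmul, map_sum]
    refine Submodule.sum_mem _ fun i _ => Submodule.sum_mem _ fun j _ => ?_
    have hm := GrVect.tmul_mem_tensorGr rfl (C.proj_mem j b) (C.proj_mem i c)
    by_cases h : j + i = a
    · rw [GrVect.proj_same (C.toGrVect.tensor C.toGrVect) (h ▸ hm)]
      exact tmul_mem_tens (ih _ hb _) (ih _ hc _)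
    · rw [GrVect.proj_ne (C.toGrVect.tensor C.toGrVect) hm h]
      exact Submodule.zero_mem _

end GrCoalg

theorem IsCoalgHom.redComul {C D : GrCoalg K} {f : C →ₗ[K] D} (hf : IsCoalgHom f) (x : C) :
    D.redComul (f x) = TensorProduct.map f f (C.redComul x) := by
  simp [GrCoalg.redComul_apply, hf.comul, hf.one]

theorem IsCoalgHom.map_filt {C D : GrCoalg K} {f : C →ₗ[K] D} (hf : IsCoalgHom f) (r : ℕ) :
    ∀ x ∈ C.filt r, f x ∈ D.filt r := by
  induction r with
  | zero =>
    intro x hx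
    obtain ⟨c, rfl⟩ := C.mem_filt_zero.1 hx
    rw [map_smul, hf.one]
    exact Submodule.smul_mem _ _ (D.one_mem_filt 0)
  | succ r ih =>
    intro x hx
    rw [GrCoalg.mem_filt_succ] at hx ⊢
    rw [hf.redComul]
    exact map_mem_tens ih ih hx

theorem IsCoalgHom.map_radical {C D : GrCoalg K} {f : C →ₗ[K] D} (hf : IsCoalgHom f) {x : C}
    (hx : x ∈ C.radical) : f x ∈ D.radical := by
  rw [GrCoalg.mem_radical] at hx ⊢
  obtain ⟨r, hr⟩ := hx
  exact ⟨r, hf.map_filt r x hr⟩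

/-! ### The primitive filtration of a tensor product. -/

namespace GrCoalg
variable (C D : GrCoalg K)

theorem isCoalgHom_one_tmul :
    IsCoalgHom (C := D) (D := C.tensor D) (TensorProduct.mk K C D C.one) where
  degree i v hv := GrVect.tmul_mem_tensorGr (by omega) C.one_mem hv
  comul x := by
    rw [mk_apply, tensor_comul_tmul, show C.comul C.one = _ from C.comul_one]
    generalize D.comul x = t
    have : gswap C.toGrVect C.toGrVect D.toGrVect D.toGrVect ∘ₗ
        TensorProduct.mk K _ _ (C.one ⊗ₜ C.one) =
        TensorProduct.map (TensorProduct.mk K C D C.one) (TensorProduct.mk K C D C.one) := by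
      refine TensorProduct.ext (GrVect.hom_ext fun j c hc => LinearMap.ext fun d => ?_)
      change gswap C.toGrVect C.toGrVect D.toGrVect D.toGrVect
        ((C.one ⊗ₜ C.one) ⊗ₜ (c ⊗ₜ d)) = (C.one ⊗ₜ c) ⊗ₜ (C.one ⊗ₜ d)
      rw [gswap_tmul _ _ _ _ _ _ C.one_mem hc]
      simp
    exact DFunLike.congr_fun this t
  counit x := by
    rw [mk_apply, tensor_counit_tmul, show C.counit C.one = 1 from C.counit_one, one_mul]
  one := rfl

theorem isCoalgHom_tmul_one :
    IsCoalgHom (C := C) (D := C.tensor D) ((TensorProduct.mk K C D).flip D.one) where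
  degree i v hv := GrVect.tmul_mem_tensorGr (by omega) hv D.one_mem
  comul x := by
    rw [LinearMap.flip_apply, mk_apply, tensor_comul_tmul,
      show D.comul D.one = _ from D.comul_one]
    generalize C.comul x = t
    have : gswap C.toGrVect C.toGrVect D.toGrVect D.toGrVect ∘ₗ
        (TensorProduct.mk K _ _).flip (D.one ⊗ₜ D.one) =
        TensorProduct.map ((TensorProduct.mk K C D).flip D.one)
          ((TensorProduct.mk K C D).flip D.one) := by
      refine TensorProduct.ext (LinearMap.ext fun c => GrVect.hom_ext fun j d hd => ?_)
      change gswap C.toGrVect C.toGrVect D.toGrVect D.toGrVect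
        ((c ⊗ₜ d) ⊗ₜ (D.one ⊗ₜ D.one)) = (c ⊗ₜ D.one) ⊗ₜ (d ⊗ₜ D.one)
      rw [gswap_tmul _ _ _ _ _ _ hd D.one_mem]
      simp
    exact DFunLike.congr_fun this t
  counit x := by
    rw [LinearMap.flip_apply, mk_apply, tensor_counit_tmul,
      show D.counit D.one = 1 from D.counit_one, mul_one]
  one := rfl

/-- Expand Δx · Δy with Δx = x ⊗ 1 + 1 ⊗ x + Δ̄x and likewise for y. Of the nine products, the two
extreme ones are removed by passing to the reduced comultiplication. In each of the other seven both
tensor factors have strictly smaller total filtration. This needs i, j > 0; if i or j is 0, one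
factor is a multiple of 1 and the inclusion x ↦ 1 ⊗ x or x ↦ x ⊗ 1 is a coalgebra map. -/
theorem tmul_mem_filt (n : ℕ) : ∀ i j, i + j ≤ n → ∀ x ∈ C.filt i, ∀ y ∈ D.filt j,
    x ⊗ₜ[K] y ∈ (C.tensor D).filt n := by
  have hl : ∀ {j n : ℕ}, j ≤ n → ∀ x ∈ C.filt 0, ∀ y ∈ D.filt j,
      x ⊗ₜ[K] y ∈ (C.tensor D).filt n := by
    intro j n hj x hx y hy
    obtain ⟨c, rfl⟩ := C.mem_filt_zero.1 hx
    rw [← smul_tmul']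
    exact Submodule.smul_mem _ _ ((isCoalgHom_one_tmul C D).map_filt n y (D.filt_mono hj hy))
  have hr : ∀ {i n : ℕ}, i ≤ n → ∀ x ∈ C.filt i, ∀ y ∈ D.filt 0,
      x ⊗ₜ[K] y ∈ (C.tensor D).filt n := by
    intro i n hi x hx y hy
    obtain ⟨c, rfl⟩ := D.mem_filt_zero.1 hy
    rw [tmul_smul]
    exact Submodule.smul_mem _ _ ((isCoalgHom_tmul_one C D).map_filt n x (C.filt_mono hi hx))
  induction n with
  | zero =>
    intro i j hij x hx y hy
    obtain rfl : i = 0 := by omega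
    exact hl (by omega) x hx y hy
  | succ n ih =>
    rintro (_ | i) (_ | j) hij x hx y hy
    · exact hl (by omega) x hx y hy
    · exact hl (by omega) x hx y hy
    · exact hr (by omega) x hx y hy
    rw [mem_filt_succ, redComul_apply, tensor_comul_tmul, C.comul_eq x, D.comul_eq y]
    have hx' := C.mem_filt_succ.1 hx
    have hy' := D.mem_filt_succ.1 hy
    generalize C.redComul x = x' at hx'
    generalize D.redComul y = y' at hy'
    have key : ∀ {p p' q q' : ℕ}, p + q ≤ n → p' + q' ≤ n → ∀ t ∈ tens (C.filt p) (C.filt p'),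
        ∀ s ∈ tens (D.filt q) (D.filt q'), gswap C.toGrVect C.toGrVect D.toGrVect D.toGrVect
          (t ⊗ₜ s) ∈ tens ((C.tensor D).filt n) ((C.tensor D).filt n) :=
      fun h h' t ht s hs => gswap_mem_tens (C.filt_proj _) (D.filt_proj _) (ih _ _ h) (ih _ _ h')
        ht hs
    have hx1 := tmul_mem_tens hx (C.one_mem_filt 0)
    have hx2 := tmul_mem_tens (C.one_mem_filt 0) hx
    have hy1 := tmul_mem_tens hy (D.one_mem_filt 0)
    have hy2 := tmul_mem_tens (D.one_mem_filt 0) hy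
    -- The two extreme products carry no sign since 1 has degree zero; they are exactly the terms
    -- subtracted in Δ̄(x ⊗ y).
    have e1 : gswap C.toGrVect C.toGrVect D.toGrVect D.toGrVect ((x ⊗ₜ C.one) ⊗ₜ (y ⊗ₜ D.one)) =
        (x ⊗ₜ y) ⊗ₜ (C.one ⊗ₜ D.one) := by
      have h : gswap C.toGrVect C.toGrVect D.toGrVect D.toGrVect ∘ₗ
          (TensorProduct.mk K _ _ (x ⊗ₜ C.one)) ∘ₗ (TensorProduct.mk K D D).flip D.one =
          (TensorProduct.mk K _ _).flip (C.one ⊗ₜ D.one) ∘ₗ TensorProduct.mk K C D x := by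
        refine GrVect.hom_ext fun i y hy => ?_
        change gswap C.toGrVect C.toGrVect D.toGrVect D.toGrVect
          ((x ⊗ₜ C.one) ⊗ₜ (y ⊗ₜ D.one)) = (x ⊗ₜ y) ⊗ₜ (C.one ⊗ₜ D.one)
        rw [gswap_tmul _ _ _ _ _ _ C.one_mem hy]
        simp
      exact DFunLike.congr_fun h y
    have e2 : gswap C.toGrVect C.toGrVect D.toGrVect D.toGrVect ((C.one ⊗ₜ x) ⊗ₜ (D.one ⊗ₜ y)) =
        (C.one ⊗ₜ D.one) ⊗ₜ (x ⊗ₜ y) := by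
      have h : gswap C.toGrVect C.toGrVect D.toGrVect D.toGrVect ∘ₗ
          (TensorProduct.mk K _ _).flip (D.one ⊗ₜ y) ∘ₗ TensorProduct.mk K C C C.one =
          (TensorProduct.mk K _ _) (C.one ⊗ₜ D.one) ∘ₗ (TensorProduct.mk K C D).flip y := by
        refine GrVect.hom_ext fun i x hx => ?_
        change gswap C.toGrVect C.toGrVect D.toGrVect D.toGrVect
          ((C.one ⊗ₜ x) ⊗ₜ (D.one ⊗ₜ y)) = (C.one ⊗ₜ D.one) ⊗ₜ (x ⊗ₜ y)
        rw [gswap_tmul _ _ _ _ _ _ hx D.one_mem]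
        simp
      exact DFunLike.congr_fun h x
    have : gswap C.toGrVect C.toGrVect D.toGrVect D.toGrVect
        ((x ⊗ₜ C.one + C.one ⊗ₜ x + x') ⊗ₜ (y ⊗ₜ D.one + D.one ⊗ₜ y + y')) -
        (x ⊗ₜ y) ⊗ₜ (C.one ⊗ₜ D.one) - (C.one ⊗ₜ D.one) ⊗ₜ (x ⊗ₜ y) =
        gswap C.toGrVect C.toGrVect D.toGrVect D.toGrVect ((x ⊗ₜ C.one) ⊗ₜ (D.one ⊗ₜ y)) +
        gswap C.toGrVect C.toGrVect D.toGrVect D.toGrVect ((x ⊗ₜ C.one) ⊗ₜ y') +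
        gswap C.toGrVect C.toGrVect D.toGrVect D.toGrVect ((C.one ⊗ₜ x) ⊗ₜ (y ⊗ₜ D.one)) +
        gswap C.toGrVect C.toGrVect D.toGrVect D.toGrVect ((C.one ⊗ₜ x) ⊗ₜ y') +
        gswap C.toGrVect C.toGrVect D.toGrVect D.toGrVect (x' ⊗ₜ (y ⊗ₜ D.one)) +
        gswap C.toGrVect C.toGrVect D.toGrVect D.toGrVect (x' ⊗ₜ (D.one ⊗ₜ y)) +
        gswap C.toGrVect C.toGrVect D.toGrVect D.toGrVect (x' ⊗ₜ y') := by
      simp only [add_tmul, tmul_add, map_add, ← e1, ← e2]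
      abel
    rw [this]
    refine Submodule.add_mem _ (Submodule.add_mem _ (Submodule.add_mem _ (Submodule.add_mem _
      (Submodule.add_mem _ (Submodule.add_mem _ ?_ ?_) ?_) ?_) ?_) ?_) ?_
    · exact key (by omega) (by omega) _ hx1 _ hy2
    · exact key (by omega) (by omega) _ hx1 _ hy'
    · exact key (by omega) (by omega) _ hx2 _ hy1
    · exact key (by omega) (by omega) _ hx2 _ hy'
    · exact key (by omega) (by omega) _ hx' _ hy1
    · exact key (by omega) (by omega) _ hx' _ hy2
    · exact key (by omega) (by omega) _ hx' _ hy'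

variable {C D} in
theorem tensor_radical (hC : C.radical = ⊤) (hD : D.radical = ⊤) : (C.tensor D).radical = ⊤ := by
  rw [eq_top_iff]
  rintro t -
  induction t using TensorProduct.induction_on with
  | zero => exact Submodule.zero_mem _
  | tmul x y =>
    obtain ⟨i, hi⟩ := C.mem_radical.1 (hC ▸ Submodule.mem_top : x ∈ C.radical)
    obtain ⟨j, hj⟩ := D.mem_radical.1 (hD ▸ Submodule.mem_top : y ∈ D.radical)
    exact (C.tensor D).mem_radical.2 ⟨i + j, tmul_mem_filt C D _ i j le_rfl x hi y hj⟩
  | add x y hx hy => exact Submodule.add_mem _ hx hy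

end GrCoalg

end
end BInf

namespace BInf
noncomputable section
variable {K : Type u} [Field K]

/-! ### Letters and primitive elements of the tensor coalgebra -/

section Letters
variable {M : Type u} [AddCommGroup M] [Module K M]

@[simp] theorem ιInv_ι (v : M) : TensorAlgebra.ιInv (TensorAlgebra.ι K v) = v :=
  TensorAlgebra.ι_leftInverse v

@[simp] theorem ιInv_one : TensorAlgebra.ιInv (1 : TensorAlgebra K M) = 0 := by
  -- `TensorAlgebra.ιInv` is the second component of the algebra map to the trivial square-zero
  -- extension of K by M; the algebra structure there uses this right action.
  let : Module Kᵐᵒᵖ M := Module.compHom _ ((RingHom.id K).fromOpposite mul_comm)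
  have : IsCentralScalar K M := ⟨fun r m => rfl⟩
  change TrivSqZeroExt.snd (TensorAlgebra.toTrivSqZeroExt (1 : TensorAlgebra K M)) = 0
  rw [map_one, TrivSqZeroExt.snd_one]

/-- In the square-zero extension a product of two letters is zero, so only the constant term of y
contributes. -/
theorem ιInv_ι_mul (v : M) (y : TensorAlgebra K M) :
    TensorAlgebra.ιInv (TensorAlgebra.ι K v * y) = TensorAlgebra.algebraMapInv y • v := by
  let : Module Kᵐᵒᵖ M := Module.compHom _ ((RingHom.id K).fromOpposite mul_comm)
  have : IsCentralScalar K M := ⟨fun r m => rfl⟩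
  have h : TrivSqZeroExt.fst (TensorAlgebra.toTrivSqZeroExt y) = TensorAlgebra.algebraMapInv y := by
    have : (TrivSqZeroExt.fstHom K K M).comp TensorAlgebra.toTrivSqZeroExt =
        (TensorAlgebra.algebraMapInv : TensorAlgebra K M →ₐ[K] K) := by
      ext; simp [TensorAlgebra.algebraMapInv]
    exact DFunLike.congr_fun this y
  change TrivSqZeroExt.snd (TensorAlgebra.toTrivSqZeroExt (TensorAlgebra.ι K v * y)) = _
  rw [map_mul, TensorAlgebra.toTrivSqZeroExt_ι, TrivSqZeroExt.snd_mul, h]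
  simp

theorem algebraMapInv_ι (v : M) :
    TensorAlgebra.algebraMapInv (TensorAlgebra.ι K v) = (0 : K) := by
  simp [TensorAlgebra.algebraMapInv]

/-- Every word is its first letter times the remaining word. -/
theorem eq_counit_add_mul (x : TensorAlgebra K M) :
    x = TensorAlgebra.algebraMapInv x • (1 : TensorAlgebra K M) +
      LinearMap.mul' K _ (TensorProduct.map (TensorAlgebra.ι K ∘ₗ TensorAlgebra.ιInv)
        LinearMap.id (deconc K M x)) := by
  induction x using tensor_left_induction with
  | one => simp
  | add x y hx hy =>
    nth_rewrite 1 [hx, hy]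
    simp only [map_add, add_smul]
    abel
  | smul r x hx =>
    nth_rewrite 1 [hx]
    simp only [map_smul, smul_add, smul_smul, smul_eq_mul]
  | mul v y _ =>
    have h : ∀ t : TensorAlgebra K M ⊗[K] TensorAlgebra K M, LinearMap.mul' K _
        (TensorProduct.map (TensorAlgebra.ι K ∘ₗ TensorAlgebra.ιInv) LinearMap.id
          ((LinearMap.mulLeft K (TensorAlgebra.ι K v)).rTensor (TensorAlgebra K M) t)) =
        TensorAlgebra.ι K v * TensorProduct.lid K _
          (((TensorAlgebra.algebraMapInv : TensorAlgebra K M →ₐ[K] K).toLinearMap).rTensor _ t) := by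
      intro t
      induction t with
      | zero => simp
      | tmul a b => simp [ιInv_ι_mul]
      | add a b ha hb => simp only [map_add, ha, hb, mul_add]
    have hc := DFunLike.congr_fun (deconc_counit_left (K := K) (M := M)) y
    rw [LinearMap.comp_apply] at hc
    rw [deconc_ι_mul, map_add, map_add, h, hc]
    simp [algebraMapInv_ι]

/-- Take the first letter off the left factor of x ⊗ 1 + 1 ⊗ x: the empty word has no letter, so
only the one-letter part of x is left. The counit identity gives ε(x) = 0. -/
theorem eq_ι_of_deconc_eq {x : TensorAlgebra K M}
    (h : deconc K M x = x ⊗ₜ 1 + 1 ⊗ₜ x) : x = TensorAlgebra.ι K (TensorAlgebra.ιInv x) := by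
  have h1 := eq_counit_add_mul x
  have h2 := DFunLike.congr_fun (deconc_counit_left (K := K) (M := M)) x
  rw [LinearMap.comp_apply, h] at h2
  have h3 : TensorAlgebra.algebraMapInv x • (1 : TensorAlgebra K M) = 0 := by
    simpa using congrArg (TensorProduct.lid K _) h2
  rw [h, h3] at h1
  simpa using h1

theorem wordGr_le {𝒱 : ℤ → Submodule K M} {S : ℤ → Submodule K (TensorAlgebra K M)}
    (h1 : 1 ∈ S 0)
    (h2 : ∀ i n, ∀ v ∈ 𝒱 i, ∀ x ∈ wordGr 𝒱 n, x ∈ S n → TensorAlgebra.ι K v * x ∈ S (i + n))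
    (n : ℤ) : wordGr 𝒱 n ≤ S n := by
  refine Submodule.span_le.2 ?_
  rintro _ ⟨l, rfl, rfl⟩
  induction l with
  | nil => simpa using h1
  | cons p l ih =>
    simp only [List.map_cons, List.prod_cons, List.sum_cons]
    exact h2 _ _ _ p.2.2 _ (Submodule.subset_span ⟨l, rfl, rfl⟩) ih

end Letters

theorem ιInv_degree (A : GrVect K) :
    HasDegree (V := tensorVect A) (W := A) 0 TensorAlgebra.ιInv := by
  intro n x hx
  rw [add_zero]
  refine wordGr_le (S := fun n => (A.gr n).comap TensorAlgebra.ιInv) ?_ ?_ n hx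
  · simp
  · intro i n v hv x hx _
    rw [Submodule.mem_comap, ιInv_ι_mul]
    by_cases hn : n = 0
    · subst hn
      rw [add_zero]
      exact Submodule.smul_mem _ _ hv
    · rw [show TensorAlgebra.algebraMapInv x = (0 : K) from
        (tensorCoalg A).counit_eq_zero n hn x hx, zero_smul]
      exact Submodule.zero_mem _

theorem ι_degree (A : GrVect K) :
    HasDegree (V := A) (W := tensorVect A) 0 (TensorAlgebra.ι K) := by
  intro n x hx
  rw [add_zero]
  exact ι_mem_wordGr A.gr hx

theorem DAsAlg.circProd_degree (V : DAsAlg K) :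
    HasDegree (V := tensorVect V.space) (W := V.space) 0 V.circProd := by
  intro n x hx
  rw [add_zero]
  refine wordGr_le (S := fun n => (V.space.gr n).comap V.circProd) ?_ ?_ n hx
  · rw [Submodule.mem_comap, V.circProd_one]
    exact V.circ.one_mem
  · intro i n v hv x _ hx
    rw [Submodule.mem_comap, V.circProd_ι_mul]
    exact V.circ.mul_mem _ _ _ hv _ hx

theorem DAsAlg.circProd_ι (V : DAsAlg K) (v : V.space) :
    V.circProd (TensorAlgebra.ι K v) = v := by
  rw [← mul_one (TensorAlgebra.ι K v), V.circProd_ι_mul, V.circProd_one, V.circ.mul_one]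

theorem tensorCoalg_redComul_ι_mul (A : GrVect K) (v : A) (y : TensorAlgebra K A) :
    (tensorCoalg A).redComul (TensorAlgebra.ι K v * y) = TensorAlgebra.ι K v ⊗ₜ y +
      (LinearMap.mulLeft K (TensorAlgebra.ι K v)).rTensor (TensorAlgebra K A)
        ((tensorCoalg A).redComul y) := by
  rw [GrCoalg.redComul_apply, GrCoalg.redComul_apply]
  change deconc K A _ - _ ⊗ₜ 1 - 1 ⊗ₜ _ = _ + LinearMap.rTensor _ _ (deconc K A _ - _ ⊗ₜ 1 - 1 ⊗ₜ _)
  rw [deconc_ι_mul]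
  simp only [map_sub, LinearMap.rTensor_tmul, LinearMap.mulLeft_apply, mul_one]
  abel

/-- Since Δ̄(vy) = v ⊗ y + v Δ̄(y), prepending a letter raises the filtration by at most one. Hence
words of length k lie in F_k. -/
theorem ι_mul_mem_filt (A : GrVect K) (v : A) (r : ℕ) : ∀ y ∈ (tensorCoalg A).filt r,
    TensorAlgebra.ι K v * y ∈ (tensorCoalg A).filt (r + 1) := by
  have h1 : TensorAlgebra.ι K v ∈ (tensorCoalg A).filt 1 := by
    rw [GrCoalg.mem_filt_succ]
    have h : (tensorCoalg A).redComul (TensorAlgebra.ι K v) = 0 := by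
      rw [GrCoalg.redComul_apply]
      change deconc K A _ - _ ⊗ₜ 1 - 1 ⊗ₜ _ = _
      rw [deconc_ι]; abel
    rw [h]
    exact Submodule.zero_mem _
  induction r with
  | zero =>
    intro y hy
    obtain ⟨c, rfl⟩ := (tensorCoalg A).mem_filt_zero.1 hy
    rw [mul_smul_comm, mul_one]
    exact Submodule.smul_mem _ _ h1
  | succ r ih =>
    intro y hy
    rw [GrCoalg.mem_filt_succ, tensorCoalg_redComul_ι_mul]
    refine Submodule.add_mem _ (tmul_mem_tens ((tensorCoalg A).filt_mono (by omega) h1) hy) ?_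
    rw [GrCoalg.mem_filt_succ] at hy
    exact map_mem_tens (f := LinearMap.mulLeft K (TensorAlgebra.ι K v)) (g := LinearMap.id) ih
      (fun b hb => (tensorCoalg A).filt_mono (Nat.le_succ r) hb) hy

theorem tensorCoalg_radical (A : GrVect K) : (tensorCoalg A).radical = ⊤ := by
  rw [eq_top_iff]
  rintro x -
  induction x using tensor_left_induction with
  | one => exact (tensorCoalg A).mem_radical.2 ⟨0, (tensorCoalg A).one_mem_filt 0⟩
  | add x y hx hy => exact Submodule.add_mem _ hx hy
  | smul r x hx => exact Submodule.smul_mem _ _ hx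
  | mul v y hy =>
    obtain ⟨r, hr⟩ := (tensorCoalg A).mem_radical.1 hy
    exact (tensorCoalg A).mem_radical.2 ⟨r + 1, ι_mul_mem_filt A v r y hr⟩

theorem tensorMap_isCoalgHom {A B : GrVect K} {f : A →ₗ[K] B} (hf : HasDegree 0 f) :
    IsCoalgHom (C := tensorCoalg A) (D := tensorCoalg B) (tensorMap f).toLinearMap where
  degree := tensorMap_degree hf
  comul := tensorMap_deconc f
  counit := tensorMap_counit f
  one := map_one (tensorMap f)

/-! ### Uniqueness of maps into the tensor coalgebra -/

/-- Suppose h vanishes on F_r and x lies in F_{r+1}. Then h ⊗ f and g ⊗ h kill Δ̄x, and f(1) = g(1)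
= 1 leaves Δ(hx) = hx ⊗ 1 + 1 ⊗ hx. So hx is a letter, and `circProd` returns that letter. Every
uniqueness statement about μ and d is an instance: f and g record along which maps h is a
coderivation. -/
theorem eq_zero_of_circProd_eq_zero (V : DAsAlg K) {C : GrCoalg K} (hC : C.radical = ⊤)
    {h f g : C →ₗ[K] TensorAlgebra K V.space} (hf : f C.one = 1) (hg : g C.one = 1)
    (hh : h C.one = 0) (hcomul : ∀ x, deconc K V.space (h x) =
      TensorProduct.map h f (C.comul x) + TensorProduct.map g h (C.comul x))
    (hcirc : ∀ x, V.circProd (h x) = 0) : h = 0 := by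
  have key : ∀ r, ∀ x ∈ C.filt r, h x = 0 := by
    intro r
    induction r with
    | zero =>
      intro x hx
      obtain ⟨c, rfl⟩ := C.mem_filt_zero.1 hx
      rw [map_smul, hh, smul_zero]
    | succ r ih =>
      intro x hx
      rw [C.mem_filt_succ] at hx
      have h1 : TensorProduct.map h f (C.redComul x) = 0 :=
        eq_of_mem_tens (g := 0) (fun a ha b _ => by simp [ih a ha]) hx
      have h2 : TensorProduct.map g h (C.redComul x) = 0 :=
        eq_of_mem_tens (g := 0) (fun a _ b hb => by simp [ih b hb]) hx
      have h3 := hcomul x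
      rw [C.comul_eq, map_add, map_add, map_add, map_add, h1, h2] at h3
      simp only [map_tmul, hf, hg, hh, zero_tmul, tmul_zero, add_zero, zero_add] at h3
      have h4 := eq_ι_of_deconc_eq h3
      have h5 := hcirc x
      rw [h4, V.circProd_ι] at h5
      rw [h4, h5, map_zero]
  ext x
  obtain ⟨r, hr⟩ := C.mem_radical.1 (hC ▸ Submodule.mem_top : x ∈ C.radical)
  exact key r x hr

/-- The difference is a coderivation along f and g, because f ⊗ f − g ⊗ g = (f − g) ⊗ f + g ⊗ (f −
g). -/
theorem coalgHom_ext (V : DAsAlg K) {C : GrCoalg K} (hC : C.radical = ⊤)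
    {f g : C →ₗ[K] TensorAlgebra K V.space} (hf : IsCoalgHom (D := tensorCoalg V.space) f)
    (hg : IsCoalgHom (D := tensorCoalg V.space) g)
    (hcirc : ∀ x, V.circProd (f x) = V.circProd (g x)) : f = g := by
  refine sub_eq_zero.1 (eq_zero_of_circProd_eq_zero V hC (f := f) (g := g) hf.one hg.one ?_ ?_ ?_)
  · rw [LinearMap.sub_apply, hf.one, hg.one, sub_self]
  · intro x
    have h1 : deconc K V.space (f x) = _ := hf.comul x
    have h2 : deconc K V.space (g x) = _ := hg.comul x
    rw [LinearMap.sub_apply, map_sub, h1, h2, ← LinearMap.sub_apply, ← LinearMap.add_apply]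
    congr 1
    refine TensorProduct.ext' fun a b => ?_
    simp [sub_tmul, tmul_sub]
  · intro x
    rw [LinearMap.sub_apply, map_sub, hcirc, sub_self]

/-! ### Fixed points of contractions -/

section Fixed
variable {C : GrCoalg K} {W : Type u} [AddCommGroup W] [Module K W]

/-- A map on `Hom (C, W)` which improves the agreement along the primitive filtration. -/
structure IsContraction (Θ : (C →ₗ[K] W) → (C →ₗ[K] W)) : Prop where
  one : ∀ f g, Θ f C.one = Θ g C.one
  succ : ∀ f g r, (∀ x ∈ C.filt r, f x = g x) → ∀ x ∈ C.filt (r + 1), Θ f x = Θ g x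

variable {Θ : (C →ₗ[K] W) → (C →ₗ[K] W)}

/-- One iteration is spent on F₀, where agreement comes from `one`, and one more on each later step;
hence the exponent r + 1. -/
theorem IsContraction.iterate (h : IsContraction Θ) (f g : C →ₗ[K] W) (r : ℕ) :
    ∀ x ∈ C.filt r, (Θ^[r + 1]) f x = (Θ^[r + 1]) g x := by
  induction r with
  | zero =>
    intro x hx
    obtain ⟨c, rfl⟩ := C.mem_filt_zero.1 hx
    rw [map_smul, map_smul]
    exact congrArg _ (h.one f g)
  | succ r ih =>
    intro x hx
    rw [Function.iterate_succ_apply' _ (r + 1), Function.iterate_succ_apply' _ (r + 1)]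
    exact h.succ _ _ r ih x hx

theorem IsContraction.unique (hC : C.radical = ⊤) (h : IsContraction Θ) {f g : C →ₗ[K] W} (hf : Θ f = f)
    (hg : Θ g = g) : f = g := by
  ext x
  obtain ⟨r, hr⟩ := C.mem_radical.1 (hC ▸ Submodule.mem_top : x ∈ C.radical)
  have := h.iterate f g r x hr
  rwa [Function.iterate_fixed hf, Function.iterate_fixed hg] at this

/-- The iterates of 0 are eventually constant on each F_r, so their pointwise limit exists and is
linear. The second clause records that every value is the value of an iterate, which lets the degree
pass to the limit in `HasDegree.of_iterate`. -/
theorem IsContraction.exists_fixed (hC : C.radical = ⊤) (h : IsContraction Θ) :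
    ∃ f, Θ f = f ∧ ∀ x, ∃ n, f x = (Θ^[n]) 0 x := by
  have hr : ∀ x : C, ∃ r, x ∈ C.filt r := fun x =>
    C.mem_radical.1 (hC ▸ Submodule.mem_top : x ∈ C.radical)
  choose r hr using hr
  have key : ∀ m n x, x ∈ C.filt m → x ∈ C.filt n →
      (Θ^[m + 1]) 0 x = (Θ^[n + 1]) 0 x := by
    intro m n x hm hn
    wlog hmn : m ≤ n generalizing m n
    · exact (this n m hn hm (by omega)).symm
    obtain ⟨k, rfl⟩ := Nat.exists_eq_add_of_le hmn
    rw [show m + k + 1 = m + 1 + k by omega, Function.iterate_add_apply Θ (m + 1) k]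
    exact h.iterate _ _ m x hm
  let f : C →ₗ[K] W :=
    { toFun := fun x => (Θ^[r x + 1]) 0 x
      map_add' := by
        intro x y
        have hx := C.filt_mono (le_max_left (r x) (r y)) (hr x)
        have hy := C.filt_mono (le_max_right (r x) (r y)) (hr y)
        rw [key _ _ _ (hr x) hx, key _ _ _ (hr y) hy,
          key _ _ _ (hr (x + y)) (Submodule.add_mem _ hx hy), map_add]
      map_smul' := by
        intro c x
        rw [key _ _ _ (hr (c • x)) (Submodule.smul_mem _ c (hr x)), map_smul, RingHom.id_apply] }
  have hf : ∀ n, ∀ x ∈ C.filt n, f x = (Θ^[n + 1]) 0 x := fun n x hx => key _ _ x (hr x) hx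
  refine ⟨f, ?_, fun x => ⟨r x + 1, rfl⟩⟩
  ext x
  have h1 := h.succ _ _ (r x) (hf (r x)) x (C.filt_mono (Nat.le_succ _) (hr x))
  rw [h1, ← Function.iterate_succ_apply' Θ]
  exact (hf (r x + 1) x (C.filt_mono (Nat.le_succ _) (hr x))).symm

end Fixed

/-! ### Convolution -/

section Conv
variable {C : GrCoalg K} {W₁ W₂ W₃ W₄ W₅ : Type u}
  [AddCommGroup W₁] [Module K W₁] [AddCommGroup W₂] [Module K W₂] [AddCommGroup W₃] [Module K W₃]
  [AddCommGroup W₄] [Module K W₄] [AddCommGroup W₅] [Module K W₅]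

/-- The convolution `x ↦ B (f x₁) (g x₂)`. -/
def conv (B : W₁ →ₗ[K] W₂ →ₗ[K] W₃) (f : C →ₗ[K] W₁) (g : C →ₗ[K] W₂) : C →ₗ[K] W₃ :=
  TensorProduct.lift B ∘ₗ TensorProduct.map f g ∘ₗ C.comul

theorem conv_apply (B : W₁ →ₗ[K] W₂ →ₗ[K] W₃) (f : C →ₗ[K] W₁) (g : C →ₗ[K] W₂) (x : C) :
    conv B f g x = TensorProduct.lift B (TensorProduct.map f g (C.comul x)) := rfl

theorem conv_one (B : W₁ →ₗ[K] W₂ →ₗ[K] W₃) (f : C →ₗ[K] W₁) (g : C →ₗ[K] W₂) :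
    conv B f g C.one = B (f C.one) (g C.one) := by
  rw [conv_apply, show C.comul C.one = _ from C.comul_one]
  simp

theorem conv_counit_left (B : W₁ →ₗ[K] W₂ →ₗ[K] W₃) (w : W₁) (g : C →ₗ[K] W₂) (x : C) :
    conv B (C.counit.smulRight w) g x = B w (g x) := by
  have h : TensorProduct.lift B ∘ₗ TensorProduct.map (C.counit.smulRight w) g =
      (B w ∘ₗ g) ∘ₗ (TensorProduct.lid K C).toLinearMap ∘ₗ C.counit.rTensor C := by
    refine TensorProduct.ext' fun a b => ?_
    simp
  have := DFunLike.congr_fun h (C.comul x)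
  rw [conv_apply]
  refine this.trans ?_
  rw [LinearMap.comp_apply, LinearMap.comp_apply, LinearMap.comp_apply, C.rTensor_counit]
  simp

theorem conv_counit_right (B : W₁ →ₗ[K] W₂ →ₗ[K] W₃) (f : C →ₗ[K] W₁) (w : W₂) (x : C) :
    conv B f (C.counit.smulRight w) x = B (f x) w := by
  have h : TensorProduct.lift B ∘ₗ TensorProduct.map f (C.counit.smulRight w) =
      (B.flip w ∘ₗ f) ∘ₗ (TensorProduct.rid K C).toLinearMap ∘ₗ C.counit.lTensor C := by
    refine TensorProduct.ext' fun a b => ?_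
    simp
  have := DFunLike.congr_fun h (C.comul x)
  rw [conv_apply]
  refine this.trans ?_
  rw [LinearMap.comp_apply, LinearMap.comp_apply, LinearMap.comp_apply, C.lTensor_counit]
  simp

/-- Transports an identity between bilinear maps to their convolutions; it serves to push a linear
map through a convolution equation. -/
theorem conv_congr {W₁' W₂' W₃' : Type u} [AddCommGroup W₁'] [Module K W₁'] [AddCommGroup W₂']
    [Module K W₂'] [AddCommGroup W₃'] [Module K W₃'] {B : W₁ →ₗ[K] W₂ →ₗ[K] W₃}
    {B' : W₁' →ₗ[K] W₂' →ₗ[K] W₃'} {f : C →ₗ[K] W₁} {g : C →ₗ[K] W₂} {f' : C →ₗ[K] W₁'}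
    {g' : C →ₗ[K] W₂'} {L : W₃ →ₗ[K] W₃'} (h : ∀ a b, L (B (f a) (g b)) = B' (f' a) (g' b)) (x : C) :
    L (conv B f g x) = conv B' f' g' x := by
  have : L ∘ₗ TensorProduct.lift B ∘ₗ TensorProduct.map f g =
      TensorProduct.lift B' ∘ₗ TensorProduct.map f' g' :=
    TensorProduct.ext' fun a b => by simpa using h a b
  exact DFunLike.congr_fun this (C.comul x)

theorem conv_add_left (B : W₁ →ₗ[K] W₂ →ₗ[K] W₃) (f f' : C →ₗ[K] W₁) (g : C →ₗ[K] W₂) :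
    conv B (f + f') g = conv B f g + conv B f' g := by
  simp [conv, TensorProduct.map_add_left, LinearMap.add_comp, LinearMap.comp_add]

theorem conv_add_right (B : W₁ →ₗ[K] W₂ →ₗ[K] W₃) (f : C →ₗ[K] W₁) (g g' : C →ₗ[K] W₂) :
    conv B f (g + g') = conv B f g + conv B f g' := by
  simp [conv, TensorProduct.map_add_right, LinearMap.add_comp, LinearMap.comp_add]

theorem conv_comp_left {W₁' : Type u} [AddCommGroup W₁'] [Module K W₁']
    (B : W₁' →ₗ[K] W₂ →ₗ[K] W₃) (L : W₁ →ₗ[K] W₁') (f : C →ₗ[K] W₁) (g : C →ₗ[K] W₂) :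
    conv B (L ∘ₗ f) g = conv (B ∘ₗ L) f g := by
  ext x
  refine conv_congr (L := LinearMap.id) ?_ x
  exact fun a b => rfl

/-- Coassociativity of C. The four bilinear maps differ because the equations below mix products of
words, the action of letters on a left tensor factor, and ⊗ itself. -/
theorem conv_assoc {W₆ : Type u} [AddCommGroup W₆] [Module K W₆]
    {B₁ : W₃ →ₗ[K] W₄ →ₗ[K] W₅} {B₂ : W₁ →ₗ[K] W₂ →ₗ[K] W₃} {B₃ : W₁ →ₗ[K] W₆ →ₗ[K] W₅}
    {B₄ : W₂ →ₗ[K] W₄ →ₗ[K] W₆} {f : C →ₗ[K] W₁} {g : C →ₗ[K] W₂}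
    {k : C →ₗ[K] W₄} (h : ∀ a b c, B₁ (B₂ (f a) (g b)) (k c) = B₃ (f a) (B₄ (g b) (k c))) :
    conv B₁ (conv B₂ f g) k = conv B₃ f (conv B₄ g k) := by
  have h1 : ∀ t : C ⊗[K] C, TensorProduct.lift B₁ (TensorProduct.map (conv B₂ f g) k t) =
      TensorProduct.lift B₁ (TensorProduct.map (TensorProduct.lift B₂ ∘ₗ TensorProduct.map f g) k
        (C.comul.rTensor C t)) := by
    intro t
    induction t with
    | zero => simp
    | tmul a b => simp [conv]
    | add a b ha hb => simp only [map_add, ha, hb]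
  have h2 : ∀ t : C ⊗[K] C, TensorProduct.lift B₃ (TensorProduct.map f (conv B₄ g k) t) =
      TensorProduct.lift B₃ (TensorProduct.map f (TensorProduct.lift B₄ ∘ₗ TensorProduct.map g k)
        (C.comul.lTensor C t)) := by
    intro t
    induction t with
    | zero => simp
    | tmul a b => simp [conv]
    | add a b ha hb => simp only [map_add, ha, hb]
  have h3 : TensorProduct.lift B₁ ∘ₗ TensorProduct.map (TensorProduct.lift B₂ ∘ₗ
      TensorProduct.map f g) k = TensorProduct.lift B₃ ∘ₗ TensorProduct.map f
        (TensorProduct.lift B₄ ∘ₗ TensorProduct.map g k) ∘ₗ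
        (TensorProduct.assoc K C C C).toLinearMap :=
    TensorProduct.ext_threefold fun a b c => by simpa using h a b c
  ext x
  rw [conv_apply, conv_apply, h1, h2]
  refine (DFunLike.congr_fun h3 _).trans ?_
  have hC := DFunLike.congr_fun (Coalgebra.coassoc (R := K) (A := C)) x
  simp only [LinearMap.comp_apply, LinearEquiv.coe_coe] at hC ⊢
  rw [hC]

/-- As g(1) = 0, the summand x ⊗ 1 of Δx contributes nothing. The others evaluate f only at 1 and on
F_r, which gains one filtration step. -/
theorem conv_left_congr (B : W₁ →ₗ[K] W₂ →ₗ[K] W₃) {f f' : C →ₗ[K] W₁} {g : C →ₗ[K] W₂}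
    (hg : g C.one = 0) {r : ℕ} (h : ∀ x ∈ C.filt r, f x = f' x) :
    ∀ x ∈ C.filt (r + 1), conv B f g x = conv B f' g x := by
  intro x hx
  rw [C.mem_filt_succ] at hx
  rw [conv_apply, conv_apply, C.comul_eq]
  simp only [map_add, map_tmul, lift.tmul, hg, map_zero, h _ (C.one_mem_filt r)]
  congr 1
  exact eq_of_mem_tens (f := TensorProduct.lift B ∘ₗ TensorProduct.map f g)
    (g := TensorProduct.lift B ∘ₗ TensorProduct.map f' g) (fun a ha b _ => by simp [h a ha]) hx

theorem conv_right_congr (B : W₁ →ₗ[K] W₂ →ₗ[K] W₃) {f : C →ₗ[K] W₁} {g g' : C →ₗ[K] W₂}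
    (hf : f C.one = 0) {r : ℕ} (h : ∀ x ∈ C.filt r, g x = g' x) :
    ∀ x ∈ C.filt (r + 1), conv B f g x = conv B f g' x := by
  intro x hx
  rw [C.mem_filt_succ] at hx
  rw [conv_apply, conv_apply, C.comul_eq]
  simp only [map_add, map_tmul, lift.tmul, hf, map_zero, LinearMap.zero_apply,
    h _ (C.one_mem_filt r)]
  congr 1
  exact eq_of_mem_tens (f := TensorProduct.lift B ∘ₗ TensorProduct.map f g)
    (g := TensorProduct.lift B ∘ₗ TensorProduct.map f g') (fun a _ b hb => by simp [h b hb]) hx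

theorem isContraction_conv_right (B : W₁ →ₗ[K] W₂ →ₗ[K] W₂) {f : C →ₗ[K] W₁} (hf : f C.one = 0)
    (w : C →ₗ[K] W₂) : IsContraction fun k => w + conv B f k where
  one k k' := by
    simp only [LinearMap.add_apply]
    rw [conv_one, conv_one, hf, map_zero, LinearMap.zero_apply, LinearMap.zero_apply]
  succ k k' r h x hx := by
    simp only [LinearMap.add_apply]
    rw [conv_right_congr B hf h x hx]

theorem isContraction_conv_left (B : W₁ →ₗ[K] W₂ →ₗ[K] W₁) {g : C →ₗ[K] W₂} (hg : g C.one = 0)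
    (w : C →ₗ[K] W₁) : IsContraction fun k => w - conv B k g where
  one k k' := by
    simp only [LinearMap.sub_apply]
    rw [conv_one, conv_one, hg, map_zero, map_zero]
  succ k k' r h x hx := by
    simp only [LinearMap.sub_apply]
    rw [conv_left_congr B hg h x hx]

end Conv

theorem conv_degree {C : GrCoalg K} {U V W : GrVect K} {B : U →ₗ[K] V →ₗ[K] W}
    (hB : ∀ i j, ∀ a ∈ U.gr i, ∀ b ∈ V.gr j, B a b ∈ W.gr (i + j)) {f : C →ₗ[K] U} {g : C →ₗ[K] V}
    {k m n : ℤ} (hf : HasDegree m f) (hg : HasDegree n g) (hk : m + n = k) :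
    HasDegree (V := C.toGrVect) (W := W) k (conv B f g) := by
  intro i x hx
  have h1 := C.comul_mem i x hx
  have : tensorGr C.toGrVect C.toGrVect i ≤ (W.gr (i + k)).comap
      (TensorProduct.lift B ∘ₗ TensorProduct.map f g) := by
    refine Submodule.span_le.2 ?_
    rintro _ ⟨p, q, rfl, a, ha, b, hb, rfl⟩
    have := hB _ _ _ (hf _ _ ha) _ (hg _ _ hb)
    rwa [show p + m + (q + n) = p + q + k by omega] at this
  exact this h1

theorem HasDegree.add {V W : GrVect K} {n : ℤ} {f g : V →ₗ[K] W} (hf : HasDegree n f)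
    (hg : HasDegree n g) : HasDegree n (f + g) :=
  fun i v hv => Submodule.add_mem _ (hf i v hv) (hg i v hv)

theorem HasDegree.sub {V W : GrVect K} {n : ℤ} {f g : V →ₗ[K] W} (hf : HasDegree n f)
    (hg : HasDegree n g) : HasDegree n (f - g) :=
  fun i v hv => Submodule.sub_mem _ (hf i v hv) (hg i v hv)

theorem HasDegree.counit_smulRight {C : GrCoalg K} {W : GrVect K} {w : W} (hw : w ∈ W.gr 0) :
    HasDegree (V := C.toGrVect) (W := W) 0 (C.counit.smulRight w) := by
  intro i x hx
  rw [LinearMap.smulRight_apply, add_zero]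
  by_cases h : i = 0
  · rw [h]; exact Submodule.smul_mem _ _ hw
  · rw [show C.counit x = 0 from C.counit_eq_zero i h x hx, zero_smul]
    exact Submodule.zero_mem _

theorem HasDegree.of_iterate {C : GrCoalg K} {W : GrVect K} {m : ℤ}
    {Θ : (C →ₗ[K] W) → (C →ₗ[K] W)}
    (hΘ : ∀ f, HasDegree (V := C.toGrVect) m f → HasDegree (V := C.toGrVect) m (Θ f))
    {f : C →ₗ[K] W} (hf : ∀ x, ∃ n, f x = (Θ^[n]) 0 x) : HasDegree (V := C.toGrVect) m f := by
  have h : ∀ n, HasDegree (V := C.toGrVect) m ((Θ^[n]) 0) := by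
    intro n
    induction n with
    | zero => exact fun i x _ => Submodule.zero_mem _
    | succ n ih => rw [Function.iterate_succ_apply']; exact hΘ _ ih
  intro i x hx
  obtain ⟨n, hn⟩ := hf x
  rw [hn]
  exact h n i x hx

end
end BInf

namespace BInf
noncomputable section
variable {K : Type u} [Field K]

/-! ### Cofreeness of the tensor coalgebra -/

/-- A coalgebra map Φ to words is determined by its letter component φ through Φ = ε·1 + φ ∗ Φ, the
convolution by concatenation. Applying `circProd` turns this into ψ = ε·1 + φ ∗ ψ, now with ∘. So
solve the second equation for φ, then the first for Φ. -/
theorem exists_coalgHom (V : DAsAlg K) {C : GrCoalg K} (hC : C.radical = ⊤)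
    {ψ : C →ₗ[K] V.space} (hψ : HasDegree 0 ψ) (hψ1 : ψ C.one = V.one) :
    ∃ Φ : C →ₗ[K] TensorAlgebra K V.space, IsCoalgHom (D := tensorCoalg V.space) Φ ∧
      ∀ x, V.circProd (Φ x) = ψ x := by
  let e : C →ₗ[K] V.space := C.counit.smulRight V.one
  have he1 : e C.one = V.one := by
    simp [e, show C.counit C.one = 1 from C.counit_one]
  have he : HasDegree (V := C.toGrVect) (W := V.space) 0 e :=
    HasDegree.counit_smulRight V.circ.one_mem
  have hψe : (ψ - e) C.one = 0 := by rw [LinearMap.sub_apply, hψ1, he1, sub_self]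
  -- The equation φ ∗ ψ = ψ − e in fixed-point form φ = (ψ − e) − φ ∗ (ψ − e). It is a contraction
  -- because ψ − e vanishes at 1.
  obtain ⟨φ, hφ, hφn⟩ :=
    (isContraction_conv_left V.circ.mul hψe (ψ - e)).exists_fixed hC
  have hφ1 : φ C.one = 0 := by
    have := DFunLike.congr_fun hφ C.one
    rw [LinearMap.sub_apply, conv_one, hψe, map_zero, sub_zero] at this
    exact this.symm
  have hφd : HasDegree (V := C.toGrVect) (W := V.space) 0 φ :=
    HasDegree.of_iterate (fun f hf => (hψ.sub he).sub
      (conv_degree V.circ.mul_mem hf (hψ.sub he) (add_zero 0))) hφn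
  have hψφ : e + conv V.circ.mul φ ψ = ψ := by
    have h1 : conv V.circ.mul φ ψ = conv V.circ.mul φ (ψ - e) + φ := by
      have h2 : conv V.circ.mul φ e = φ := by
        ext x
        rw [conv_counit_right, V.circ.mul_one]
      nth_rewrite 3 [← h2]
      rw [← conv_add_right, sub_add_cancel]
    rw [h1]
    nth_rewrite 2 [← hφ]
    abel
  let e' : C →ₗ[K] TensorAlgebra K V.space := C.counit.smulRight 1
  have he'1 : e' C.one = 1 := by
    simp [e', show C.counit C.one = 1 from C.counit_one]
  let m := LinearMap.mul K (TensorAlgebra K V.space)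
  have hιφ : (TensorAlgebra.ι K ∘ₗ φ) C.one = 0 := by
    rw [LinearMap.comp_apply, hφ1, map_zero]
  obtain ⟨Φ, hΦ, hΦn⟩ := (isContraction_conv_right m hιφ e').exists_fixed hC
  have hΦx : ∀ x, Φ x = e' x + conv m (TensorAlgebra.ι K ∘ₗ φ) Φ x := fun x =>
    (DFunLike.congr_fun hΦ x).symm
  have hΦ1 : Φ C.one = 1 := by
    rw [hΦx, conv_one, hιφ, map_zero, LinearMap.zero_apply, add_zero, he'1]
  have hΦd : HasDegree (V := C.toGrVect) (W := tensorVect V.space) 0 Φ :=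
    HasDegree.of_iterate (fun f hf => HasDegree.add
      (HasDegree.counit_smulRight (W := tensorVect V.space) SetLike.GradedOne.one_mem)
      (conv_degree (W := tensorVect V.space) (concat V.space).mul_mem
        (HasDegree.comp_zero (ι_degree V.space) hφd) hf (add_zero 0))) hΦn
  refine ⟨Φ, ⟨hΦd, ?_, ?_, hΦ1⟩, ?_⟩
  · let T2 := TensorAlgebra K V.space ⊗[K] TensorAlgebra K V.space
    let B' : TensorAlgebra K V.space →ₗ[K] T2 →ₗ[K] T2 := LinearMap.rTensorHom _ ∘ₗ m
    let B : V.space →ₗ[K] T2 →ₗ[K] T2 := B' ∘ₗ TensorAlgebra.ι K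
    let mk : TensorAlgebra K V.space →ₗ[K] TensorAlgebra K V.space →ₗ[K] T2 :=
      TensorProduct.mk K _ _
    let w : C →ₗ[K] T2 := mk 1 ∘ₗ Φ
    -- Both ΔΦ and (Φ ⊗ Φ)Δ solve X = 1 ⊗ Φ + φ ∗ X, where a letter acts by prepending to the left
    -- tensor factor; the fixed point is unique.
    have h1 : w + conv B φ (deconc K V.space ∘ₗ Φ) = deconc K V.space ∘ₗ Φ := by
      ext x
      have h2 : (deconc K V.space - mk 1)
          (conv m (TensorAlgebra.ι K ∘ₗ φ) Φ x) = conv B φ (deconc K V.space ∘ₗ Φ) x := by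
        refine conv_congr (fun a b => ?_) x
        change deconc K _ (TensorAlgebra.ι K (φ a) * Φ b) -
          1 ⊗ₜ (TensorAlgebra.ι K (φ a) * Φ b) = _
        rw [deconc_ι_mul, add_sub_cancel_left]
        rfl
      have h3 : deconc K V.space (e' x) = mk 1 (e' x) := by
        simp [e', mk]
        rfl
      change mk 1 (Φ x) + _ = deconc K V.space (Φ x)
      rw [← h2, LinearMap.sub_apply, hΦx x, map_add, map_add, h3]
      abel
    have h3 : w + conv B φ (conv mk Φ Φ) = conv mk Φ Φ := by
      have h4 : conv mk (conv m (TensorAlgebra.ι K ∘ₗ φ) Φ) Φ = conv B φ (conv mk Φ Φ) :=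
        (conv_assoc (B₃ := B') fun a b c => rfl).trans (conv_comp_left _ _ _ _)
      rw [← h4]
      have h5 : w = conv mk e' Φ := by
        ext x
        rw [conv_counit_left]
        rfl
      rw [h5, ← conv_add_left]
      congr 1
    have h6 := (isContraction_conv_right B hφ1 w).unique hC h1 h3
    intro x
    refine (DFunLike.congr_fun h6 x).trans ?_
    rw [conv_apply]
    have : TensorProduct.lift (TensorProduct.mk K (TensorAlgebra K V.space)
      (TensorAlgebra K V.space)) = LinearMap.id := TensorProduct.ext' fun a b => rfl
    rw [this]
    rfl
  · intro x
    rw [hΦx, map_add]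
    have h1 : (tensorCoalg V.space).counit (conv m (TensorAlgebra.ι K ∘ₗ φ) Φ x) =
        conv (LinearMap.mul K K) (0 : C →ₗ[K] K) (0 : C →ₗ[K] K) x :=
      conv_congr (fun a b => by
        change TensorAlgebra.algebraMapInv (TensorAlgebra.ι K (φ a) * Φ b) = _
        rw [map_mul, algebraMapInv_ι]; simp) x
    rw [h1, conv_apply]
    change TensorAlgebra.algebraMapInv (C.counit x • (1 : TensorAlgebra K V.space)) + _ = _
    simp
  -- `circProd ∘ Φ` satisfies the equation that `hψφ` states for ψ.
  · have h1 : e + conv V.circ.mul φ (V.circProd ∘ₗ Φ) = V.circProd ∘ₗ Φ := by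
      ext x
      have h2 : V.circProd (conv m (TensorAlgebra.ι K ∘ₗ φ) Φ x) =
          conv V.circ.mul φ (V.circProd ∘ₗ Φ) x :=
        conv_congr (fun a b => V.circProd_ι_mul _ _) x
      rw [LinearMap.add_apply, ← h2, LinearMap.comp_apply, hΦx x, map_add]
      simp [e, e', V.circProd_one]
    exact DFunLike.congr_fun ((isContraction_conv_right V.circ.mul hφ1 e).unique hC h1 hψφ)

theorem DGAlgStr.d_one {V : GrVect K} {e : V} (S : DGAlgStr V e) : S.d e = 0 := by
  have h := S.d_mul e e
  rw [S.one_mul, signOp_eq V S.one_mem, ksgn_zero, one_smul, S.one_mul, S.mul_one] at h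
  simpa using h

theorem signOp_one (A : GrVect K) : signOp (tensorVect A) (1 : TensorAlgebra K A) = 1 := by
  rw [signOp_eq (tensorVect A) (SetLike.GradedOne.one_mem : (1 : TensorAlgebra K A) ∈ wordGr A.gr 0),
    ksgn_zero, one_smul]

theorem signOp_mul (A : GrVect K) (x y : TensorAlgebra K A) :
    signOp (tensorVect A) (x * y) = signOp (tensorVect A) x * signOp (tensorVect A) y := by
  have : (LinearMap.mul K (TensorAlgebra K A)).compr₂ (signOp (tensorVect A)) =
      (LinearMap.mul K (TensorAlgebra K A)).compl₁₂ (signOp (tensorVect A))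
        (signOp (tensorVect A)) := by
    refine GrVect.hom_ext (V := tensorVect A) fun i a ha =>
      GrVect.hom_ext (V := tensorVect A) fun j b hb => ?_
    change signOp (tensorVect A) (a * b) = signOp (tensorVect A) a * signOp (tensorVect A) b
    rw [signOp_eq (tensorVect A) ha, signOp_eq (tensorVect A) hb,
      signOp_eq (tensorVect A) (SetLike.GradedMul.mul_mem ha hb), ksgn_add]
    exact (smul_mul_smul_comm _ _ _ _).symm
  exact DFunLike.congr_fun (DFunLike.congr_fun this x) y

/-- With δ the letter component of D, the coderivation rule amounts to D = δ ∗ id + σ ∗ D: either an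
initial segment is contracted to one letter, or D passes the first letter with its sign. After
`circProd` this reads ∂p = δ ∗ p + σ ∗ ∂p with p = `circProd`, an equation for δ. -/
theorem exists_coderivation (V : DAsAlg K) :
    ∃ D : TensorAlgebra K V.space →ₗ[K] TensorAlgebra K V.space,
      HasDegree (V := tensorVect V.space) (W := tensorVect V.space) (-1) D ∧
      D 1 = 0 ∧
      (∀ x, deconc K V.space (D x) = TensorProduct.map D LinearMap.id (deconc K V.space x) +
        TensorProduct.map (signOp (tensorVect V.space)) D (deconc K V.space x)) ∧
      ∀ x, V.circProd (D x) = V.dg.d (V.circProd x) := by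
  let C := tensorCoalg V.space
  have hC : C.radical = ⊤ := tensorCoalg_radical V.space
  let p : C →ₗ[K] V.space := V.circProd
  have hp : HasDegree (V := C.toGrVect) (W := V.space) 0 p := V.circProd_degree
  let e : C →ₗ[K] V.space := C.counit.smulRight V.one
  have he1 : e C.one = V.one := by
    simp [e, show C.counit C.one = 1 from C.counit_one]
  have he : HasDegree (V := C.toGrVect) (W := V.space) 0 e :=
    HasDegree.counit_smulRight V.circ.one_mem
  have hpe : (p - e) C.one = 0 := by
    rw [LinearMap.sub_apply, he1, show p C.one = V.one from V.circProd_one, sub_self]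
  -- The one-letter part with the Koszul sign that a map of degree −1 acquires when it passes this
  -- letter.
  let σ : C →ₗ[K] V.space := signOp V.space ∘ₗ TensorAlgebra.ιInv
  have hσ : HasDegree (V := C.toGrVect) (W := V.space) 0 σ :=
    (signOp_degree V.space).comp_zero (ιInv_degree V.space)
  have hσ1 : σ C.one = 0 := by
    change signOp V.space (TensorAlgebra.ιInv 1) = 0
    rw [ιInv_one, map_zero]
  let dp : C →ₗ[K] V.space := V.dg.d ∘ₗ p
  have hdp : HasDegree (V := C.toGrVect) (W := V.space) (-1) dp := by
    simpa using V.dg.d_degree.comp hp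
  have hdp1 : dp C.one = 0 := by
    change V.dg.d (V.circProd 1) = 0
    rw [V.circProd_one, V.dg.d_one]
  let γ : C →ₗ[K] V.space := dp - conv V.circ.mul σ dp
  have hγ : HasDegree (V := C.toGrVect) (W := V.space) (-1) γ :=
    hdp.sub (conv_degree V.circ.mul_mem hσ hdp (zero_add _))
  have hγ1 : γ C.one = 0 := by
    change dp C.one - conv V.circ.mul σ dp C.one = 0
    rw [conv_one, hdp1, map_zero, sub_zero]
  -- Solves δ ∗ p = γ. Writing p = e + (p − e), with p − e vanishing at 1, makes it a contraction.
  obtain ⟨δ, hδ, hδn⟩ := (isContraction_conv_left V.circ.mul hpe γ).exists_fixed hC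
  have hδ1 : δ C.one = 0 := by
    have := DFunLike.congr_fun hδ C.one
    rw [LinearMap.sub_apply, conv_one, hpe, map_zero, sub_zero, hγ1] at this
    exact this.symm
  have hδd : HasDegree (V := C.toGrVect) (W := V.space) (-1) δ :=
    HasDegree.of_iterate (fun f hf => hγ.sub
      (conv_degree V.circ.mul_mem hf (hp.sub he) (add_zero _))) hδn
  have hdpδ : conv V.circ.mul δ p + conv V.circ.mul σ dp = dp := by
    have h1 : conv V.circ.mul δ p = conv V.circ.mul δ (p - e) + δ := by
      have h2 : conv V.circ.mul δ e = δ := by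
        ext x
        rw [conv_counit_right, V.circ.mul_one]
      nth_rewrite 3 [← h2]
      rw [← conv_add_right, sub_add_cancel]
    rw [h1]
    nth_rewrite 2 [← hδ]
    simp only [γ]
    abel
  let m := LinearMap.mul K (TensorAlgebra K V.space)
  let ι : V.space →ₗ[K] TensorAlgebra K V.space := TensorAlgebra.ι K
  have hισ : (ι ∘ₗ σ) C.one = 0 := by
    rw [LinearMap.comp_apply, hσ1, map_zero]
  let w : C →ₗ[K] TensorAlgebra K V.space := conv m (ι ∘ₗ δ) LinearMap.id
  obtain ⟨D, hD, hDn⟩ := (isContraction_conv_right m hισ w).exists_fixed hC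
  have hDx : ∀ x, D x = w x + conv m (ι ∘ₗ σ) D x := fun x => (DFunLike.congr_fun hD x).symm
  have hD1 : D C.one = 0 := by
    have hιδ : (ι ∘ₗ δ) C.one = 0 := by
      rw [LinearMap.comp_apply, hδ1, map_zero]
    have h1 : w C.one = 0 := by
      change conv m (ι ∘ₗ δ) LinearMap.id C.one = 0
      rw [conv_one, hιδ, map_zero, LinearMap.zero_apply]
    have h2 : conv m (ι ∘ₗ σ) D C.one = 0 := by
      rw [conv_one, hισ, map_zero, LinearMap.zero_apply]
    rw [hDx, h1, h2, add_zero]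
  have hDd : HasDegree (V := C.toGrVect) (W := tensorVect V.space) (-1) D := by
    refine HasDegree.of_iterate (fun f hf => HasDegree.add ?_ ?_) hDn
    · refine conv_degree (W := tensorVect V.space) (V := tensorVect V.space)
        (concat V.space).mul_mem (f := ι ∘ₗ δ) ?_ (HasDegree.id _) (add_zero _)
      simpa using (ι_degree V.space).comp hδd
    · exact conv_degree (W := tensorVect V.space) (V := tensorVect V.space)
        (concat V.space).mul_mem (f := ι ∘ₗ σ)
        (HasDegree.comp_zero (ι_degree V.space) hσ) hf (zero_add _)
  refine ⟨D, hDd, hD1, ?_, ?_⟩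
  · let T2 := TensorAlgebra K V.space ⊗[K] TensorAlgebra K V.space
    let s : C →ₗ[K] TensorAlgebra K V.space := signOp (tensorVect V.space)
    let B' : TensorAlgebra K V.space →ₗ[K] T2 →ₗ[K] T2 := LinearMap.rTensorHom _ ∘ₗ m
    let B : V.space →ₗ[K] T2 →ₗ[K] T2 := B' ∘ₗ ι
    let mk : TensorAlgebra K V.space →ₗ[K] TensorAlgebra K V.space →ₗ[K] T2 :=
      TensorProduct.mk K _ _
    have hmk : ∀ (f g : C →ₗ[K] TensorAlgebra K V.space) x,
        conv mk f g x = TensorProduct.map f g (deconc K V.space x) := by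
      intro f g x
      rw [conv_apply]
      have : TensorProduct.lift mk = LinearMap.id := TensorProduct.ext' fun a b => rfl
      rw [this]
      rfl
    -- The sign operator is multiplicative on words, so it obeys the first-letter recursion. This
    -- rewrites s ⊗ D in the same form as the equation for D.
    have hs : s = C.counit.smulRight 1 + conv m (ι ∘ₗ σ) s := by
      ext x
      have h1 := congrArg s (eq_counit_add_mul x)
      rw [map_add, map_smul, show s 1 = 1 from signOp_one V.space] at h1
      refine h1.trans ?_
      rw [LinearMap.add_apply]
      congr 1
      have h2 : s (conv m (ι ∘ₗ TensorAlgebra.ιInv) (LinearMap.id : C →ₗ[K] C) x) =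
          conv m (ι ∘ₗ σ) s x := conv_congr (fun a b => by
        change s (ι (TensorAlgebra.ιInv a) * b) = ι (signOp V.space (TensorAlgebra.ιInv a)) * s b
        refine (signOp_mul V.space _ _).trans ?_
        congr 1
        exact signOp_comp_zero (ι_degree V.space) _) x
      exact h2
    let ω : C →ₗ[K] T2 := mk 1 ∘ₗ D + conv B δ (deconc K V.space)
    have hB : ∀ (f : C →ₗ[K] V.space) (g : C →ₗ[K] T2), conv B' (ι ∘ₗ f) g = conv B f g :=
      fun f g => conv_comp_left _ _ _ _
    have h1 : ω + conv B σ (deconc K V.space ∘ₗ D) = deconc K V.space ∘ₗ D := by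
      ext x
      have h2 : (deconc K V.space - mk 1) (conv m (ι ∘ₗ σ) D x) =
          conv B σ (deconc K V.space ∘ₗ D) x := conv_congr (fun a b => by
        change deconc K _ (TensorAlgebra.ι K (σ a) * D b) -
          1 ⊗ₜ (TensorAlgebra.ι K (σ a) * D b) = _
        rw [deconc_ι_mul, add_sub_cancel_left]
        rfl) x
      have h3 : (deconc K V.space - mk 1) (w x) = conv B δ (deconc K V.space) x :=
        conv_congr (fun a b => by
          change deconc K _ (TensorAlgebra.ι K (δ a) * b) -
          1 ⊗ₜ (TensorAlgebra.ι K (δ a) * b) = _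
          rw [deconc_ι_mul, add_sub_cancel_left]
          rfl) x
      change mk 1 (D x) + conv B δ (deconc K V.space) x + conv B σ (deconc K V.space ∘ₗ D) x =
        deconc K V.space (D x)
      rw [← h2, ← h3, hDx x, LinearMap.sub_apply, LinearMap.sub_apply]
      simp only [map_add]
      abel
    -- (D ⊗ id + s ⊗ D)Δ solves the equation that `h1` gives for ΔD, with inhomogeneous term ω = 1 ⊗
    -- D + δ ∗ Δ.
    have h3 : ω + conv B σ (conv mk D LinearMap.id + conv mk s D) =
        conv mk D LinearMap.id + conv mk s D := by
      have h4 : conv mk s D = mk 1 ∘ₗ D + conv B σ (conv mk s D) := by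
        have h5 : conv mk (C.counit.smulRight 1) D = mk 1 ∘ₗ D := by
          ext x
          rw [conv_counit_left]
          rfl
        have h6 : conv mk (conv m (ι ∘ₗ σ) s) D = conv B σ (conv mk s D) :=
          (conv_assoc (B₃ := B') fun a b c => rfl).trans (hB _ _)
        nth_rewrite 1 [hs]
        rw [conv_add_left, h5, h6]
      have h7 : conv mk D LinearMap.id = conv B δ (deconc K V.space) +
          conv B σ (conv mk D LinearMap.id) := by
        have h8 : conv mk w LinearMap.id = conv B δ (deconc K V.space) := by
          refine ((conv_assoc (B₃ := B') (B₄ := mk) fun a b c => rfl).trans (hB _ _)).trans ?_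
          congr 1
          ext x
          rw [hmk, TensorProduct.map_id]
          rfl
        have h9 : conv mk (conv m (ι ∘ₗ σ) D) LinearMap.id =
            conv B σ (conv mk D LinearMap.id) :=
          (conv_assoc (B₃ := B') fun a b c => rfl).trans (hB _ _)
        nth_rewrite 1 [← hD]
        rw [conv_add_left, h8, h9]
      rw [conv_add_right]
      conv_rhs => rw [h7, h4]
      simp only [ω]
      abel
    have h6 := (isContraction_conv_right B hσ1 ω).unique hC h1 h3
    intro x
    rw [← hmk, ← hmk]
    exact DFunLike.congr_fun h6 x
  · have h1 : conv V.circ.mul δ p + conv V.circ.mul σ (p ∘ₗ D) = p ∘ₗ D := by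
      ext x
      have h2 : p (conv m (ι ∘ₗ σ) D x) = conv V.circ.mul σ (p ∘ₗ D) x :=
        conv_congr (fun a b => V.circProd_ι_mul _ _) x
      have h3 : p (w x) = conv V.circ.mul δ p x :=
        conv_congr (fun a b => V.circProd_ι_mul _ _) x
      rw [LinearMap.add_apply, ← h2, ← h3, LinearMap.comp_apply, hDx x, map_add]
    exact DFunLike.congr_fun
      ((isContraction_conv_right V.circ.mul hσ1 (conv V.circ.mul δ p)).unique hC h1 hdpδ)

end
end BInf

namespace BInf
noncomputable section
variable {K : Type u} [Field K]

/-! ### Coderivations of tensor products -/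

section MapSub
variable {M N P Q : Type u} [AddCommGroup M] [Module K M] [AddCommGroup N] [Module K N]
  [AddCommGroup P] [Module K P] [AddCommGroup Q] [Module K Q]

theorem tensor_map_sub_left (f g : M →ₗ[K] P) (h : N →ₗ[K] Q) :
    TensorProduct.map (f - g) h = TensorProduct.map f h - TensorProduct.map g h :=
  TensorProduct.ext' fun _ _ => by simp [sub_tmul]

theorem tensor_map_sub_right (f : M →ₗ[K] P) (g h : N →ₗ[K] Q) :
    TensorProduct.map f (g - h) = TensorProduct.map f g - TensorProduct.map f h :=
  TensorProduct.ext' fun _ _ => by simp [tmul_sub]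

theorem tensor_map_neg_left (f : M →ₗ[K] P) (h : N →ₗ[K] Q) :
    TensorProduct.map (-f) h = -TensorProduct.map f h :=
  TensorProduct.ext' fun _ _ => by simp [neg_tmul]

end MapSub

/-- Lowering the degree of the second factor by one changes the sign of the interchange by the
parity of the third, which `signOp W` restores. -/
theorem gswap_map_second {V V' W W' : GrVect K} {d : V' →ₗ[K] V'} (hd : HasDegree (-1) d)
    (t : V ⊗[K] V') (s : W ⊗[K] W') :
    gswap V V' W W' (TensorProduct.map (signOp V) d t ⊗ₜ s) =
      TensorProduct.map (TensorProduct.map (signOp V) (signOp W)) (TensorProduct.map d LinearMap.id)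
        (gswap V V' W W' (t ⊗ₜ s)) := by
  have : gswap V V' W W' ∘ₗ (TensorProduct.map (signOp V) d).rTensor _ =
      TensorProduct.map (TensorProduct.map (signOp V) (signOp W))
        (TensorProduct.map d LinearMap.id) ∘ₗ gswap V V' W W' := by
    refine TensorProduct.ext (TensorProduct.ext (LinearMap.ext fun a => GrVect.hom_ext
      fun i b hb => TensorProduct.ext (GrVect.hom_ext fun j c hc => LinearMap.ext fun e => ?_)))
    change gswap V V' W W' ((signOp V a ⊗ₜ d b) ⊗ₜ (c ⊗ₜ e)) = TensorProduct.map _ _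
      (gswap V V' W W' ((a ⊗ₜ b) ⊗ₜ (c ⊗ₜ e)))
    rw [gswap_tmul _ _ _ _ _ _ hb hc, gswap_tmul _ _ _ _ _ _ (hd _ _ hb) hc]
    simp only [map_smul, TensorProduct.map_tmul, signOp_eq W hc, tmul_smul, ← smul_tmul',
      smul_smul, ← ksgn_add, LinearMap.id_apply]
    rw [add_mul, neg_one_mul, ksgn_add, ksgn_neg, ksgn_add]
  exact DFunLike.congr_fun this (t ⊗ₜ s)

/-- Here the change is by the parity of the second factor, compensated by `signOp V'` before the
interchange. -/
theorem gswap_map_third {V V' W W' : GrVect K} {d : W →ₗ[K] W} (hd : HasDegree (-1) d)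
    (t : V ⊗[K] V') (s : W ⊗[K] W') :
    gswap V V' W W' (TensorProduct.map (signOp V) (signOp V') t ⊗ₜ
      TensorProduct.map d LinearMap.id s) =
      TensorProduct.map (TensorProduct.map (signOp V) d) LinearMap.id
        (gswap V V' W W' (t ⊗ₜ s)) := by
  have : gswap V V' W W' ∘ₗ TensorProduct.map (TensorProduct.map (signOp V) (signOp V'))
      (TensorProduct.map d LinearMap.id) =
      TensorProduct.map (TensorProduct.map (signOp V) d) LinearMap.id ∘ₗ gswap V V' W W' := by
    refine TensorProduct.ext (TensorProduct.ext (LinearMap.ext fun a => GrVect.hom_ext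
      fun i b hb => TensorProduct.ext (GrVect.hom_ext fun j c hc => LinearMap.ext fun e => ?_)))
    change gswap V V' W W' ((signOp V a ⊗ₜ signOp V' b) ⊗ₜ (d c ⊗ₜ e)) = TensorProduct.map _ _
      (gswap V V' W W' ((a ⊗ₜ b) ⊗ₜ (c ⊗ₜ e)))
    rw [gswap_tmul _ _ _ _ _ _ hb hc, signOp_eq V' hb, tmul_smul, ← smul_tmul', map_smul,
      gswap_tmul _ _ _ _ _ _ hb (hd _ _ hc)]
    simp only [map_smul, TensorProduct.map_tmul, smul_smul, ← ksgn_add, LinearMap.id_apply]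
    congr 2
    ring
  exact DFunLike.congr_fun this (t ⊗ₜ s)

/-- The differential `d ⊗ id + id ⊗ d` of a tensor product, with its Koszul signs. -/
def tensorD {C D : GrCoalg K} (d : C →ₗ[K] C) (d' : D →ₗ[K] D) : C ⊗[K] D →ₗ[K] C ⊗[K] D :=
  TensorProduct.map d LinearMap.id + TensorProduct.map (signOp C.toGrVect) d'

theorem signOp_comul (C : GrCoalg K) (x : C) : C.comul (signOp C.toGrVect x) =
    TensorProduct.map (signOp C.toGrVect) (signOp C.toGrVect) (C.comul x) := by
  rw [← signOp_tensor]
  exact (signOp_comp_zero C.comul_degree x).symm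

/-- Each side has four terms, one for every slot of (C ⊗ D) ⊗ (C ⊗ D) in which a differential can
stand. The interchange lemmas match them slot by slot. -/
theorem comul_tensorD {C D : GrCoalg K} {d : C →ₗ[K] C} {d' : D →ₗ[K] D}
    (hd : HasDegree (-1) d) (hd' : HasDegree (-1) d')
    (hc : ∀ x, C.comul (d x) = d.rTensor C (C.comul x) +
      TensorProduct.map (signOp C.toGrVect) d (C.comul x))
    (hc' : ∀ x, D.comul (d' x) = d'.rTensor D (D.comul x) +
      TensorProduct.map (signOp D.toGrVect) d' (D.comul x)) (t : C ⊗[K] D) :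
    (C.tensor D).comul (tensorD d d' t) =
      TensorProduct.map (tensorD d d') LinearMap.id ((C.tensor D).comul t) +
      TensorProduct.map (TensorProduct.map (signOp C.toGrVect) (signOp D.toGrVect)) (tensorD d d')
        ((C.tensor D).comul t) := by
  induction t using TensorProduct.induction_on with
  | zero => simp
  | add x y hx hy =>
    simp only [map_add, hx, hy]
    abel
  | tmul x y =>
    have h1 : ∀ r, TensorProduct.map (tensorD d d') (LinearMap.id : C ⊗[K] D →ₗ[K] C ⊗[K] D) r =
        TensorProduct.map (TensorProduct.map d LinearMap.id)
          (TensorProduct.map LinearMap.id LinearMap.id) r +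
        TensorProduct.map (TensorProduct.map (signOp C.toGrVect) d') LinearMap.id r := by
      intro r
      rw [tensorD, TensorProduct.map_add_left, LinearMap.add_apply, TensorProduct.map_id]
    have h2 : ∀ r, TensorProduct.map (TensorProduct.map (signOp C.toGrVect) (signOp D.toGrVect))
        (tensorD d d') r =
        TensorProduct.map (TensorProduct.map (signOp C.toGrVect) (signOp D.toGrVect))
          (TensorProduct.map d LinearMap.id) r +
        TensorProduct.map (TensorProduct.map (signOp C.toGrVect) (signOp D.toGrVect))
          (TensorProduct.map (signOp C.toGrVect) d') r := by
      intro r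
      rw [tensorD, TensorProduct.map_add_right, LinearMap.add_apply]
    rw [GrCoalg.tensor_comul_tmul, h1, h2, ← gswap_map_second hd, ← gswap_map_third hd',
      ← gswap_map _ _ (signOp_degree _) (signOp_degree _), ← gswap_map _ _ (HasDegree.id _)
      (HasDegree.id _), tensorD, LinearMap.add_apply, map_add, TensorProduct.map_tmul,
      TensorProduct.map_tmul, GrCoalg.tensor_comul_tmul, GrCoalg.tensor_comul_tmul, hc, hc',
      signOp_comul, TensorProduct.map_id]
    simp only [add_tmul, tmul_add, map_add, LinearMap.id_apply, LinearMap.rTensor]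
    abel

/-! ### Bialgebra structures -/

theorem DGBialgStr.ext' {C : GrCoalg K} {S S' : DGBialgStr C} (hm : S.mul = S'.mul)
    (hd : S.d = S'.d) : S = S' := by
  obtain ⟨⟨⟨m, _, _, _, _, _⟩, d, _, _, _⟩, _, _, _⟩ := S
  obtain ⟨⟨⟨m', _, _, _, _, _⟩, d', _, _, _⟩, _, _, _⟩ := S'
  obtain rfl : m = m' := hm
  obtain rfl : d = d' := hd
  rfl

theorem GrAlgStr.lift_mul_degree {V : GrVect K} {e : V} (S : GrAlgStr V e) :
    HasDegree (V := V.tensor V) (W := V) 0 (TensorProduct.lift S.mul) := by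
  intro n t ht
  have : tensorGr V V n ≤ (V.gr (n + 0)).comap (TensorProduct.lift S.mul) := by
    refine Submodule.span_le.2 ?_
    rintro _ ⟨i, j, rfl, a, ha, b, hb, rfl⟩
    rw [add_zero]
    exact S.mul_mem _ _ _ ha _ hb
  exact this ht

theorem DGBialgStr.isCoalgHom_mul {C : GrCoalg K} (S : DGBialgStr C) :
    IsCoalgHom (C := C.tensor C) (D := C) (TensorProduct.lift S.mul) where
  degree := S.lift_mul_degree
  comul := by
    refine DFunLike.congr_fun (f := C.comul ∘ₗ TensorProduct.lift S.mul)
      (g := TensorProduct.map (TensorProduct.lift S.mul) (TensorProduct.lift S.mul) ∘ₗ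
        (C.tensor C).comul) ?_
    exact TensorProduct.ext' fun x y => S.comul_mul x y
  counit := by
    refine DFunLike.congr_fun (f := C.counit ∘ₗ TensorProduct.lift S.mul)
      (g := (C.tensor C).counit) ?_
    exact TensorProduct.ext' fun x y => S.counit_mul x y
  one := S.one_mul _

/-- The defining condition concerns only ker ε; on the constant parts the identity is the unit law
on both sides. -/
theorem DAsAlg.IsUnderlying.circProd_mul {V : DAsAlg K} {S : BInfStr V.space}
    (hS : V.IsUnderlying S) (x y : TensorAlgebra K V.space) :
    V.circProd (S.mul x y) = V.dg.mul (V.circProd x) (V.circProd y) := by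
  have h : ∀ z : TensorAlgebra K V.space, ∃ (c : K) (z' : TensorAlgebra K V.space),
      TensorAlgebra.algebraMapInv z' = 0 ∧ z = c • 1 + z' :=
    fun z => ⟨TensorAlgebra.algebraMapInv z, z - TensorAlgebra.algebraMapInv z • 1, by simp,
      by simp⟩
  obtain ⟨c, x', hx, rfl⟩ := h x
  obtain ⟨c', y', hy, rfl⟩ := h y
  have h1 : ∀ z, S.mul (1 : TensorAlgebra K V.space) z = z := S.one_mul
  have h2 : ∀ z, S.mul z (1 : TensorAlgebra K V.space) = z := S.mul_one
  simp only [map_add, map_smul, LinearMap.add_apply, LinearMap.smul_apply, h1, h2, hS.mul x' y' hx hy,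
    V.circProd_one, V.dg.one_mul, V.dg.mul_one]

theorem DAsAlg.IsUnderlying.circProd_d {V : DAsAlg K} {S : BInfStr V.space}
    (hS : V.IsUnderlying S) (x : TensorAlgebra K V.space) :
    V.circProd (S.d x) = V.dg.d (V.circProd x) := by
  obtain ⟨c, x', hx, rfl⟩ : ∃ (c : K) (x' : TensorAlgebra K V.space),
      TensorAlgebra.algebraMapInv x' = 0 ∧ x = c • 1 + x' :=
    ⟨TensorAlgebra.algebraMapInv x, x - TensorAlgebra.algebraMapInv x • 1, by simp, by simp⟩
  have h1 : S.d (1 : TensorAlgebra K V.space) = 0 := S.d_one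
  simp only [map_add, map_smul, h1, hS.d x' hx, V.circProd_one, V.dg.d_one, map_zero]

/-! ### The underlying B-infinity structure -/

/-- A coderivation along coalgebra maps which is killed by `circProd` vanishes. -/
theorem d_mul_of_circProd (V : DAsAlg K)
    {μ : TensorAlgebra K V.space ⊗[K] TensorAlgebra K V.space →ₗ[K] TensorAlgebra K V.space}
    {D : TensorAlgebra K V.space →ₗ[K] TensorAlgebra K V.space}
    (hμ : IsCoalgHom (C := (tensorCoalg V.space).tensor (tensorCoalg V.space))
      (D := tensorCoalg V.space) μ)
    (hμc : ∀ x y, V.circProd (μ (x ⊗ₜ y)) = V.dg.mul (V.circProd x) (V.circProd y))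
    (hDd : HasDegree (V := tensorVect V.space) (W := tensorVect V.space) (-1) D)
    (hD1 : D 1 = 0)
    (hD : ∀ x, deconc K V.space (D x) = TensorProduct.map D LinearMap.id (deconc K V.space x) +
        TensorProduct.map (signOp (tensorVect V.space)) D (deconc K V.space x))
    (hDc : ∀ x, V.circProd (D x) = V.dg.d (V.circProd x)) :
    D ∘ₗ μ = μ ∘ₗ tensorD (C := tensorCoalg V.space) (D := tensorCoalg V.space) D D := by
  let T := tensorCoalg V.space
  let s := signOp (tensorVect V.space)
  let E := tensorD (C := T) (D := T) D D
  have hT := GrCoalg.tensor_radical (tensorCoalg_radical V.space) (tensorCoalg_radical V.space)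
  have hE1 : E ((1 : TensorAlgebra K V.space) ⊗ₜ (1 : TensorAlgebra K V.space)) = 0 := by
    change D 1 ⊗ₜ _ + s 1 ⊗ₜ D 1 = 0
    rw [hD1, zero_tmul, tmul_zero, add_zero]
  have hμ1 : μ ((1 : TensorAlgebra K V.space) ⊗ₜ (1 : TensorAlgebra K V.space)) = 1 := hμ.one
  have hs1 : s 1 = 1 := signOp_one V.space
  have hsμ : μ ∘ₗ TensorProduct.map s s = s ∘ₗ μ := by
    refine LinearMap.ext fun t => ?_
    have := signOp_comp_zero hμ.degree t
    rw [signOp_tensor] at this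
    exact this.symm
  -- Dμ and μ(D ⊗ id + s ⊗ D) are both coderivations along sμ and μ. Their difference is killed by
  -- `circProd` by the Leibniz rule in V.
  refine sub_eq_zero.1 (eq_zero_of_circProd_eq_zero V hT (f := μ) (g := s ∘ₗ μ) hμ.one ?_ ?_ ?_ ?_)
  · exact (congrArg s hμ1).trans hs1
  · change D (μ (1 ⊗ₜ 1)) - μ (E (1 ⊗ₜ 1)) = 0
    rw [hμ1, hD1, hE1, map_zero, sub_zero]
  · intro t
    have h1 : deconc K V.space (μ t) = TensorProduct.map μ μ ((T.tensor T).comul t) := hμ.comul t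
    have h2 : deconc K V.space (μ (E t)) = TensorProduct.map μ μ ((T.tensor T).comul (E t)) :=
      hμ.comul (E t)
    rw [comul_tensorD hDd hDd hD hD] at h2
    change deconc K V.space (D (μ t) - μ (E t)) = _
    rw [map_sub, hD, h1, h2]
    generalize (T.tensor T).comul t = r
    rw [← hsμ]
    simp only [map_add, ← TensorProduct.map_comp, ← LinearMap.comp_apply]
    rw [LinearMap.id_comp, LinearMap.comp_id, ← hsμ, tensor_map_sub_left,
      tensor_map_sub_right, LinearMap.sub_apply, LinearMap.sub_apply]
    abel
  · intro t
    change V.circProd (D (μ t) - μ (E t)) = 0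
    rw [map_sub, hDc, sub_eq_zero]
    induction t using TensorProduct.induction_on with
    | zero => simp
    | add x y hx hy => simp only [map_add, hx, hy]
    | tmul x y =>
      change _ = V.circProd (μ (D x ⊗ₜ y + s x ⊗ₜ D y))
      rw [map_add, map_add, hμc, hμc, hμc, V.dg.d_mul, hDc, hDc,
        signOp_comp_zero V.circProd_degree]

/-- Cofreeness lifts • and ∂ along `circProd`. Each axiom then equates two coalgebra maps or two
coderivations into T^c(V), from one, two or three tensor factors of T^c(V), so it follows from the
corresponding axiom of V. -/
theorem exists_isUnderlying (V : DAsAlg K) : ∃ S : BInfStr V.space, V.IsUnderlying S := by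
  let T := tensorCoalg V.space
  let s := signOp (tensorVect V.space)
  have hT : T.radical = ⊤ := tensorCoalg_radical V.space
  have hT2 := GrCoalg.tensor_radical hT hT
  have hT3 := GrCoalg.tensor_radical hT2 hT
  obtain ⟨μ, hμ, hμc⟩ := exists_coalgHom V hT2
    (ψ := TensorProduct.lift V.dg.mul ∘ₗ TensorProduct.map V.circProd V.circProd)
    (V.dg.lift_mul_degree.comp_zero (V.circProd_degree.map_zero V.circProd_degree))
    (by
      change V.dg.mul (V.circProd 1) (V.circProd 1) = V.one
      rw [V.circProd_one, V.dg.one_mul])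
  replace hμc : ∀ x y : TensorAlgebra K V.space, V.circProd (μ (x ⊗ₜ y)) =
      V.dg.mul (V.circProd x) (V.circProd y) := fun x y => hμc (x ⊗ₜ y)
  obtain ⟨D, hDd, hD1, hD, hDc⟩ := exists_coderivation V
  have hone : ∀ x : TensorAlgebra K V.space, μ ((1 : TensorAlgebra K V.space) ⊗ₜ x) = x := by
    have := coalgHom_ext V hT (hμ.comp (GrCoalg.isCoalgHom_one_tmul T T)) (IsCoalgHom.id T)
      fun x => by
        change V.circProd (μ ((1 : TensorAlgebra K V.space) ⊗ₜ x)) = V.circProd x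
        rw [hμc, V.circProd_one, V.dg.one_mul]
    exact DFunLike.congr_fun this
  have hone' : ∀ x : TensorAlgebra K V.space, μ (x ⊗ₜ (1 : TensorAlgebra K V.space)) = x := by
    have := coalgHom_ext V hT (hμ.comp (GrCoalg.isCoalgHom_tmul_one T T)) (IsCoalgHom.id T)
      fun x => by
        change V.circProd (μ (x ⊗ₜ (1 : TensorAlgebra K V.space))) = V.circProd x
        rw [hμc, V.circProd_one, V.dg.mul_one]
    exact DFunLike.congr_fun this
  have hassoc : ∀ x y z : TensorAlgebra K V.space,
      μ (μ (x ⊗ₜ y) ⊗ₜ z) = μ (x ⊗ₜ μ (y ⊗ₜ z)) := by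
    have := coalgHom_ext V hT3 (hμ.comp (hμ.tensor (IsCoalgHom.id T)))
      ((hμ.comp ((IsCoalgHom.id T).tensor hμ)).comp (IsCoalgHom.assoc T T T)) fun t => by
        refine DFunLike.congr_fun (f := V.circProd ∘ₗ μ ∘ₗ TensorProduct.map μ LinearMap.id)
          (g := V.circProd ∘ₗ (μ ∘ₗ TensorProduct.map LinearMap.id μ) ∘ₗ
            (TensorProduct.assoc K T T T).toLinearMap) ?_ t
        refine TensorProduct.ext_threefold fun x y z => ?_
        change V.circProd (μ (μ (x ⊗ₜ y) ⊗ₜ z)) = V.circProd (μ (x ⊗ₜ μ (y ⊗ₜ z)))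
        rw [hμc, hμc, hμc, hμc, V.dg.mul_assoc]
    exact fun x y z => DFunLike.congr_fun this ((x ⊗ₜ y) ⊗ₜ z)
  have hdμ := d_mul_of_circProd V hμ hμc hDd hD1 hD hDc
  -- D² is a coderivation without signs: D is odd, so the cross terms sD ⊗ D and Ds ⊗ D cancel.
  have hdd : D ∘ₗ D = 0 := by
    refine eq_zero_of_circProd_eq_zero V hT (f := LinearMap.id) (g := LinearMap.id) rfl rfl ?_ ?_ ?_
    · change D (D 1) = 0
      rw [hD1, map_zero]
    · intro x
      change deconc K V.space (D (D x)) = TensorProduct.map _ _ (deconc K V.space x) +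
        TensorProduct.map _ _ (deconc K V.space x)
      rw [hD, hD]
      generalize deconc K V.space x = r
      have hsD : s ∘ₗ D = -(D ∘ₗ s) := by
        ext t : 1
        change s (D t) = -(D (s t))
        rw [signOp_comp hDd, ksgn_neg_one, neg_one_smul]
      have hss : s ∘ₗ s = LinearMap.id := by
        ext t : 1
        exact signOp_signOp _ t
      simp only [map_add, ← TensorProduct.map_comp, ← LinearMap.comp_apply]
      rw [LinearMap.id_comp, LinearMap.id_comp, LinearMap.comp_id, hsD, hss,
        tensor_map_neg_left, LinearMap.neg_apply]
      abel
    · intro x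
      change V.circProd (D (D x)) = 0
      rw [hDc, hDc, V.dg.d_d]
  refine ⟨{
    mul := TensorProduct.curry μ
    mul_mem := fun i j x hx y hy => by
      have := hμ.degree _ _ (GrVect.tmul_mem_tensorGr (V := tensorVect V.space)
        (W := tensorVect V.space) rfl hx hy)
      rwa [add_zero] at this
    one_mem := T.one_mem
    mul_assoc := hassoc
    one_mul := hone
    mul_one := hone'
    d := D
    d_degree := hDd
    d_d := DFunLike.congr_fun hdd
    d_mul := fun x y => (DFunLike.congr_fun hdμ (x ⊗ₜ y)).trans (map_add μ _ _)
    comul_mul := fun x y => by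
      rw [show TensorProduct.lift (TensorProduct.curry μ) = μ from
        TensorProduct.lift_mk_compr₂ μ]
      exact hμ.comul (x ⊗ₜ y)
    counit_mul := fun x y => hμ.counit (x ⊗ₜ y)
    comul_d := hD }, fun x y _ _ => hμc x y, fun x _ => hDc x⟩

theorem isUnderlying_unique (V : DAsAlg K) {S S' : BInfStr V.space} (hS : V.IsUnderlying S)
    (hS' : V.IsUnderlying S') : S = S' := by
  have hT : (tensorCoalg V.space).radical = ⊤ := tensorCoalg_radical V.space
  refine DGBialgStr.ext' ?_ ?_
  · have := coalgHom_ext V (GrCoalg.tensor_radical hT hT) S.isCoalgHom_mul S'.isCoalgHom_mul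
      fun t => by
        induction t using TensorProduct.induction_on with
        | zero => simp
        | add x y hx hy => rw [map_add, map_add, map_add, map_add, hx, hy]
        | tmul x y => exact (hS.circProd_mul x y).trans (hS'.circProd_mul x y).symm
    exact LinearMap.ext fun x => LinearMap.ext fun y => DFunLike.congr_fun this (x ⊗ₜ y)
  · refine sub_eq_zero.1 (eq_zero_of_circProd_eq_zero V hT (f := LinearMap.id)
      (g := signOp (tensorVect V.space)) rfl (signOp_one _) ?_ ?_ ?_)
    · rw [LinearMap.sub_apply, S.d_one, S'.d_one, sub_zero]
    · intro x
      have h1 := S.comul_d x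
      have h2 := S'.comul_d x
      change deconc K V.space (S.d x) = _ at h1
      change deconc K V.space (S'.d x) = _ at h2
      rw [LinearMap.sub_apply, map_sub, h1, h2, tensor_map_sub_left,
        tensor_map_sub_right]
      simp only [LinearMap.sub_apply, LinearMap.rTensor]
      abel
    · intro x
      rw [LinearMap.sub_apply, map_sub, hS.circProd_d, hS'.circProd_d, sub_self]

/-! ### The universal enveloping algebra -/

/-- The homomorphism from the words in a space to a 2-associative algebra which extends a map. -/
def DAsAlg.extend (V : DAsAlg K) {A : Type u} [AddCommGroup A] [Module K A] (f : A →ₗ[K] V.space) :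
    TensorAlgebra K A →ₗ[K] V.space :=
  V.circProd ∘ₗ (tensorMap f).toLinearMap

section Extend
variable (V : DAsAlg K) {A : Type u} [AddCommGroup A] [Module K A] (f : A →ₗ[K] V.space)

theorem DAsAlg.extend_apply (x : TensorAlgebra K A) :
    V.extend f x = V.circProd (tensorMap f x) := rfl

theorem DAsAlg.extend_one : V.extend f 1 = V.one := by
  rw [extend_apply, map_one, circProd_one]

theorem DAsAlg.extend_ι (a : A) : V.extend f (TensorAlgebra.ι K a) = f a := by
  rw [extend_apply, tensorMap_ι, circProd_ι]

theorem DAsAlg.extend_ι_mul (a : A) (x : TensorAlgebra K A) :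
    V.extend f (TensorAlgebra.ι K a * x) = V.circ.mul (f a) (V.extend f x) := by
  rw [extend_apply, map_mul, tensorMap_ι, circProd_ι_mul, extend_apply]

theorem DAsAlg.extend_mul (x y : TensorAlgebra K A) :
    V.extend f (x * y) = V.circ.mul (V.extend f x) (V.extend f y) := by
  induction x using tensor_left_induction with
  | one => rw [_root_.one_mul, extend_one, V.circ.one_mul]
  | mul v x hx => rw [_root_.mul_assoc, extend_ι_mul, hx, extend_ι_mul, V.circ.mul_assoc]
  | add x y hx hy => rw [add_mul, map_add, hx, hy, map_add, map_add, LinearMap.add_apply]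
  | smul r x hx => rw [smul_mul_assoc, map_smul, hx, map_smul, map_smul, LinearMap.smul_apply]

variable {V f} in
theorem DAsAlg.eq_extend {F : TensorAlgebra K A →ₗ[K] V.space} (h1 : F 1 = V.one)
    (hm : ∀ x y, F (x * y) = V.circ.mul (F x) (F y)) (hf : ∀ a, F (TensorAlgebra.ι K a) = f a) :
    F = V.extend f := by
  ext x
  induction x using tensor_left_induction with
  | one => rw [h1, extend_one]
  | mul v x hx => rw [hm, hx, hf, extend_ι_mul]
  | add x y hx hy => rw [map_add, map_add, hx, hy]
  | smul r x hx => rw [map_smul, map_smul, hx]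

end Extend

theorem DAsAlg.extend_degree (V : DAsAlg K) {A : GrVect K} {f : A →ₗ[K] V.space}
    (hf : HasDegree 0 f) : HasDegree (V := tensorVect A) (W := V.space) 0 (V.extend f) :=
  V.circProd_degree.comp_zero (tensorMap_degree hf)

/-- The extension factors as `circProd ∘ T(f)`: T(f) respects μ and d by hypothesis, and `circProd`
carries these to • and ∂. -/
theorem isHom_extend {A : BInfAlg K} {V : DAsAlg K} {S : BInfStr V.space}
    (hS : V.IsUnderlying S) {f : A.space →ₗ[K] V.space} (hf : IsBInfHom A.str S f) :
    DAsAlg.IsHom ((env K).obj A).toDAsAlg V (V.extend f) where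
  degree := V.extend_degree hf.degree
  map_one := V.extend_one f
  map_bullet x y :=
    (congrArg V.circProd (hf.map_mul x y)).trans (hS.circProd_mul _ _)
  map_circ := V.extend_mul f
  map_d x := (congrArg V.circProd (hf.map_d x)).trans (hS.circProd_d _)

/-- Freeness of words under concatenation gives F = `circProd ∘ T(f)` with f = F on letters. So the
two sides of each identity for T(f) agree after `circProd`; for the products they are coalgebra
maps, and for the differentials the difference is a coderivation along sT(f) and T(f). -/
theorem isBInfHom_of_isHom {A : BInfAlg K} {V : DAsAlg K} {S : BInfStr V.space}
    (hS : V.IsUnderlying S) {F : TensorAlgebra K A.space →ₗ[K] V.space}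
    (hF : DAsAlg.IsHom ((env K).obj A).toDAsAlg V F) :
    IsBInfHom A.str S (F ∘ₗ TensorAlgebra.ι K) := by
  let f : A.space →ₗ[K] V.space := F ∘ₗ TensorAlgebra.ι K
  have hfd : HasDegree 0 f := HasDegree.comp_zero hF.degree (ι_degree A.space)
  have hFf : ∀ x, V.circProd (tensorMap f x) = F x := fun x =>
    (DFunLike.congr_fun (DAsAlg.eq_extend hF.map_one hF.map_circ fun _ => rfl) x).symm
  have hT : (tensorCoalg A.space).radical = ⊤ := tensorCoalg_radical A.space
  have hf := tensorMap_isCoalgHom hfd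
  refine ⟨hfd, fun x y => ?_, fun x => ?_⟩
  · have := coalgHom_ext V (GrCoalg.tensor_radical hT hT) (hf.comp A.str.isCoalgHom_mul)
      (S.isCoalgHom_mul.comp (hf.tensor hf)) fun t => by
        refine DFunLike.congr_fun (f := V.circProd ∘ₗ (tensorMap f).toLinearMap ∘ₗ
          TensorProduct.lift A.str.mul) (g := V.circProd ∘ₗ TensorProduct.lift S.mul ∘ₗ
          TensorProduct.map (tensorMap f).toLinearMap (tensorMap f).toLinearMap) ?_ t
        refine TensorProduct.ext' fun x y => ?_
        refine (hFf _).trans ((hF.map_bullet x y).trans ?_)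
        refine Eq.trans ?_ (hS.circProd_mul _ _).symm
        exact congrArg₂ (fun a b => V.dg.mul a b) (hFf x).symm (hFf y).symm
    exact DFunLike.congr_fun this (x ⊗ₜ y)
  · let g : TensorAlgebra K A.space →ₗ[K] TensorAlgebra K V.space := (tensorMap f).toLinearMap
    have hg1 : g 1 = 1 := map_one (tensorMap f)
    have hgs : signOp (tensorVect V.space) ∘ₗ g = g ∘ₗ signOp (tensorVect A.space) := by
      ext x : 1
      exact signOp_comp_zero hf.degree x
    have hgc : ∀ x, deconc K V.space (g x) = TensorProduct.map g g (deconc K A.space x) :=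
      hf.comul
    have h := eq_zero_of_circProd_eq_zero V hT (h := g ∘ₗ A.str.d - S.d ∘ₗ g) (f := g)
      (g := signOp (tensorVect V.space) ∘ₗ g) hg1
      ((congrArg (signOp (tensorVect V.space)) hg1).trans (signOp_one _)) ?_ ?_ ?_
    · exact sub_eq_zero.1 (DFunLike.congr_fun h x)
    · change g (A.str.d (tensorCoalg A.space).one) - S.d (g 1) = 0
      rw [A.str.d_one, hg1, map_zero, zero_sub, neg_eq_zero]
      exact S.d_one
    · intro x
      have h1 : deconc K A.space (A.str.d x) = _ := A.str.comul_d x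
      have h2 : deconc K V.space (S.d (g x)) = _ := S.comul_d (g x)
      change deconc K V.space (g (A.str.d x) - S.d (g x)) = _
      have h3 : (tensorCoalg V.space).comul (g x) = TensorProduct.map g g (deconc K A.space x) :=
        hgc x
      rw [map_sub, h2, hgc, h1, h3]
      change _ = TensorProduct.map _ _ (deconc K A.space x) +
        TensorProduct.map _ _ (deconc K A.space x)
      change TensorProduct.map g g (LinearMap.rTensor _ _ (deconc K A.space x) +
        TensorProduct.map _ _ (deconc K A.space x)) - _ = _
      generalize deconc K A.space x = r
      simp only [map_add, LinearMap.rTensor, ← TensorProduct.map_comp, ← LinearMap.comp_apply]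
      rw [hgs, LinearMap.comp_id, LinearMap.id_comp, tensor_map_sub_left,
        tensor_map_sub_right, LinearMap.sub_apply, LinearMap.sub_apply]
      abel
    · intro x
      change V.circProd (g (A.str.d x) - S.d (g x)) = 0
      rw [map_sub, hS.circProd_d, sub_eq_zero]
      refine (hFf _).trans ((hF.map_d x).trans ?_)
      exact congrArg V.dg.d (hFf x).symm

end
end BInf

namespace BInf
noncomputable section
variable {K : Type u} [Field K]

/-! ### Injectivity of coalgebra maps -/

theorem tensor_map_injective {M N P Q : Type u} [AddCommGroup M] [Module K M] [AddCommGroup N]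
    [Module K N] [AddCommGroup P] [Module K P] [AddCommGroup Q] [Module K Q] {f : M →ₗ[K] P}
    {g : N →ₗ[K] Q} (hf : Function.Injective f) (hg : Function.Injective g) :
    Function.Injective (TensorProduct.map f g) := by
  obtain ⟨f', hf'⟩ := LinearMap.exists_leftInverse_of_injective f (LinearMap.ker_eq_bot.2 hf)
  obtain ⟨g', hg'⟩ := LinearMap.exists_leftInverse_of_injective g (LinearMap.ker_eq_bot.2 hg)
  refine Function.LeftInverse.injective (g := TensorProduct.map f' g') fun t => ?_
  rw [← LinearMap.comp_apply, ← TensorProduct.map_comp, hf', hg', TensorProduct.map_id,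
    LinearMap.id_apply]

/-- If f is injective on F_r then f ⊗ f is injective on F_r ⊗ F_r. For x in F_{r+1} with f(x) = 0
this forces Δ̄x = 0, so x is primitive and the hypothesis applies. -/
theorem IsCoalgHom.injective {C D : GrCoalg K} {f : C →ₗ[K] D} (hf : IsCoalgHom f)
    (hC : C.radical = ⊤) (h : ∀ x ∈ C.primitives, f x = 0 → x = 0) : Function.Injective f := by
  rw [injective_iff_map_eq_zero]
  have key : ∀ r, ∀ x ∈ C.filt r, f x = 0 → x = 0 := by
    intro r
    induction r with
    | zero =>
      intro x hx hfx
      obtain ⟨c, rfl⟩ := C.mem_filt_zero.1 hx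
      have := hf.counit (c • C.one)
      rw [hfx, map_zero, map_smul, show C.counit C.one = 1 from C.counit_one, smul_eq_mul,
        mul_one] at this
      rw [← this, zero_smul]
    | succ r ih =>
      intro x hx hfx
      refine h x ⟨?_, ?_⟩ hfx
      · change C.counit x = 0
        rw [← hf.counit, hfx, map_zero]
      · change C.redComul x = 0
        rw [C.mem_filt_succ] at hx
        obtain ⟨t, ht⟩ := hx
        have h1 := hf.redComul x
        rw [hfx, map_zero, ← ht, ← LinearMap.comp_apply, ← TensorProduct.map_comp] at h1
        have h2 : Function.Injective (f ∘ₗ (C.filt r).subtype) := by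
          rw [injective_iff_map_eq_zero]
          exact fun a ha => Subtype.ext (ih a a.2 ha)
        rw [← ht, (injective_iff_map_eq_zero _).1 (tensor_map_injective h2 h2) t h1.symm, map_zero]
  intro x hx
  obtain ⟨r, hr⟩ := C.mem_radical.1 (hC ▸ Submodule.mem_top : x ∈ C.radical)
  exact key r x hr hx

theorem eq_ι_of_mem_primitives (A : GrVect K) {x : TensorAlgebra K A}
    (hx : x ∈ (tensorCoalg A).primitives) : x = TensorAlgebra.ι K (TensorAlgebra.ιInv x) := by
  refine eq_ι_of_deconc_eq ?_
  have h : (tensorCoalg A).redComul x = 0 := hx.2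
  have := (tensorCoalg A).comul_eq x
  rw [h, add_zero] at this
  exact this

theorem ι_mem_primitives (A : GrVect K) (a : A) :
    TensorAlgebra.ι K a ∈ (tensorCoalg A).primitives := by
  refine ⟨algebraMapInv_ι a, ?_⟩
  change deconc K A _ - _ ⊗ₜ 1 - 1 ⊗ₜ _ = 0
  rw [deconc_ι]
  abel

/-! ### The radical of a differential graded bialgebra -/

theorem signOp_isCoalgHom (C : GrCoalg K) : IsCoalgHom (signOp C.toGrVect : C →ₗ[K] C) where
  degree := signOp_degree _
  comul := signOp_comul C
  counit x := by
    have : C.counit ∘ₗ signOp C.toGrVect = C.counit := by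
      refine GrVect.hom_ext fun i v hv => ?_
      rw [LinearMap.comp_apply, signOp_eq _ hv, map_smul]
      by_cases h : i = 0
      · rw [h, ksgn_zero, one_smul]
      · rw [show C.counit v = 0 from C.counit_eq_zero i h v hv, smul_zero]
    exact DFunLike.congr_fun this x
  one := by rw [signOp_eq _ C.one_mem, ksgn_zero, one_smul]

/-- Because d(1) = 0, the coderivation rule also holds for Δ̄. -/
theorem DGBialgStr.d_mem_filt {C : GrCoalg K} (S : DGBialgStr C) (r : ℕ) :
    ∀ x ∈ C.filt r, S.d x ∈ C.filt r := by
  induction r with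
  | zero =>
    intro x hx
    obtain ⟨c, rfl⟩ := C.mem_filt_zero.1 hx
    rw [map_smul, S.d_one, smul_zero]
    exact Submodule.zero_mem _
  | succ r ih =>
    intro x hx
    rw [C.mem_filt_succ] at hx ⊢
    have h1 : C.redComul (S.d x) = TensorProduct.map S.d LinearMap.id (C.redComul x) +
        TensorProduct.map (signOp C.toGrVect) S.d (C.redComul x) := by
      rw [C.redComul_apply, C.redComul_apply, S.comul_d]
      simp only [map_sub, map_tmul, S.d_one, (signOp_isCoalgHom C).one, tmul_zero, zero_tmul,
        LinearMap.rTensor, LinearMap.id_apply]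
      abel
    rw [h1]
    exact Submodule.add_mem _ (map_mem_tens ih (fun b hb => hb) hx)
      (map_mem_tens ((signOp_isCoalgHom C).map_filt r) ih hx)

theorem DGBialgStr.d_mem_radical {C : GrCoalg K} (S : DGBialgStr C) {x : C} (hx : x ∈ C.radical) :
    S.d x ∈ C.radical := by
  obtain ⟨r, hr⟩ := C.mem_radical.1 hx
  exact C.mem_radical.2 ⟨r, S.d_mem_filt r x hr⟩

/-! ### Lifting a reduced comultiplication to the tensor coalgebra -/

/-- Coassociativity stated for t = Δ̄x alone: the cocycle condition required by
`deconc_eq_of_cocycle`. -/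
theorem GrCoalg.lTensor_comul_redComul (C : GrCoalg K) (x : C) :
    C.comul.lTensor C (C.redComul x) = TensorProduct.assoc K C C C (C.comul.rTensor C (C.redComul x)) +
      TensorProduct.assoc K C C C (C.redComul x ⊗ₜ C.one) - C.one ⊗ₜ C.redComul x := by
  have h := DFunLike.congr_fun (Coalgebra.coassoc (R := K) (A := C)) x
  simp only [LinearMap.comp_apply, LinearEquiv.coe_coe] at h
  rw [C.redComul_apply]
  simp only [map_sub, sub_tmul, tmul_sub, LinearMap.lTensor_tmul, LinearMap.rTensor_tmul,
    show C.comul C.one = _ from C.comul_one, assoc_tmul]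
  rw [h]
  abel

/-- Integrates the cocycle t. A word is recovered from its comultiplication by joining the first
letter to the rest, so y is obtained from t by keeping the one-letter part of the left factor and
multiplying. With Q the same operation on the first two of three factors, Δy = 1 ⊗ y + Q((id ⊗ Δ)t),
and the cocycle condition evaluates the last term. -/
theorem deconc_eq_of_cocycle {M : Type u} [AddCommGroup M] [Module K M]
    {t : TensorAlgebra K M ⊗[K] TensorAlgebra K M}
    (h1 : (TensorAlgebra.algebraMapInv : TensorAlgebra K M →ₐ[K] K).toLinearMap.rTensor _ t = 0)
    (h2 : (deconc K M).lTensor _ t = TensorProduct.assoc K _ _ _ ((deconc K M).rTensor _ t) +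
      TensorProduct.assoc K _ _ _ (t ⊗ₜ[K] (1 : TensorAlgebra K M)) - (1 : TensorAlgebra K M) ⊗ₜ[K] t)
    {y : TensorAlgebra K M} (hy : y = LinearMap.mul' K _ (TensorProduct.map
      (TensorAlgebra.ι K ∘ₗ TensorAlgebra.ιInv) LinearMap.id t)) :
    deconc K M y = 1 ⊗ₜ y + y ⊗ₜ 1 + t := by
  let m : TensorAlgebra K M ⊗[K] TensorAlgebra K M →ₗ[K] TensorAlgebra K M :=
    LinearMap.mul' K _ ∘ₗ TensorProduct.map (TensorAlgebra.ι K ∘ₗ TensorAlgebra.ιInv) LinearMap.id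
  let Q : TensorAlgebra K M ⊗[K] (TensorAlgebra K M ⊗[K] TensorAlgebra K M) →ₗ[K]
      TensorAlgebra K M ⊗[K] TensorAlgebra K M :=
    m.rTensor _ ∘ₗ (TensorProduct.assoc K _ _ _).symm.toLinearMap
  have hm : ∀ s, deconc K M (m s) = 1 ⊗ₜ m s + Q ((deconc K M).lTensor _ s) := by
    intro s
    induction s using TensorProduct.induction_on with
    | zero => simp
    | add a b ha hb =>
      simp only [map_add, ha, hb, tmul_add]
      abel
    | tmul a b =>
      change deconc K M (TensorAlgebra.ι K (TensorAlgebra.ιInv a) * b) = 1 ⊗ₜ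
        (TensorAlgebra.ι K (TensorAlgebra.ιInv a) * b) + Q (a ⊗ₜ deconc K M b)
      rw [deconc_ι_mul]
      congr 1
      generalize deconc K M b = r
      induction r using TensorProduct.induction_on with
      | zero => simp
      | add a b ha hb => simp only [map_add, ha, hb, tmul_add]
      | tmul c d => rfl
  have hQ1 : ∀ s, Q (TensorProduct.assoc K _ _ _ ((deconc K M).rTensor _ s)) = s -
      (1 : TensorAlgebra K M) ⊗ₜ TensorProduct.lid K _
        ((TensorAlgebra.algebraMapInv : TensorAlgebra K M →ₐ[K] K).toLinearMap.rTensor _ s) := by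
    intro s
    induction s using TensorProduct.induction_on with
    | zero => simp
    | add a b ha hb =>
      simp only [map_add, ha, hb, tmul_add]
      abel
    | tmul a b =>
      have h : m (deconc K M a) = a - TensorAlgebra.algebraMapInv a • 1 :=
        eq_sub_of_add_eq' (eq_counit_add_mul a).symm
      simp only [Q, LinearMap.comp_apply, LinearEquiv.coe_coe, LinearEquiv.symm_apply_apply,
        LinearMap.rTensor_tmul]
      rw [h, sub_tmul, lid_tmul, tmul_smul, smul_tmul']
      rfl
  have hQ2 : Q (TensorProduct.assoc K _ _ _ (t ⊗ₜ[K] (1 : TensorAlgebra K M))) = m t ⊗ₜ 1 := by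
    simp [Q]
  have hQ3 : ∀ s, Q ((1 : TensorAlgebra K M) ⊗ₜ s) = 0 := by
    intro s
    induction s using TensorProduct.induction_on with
    | zero => simp
    | add a b ha hb => rw [tmul_add, map_add, ha, hb, add_zero]
    | tmul a b => simp [Q, m]
  have hy' : y = m t := hy
  rw [hy', hm, h2, map_sub, map_add, hQ1, hQ2, hQ3, h1]
  simp only [map_zero, tmul_zero, sub_zero]
  abel

/-! ### The map from the words in the primitive elements -/

namespace DAsBialg
variable (V : DAsBialg K)

/-- The map `v₁ ⋯ v_k ↦ v₁ ∘ ⋯ ∘ v_k` on words of primitive elements. -/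
def ofPrim : TensorAlgebra K V.prim →ₗ[K] V.coalg := V.toDAsAlg.extend V.primIncl

theorem primIncl_degree : HasDegree (V := V.prim) (W := V.coalg.toGrVect) 0 V.primIncl := by
  intro i v hv
  rw [add_zero]
  exact hv

theorem ofPrim_one : V.ofPrim 1 = V.coalg.one := V.toDAsAlg.extend_one _

theorem ofPrim_ι (p : V.prim) : V.ofPrim (TensorAlgebra.ι K p) = p := V.toDAsAlg.extend_ι _ p

theorem ofPrim_ι_mul (p : V.prim) (x : TensorAlgebra K V.prim) :
    V.ofPrim (TensorAlgebra.ι K p * x) = V.circ.mul p (V.ofPrim x) :=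
  V.toDAsAlg.extend_ι_mul _ p x

/-- The summand p ⊗ 1 of Δp produces p ⊗ w, which cancels the correction term. What remains has the
form of `deconc_ι_mul`. -/
theorem comul_circ_of_mem {p : V.coalg} (hp : p ∈ V.coalg.primitives) (w : V.coalg) :
    V.coalg.comul (V.circ.mul p w) = V.coalg.one ⊗ₜ V.circ.mul p w +
      (V.circ.mul p).rTensor V.coalg (V.coalg.comul w) := by
  have h : V.coalg.redComul p = 0 := hp.2
  rw [V.comul_circ, V.coalg.comul_eq p, h]
  simp only [map_add, LinearMap.lTensor_tmul, LinearMap.flip_apply, V.circ.one_mul,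
    add_zero]
  abel

/-- Applying ε ⊗ ε to the previous formula gives ε(p ∘ w) = ε(p ∘ w) + ε(p ∘ w). -/
theorem counit_circ_of_mem {p : V.coalg} (hp : p ∈ V.coalg.primitives) (w : V.coalg) :
    V.coalg.counit (V.circ.mul p w) = 0 := by
  have h := congrArg (LinearMap.mul' K K ∘ₗ TensorProduct.map V.coalg.counit V.coalg.counit)
    (V.comul_circ_of_mem hp w)
  have h1 : ∀ z, (LinearMap.mul' K K ∘ₗ TensorProduct.map V.coalg.counit V.coalg.counit)
      (V.coalg.comul z) = V.coalg.counit z := by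
    intro z
    have h2 : LinearMap.mul' K K ∘ₗ TensorProduct.map V.coalg.counit V.coalg.counit =
        V.coalg.counit ∘ₗ (TensorProduct.lid K V.coalg).toLinearMap ∘ₗ
          V.coalg.counit.rTensor V.coalg := TensorProduct.ext' fun a b => by simp
    rw [h2, LinearMap.comp_apply, LinearMap.comp_apply, V.coalg.rTensor_counit]
    simp
  have h3 : (LinearMap.mul' K K ∘ₗ TensorProduct.map V.coalg.counit V.coalg.counit)
      ((V.circ.mul p).rTensor V.coalg (V.coalg.comul w)) = V.coalg.counit (V.circ.mul p w) := by
    have h2 : (LinearMap.mul' K K ∘ₗ TensorProduct.map V.coalg.counit V.coalg.counit) ∘ₗ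
        (V.circ.mul p).rTensor V.coalg =
        (V.coalg.counit ∘ₗ V.circ.mul p) ∘ₗ (TensorProduct.rid K V.coalg).toLinearMap ∘ₗ
          V.coalg.counit.lTensor V.coalg := TensorProduct.ext' fun a b => by simp [mul_comm]
    rw [← LinearMap.comp_apply, h2, LinearMap.comp_apply, LinearMap.comp_apply,
      LinearMap.comp_apply, V.coalg.lTensor_counit]
    simp
  rw [h1, map_add, h3] at h
  have h4 : (LinearMap.mul' K K ∘ₗ TensorProduct.map V.coalg.counit V.coalg.counit)
      (V.coalg.one ⊗ₜ V.circ.mul p w) = V.coalg.counit (V.circ.mul p w) := by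
    simp [show V.coalg.counit V.coalg.one = 1 from V.coalg.counit_one]
  rw [h4] at h
  simpa using h

theorem ofPrim_isCoalgHom : IsCoalgHom (C := tensorCoalg V.prim) (D := V.coalg) V.ofPrim where
  degree := V.toDAsAlg.extend_degree V.primIncl_degree
  comul x := by
    change _ = TensorProduct.map _ _ (deconc K V.prim x)
    induction x using tensor_left_induction with
    | one =>
      rw [ofPrim_one, deconc_one, map_tmul, ofPrim_one]
      exact V.coalg.comul_one
    | add x y hx hy => simp only [map_add, hx, hy]
    | smul r x hx => simp only [map_smul, hx]
    | mul p x hx =>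
      rw [ofPrim_ι_mul, V.comul_circ_of_mem p.2, hx, deconc_ι_mul, map_add, map_tmul, ofPrim_one,
        ofPrim_ι_mul]
      congr 1
      generalize deconc K V.prim x = r
      induction r using TensorProduct.induction_on with
      | zero => simp
      | add a b ha hb => simp only [map_add, ha, hb]
      | tmul a b =>
        simp only [map_tmul, LinearMap.rTensor_tmul, LinearMap.mulLeft_apply]
        rw [ofPrim_ι_mul]
  counit x := by
    change _ = TensorAlgebra.algebraMapInv x
    induction x using tensor_left_induction with
    | one =>
      rw [ofPrim_one, map_one]
      exact V.coalg.counit_one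
    | add x y hx hy => rw [map_add, map_add, map_add, hx, hy]
    | smul r x hx => rw [map_smul, map_smul, map_smul, hx]
    | mul p x hx => rw [ofPrim_ι_mul, V.counit_circ_of_mem p.2, map_mul, algebraMapInv_ι, zero_mul]
  one := V.ofPrim_one

theorem ofPrim_injective : Function.Injective V.ofPrim := by
  refine V.ofPrim_isCoalgHom.injective (tensorCoalg_radical V.prim) fun x hx h => ?_
  have h1 := eq_ι_of_mem_primitives V.prim hx
  rw [h1, V.ofPrim_ι] at h
  have h2 : TensorAlgebra.ιInv x = 0 := Subtype.ext h
  rw [h1, h2, map_zero]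

theorem range_ofPrim : LinearMap.range V.ofPrim = V.coalg.radical := by
  have hE := V.ofPrim_isCoalgHom
  have hcomul : ∀ y, V.coalg.comul (V.ofPrim y) =
      TensorProduct.map V.ofPrim V.ofPrim (deconc K V.prim y) := hE.comul
  refine le_antisymm ?_ (iSup_le fun r => ?_)
  · rintro _ ⟨x, rfl⟩
    exact hE.map_radical (tensorCoalg_radical V.prim ▸ Submodule.mem_top)
  induction r with
  | zero =>
    intro x hx
    obtain ⟨c, rfl⟩ := V.coalg.mem_filt_zero.1 hx
    exact ⟨c • 1, by rw [map_smul, ofPrim_one]⟩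
  | succ r ih =>
    suffices h : ∀ x ∈ V.coalg.filt (r + 1), V.coalg.counit x = 0 → x ∈ LinearMap.range V.ofPrim by
      intro x hx
      have h1 := h (x - V.coalg.counit x • V.coalg.one)
        (Submodule.sub_mem _ hx (Submodule.smul_mem _ _ (V.coalg.one_mem_filt _)))
        (by simp [show V.coalg.counit V.coalg.one = 1 from V.coalg.counit_one])
      have h2 : V.coalg.one ∈ LinearMap.range V.ofPrim := ⟨1, V.ofPrim_one⟩
      have := Submodule.add_mem _ h1 (Submodule.smul_mem _ (V.coalg.counit x) h2)
      rwa [sub_add_cancel] at this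
    intro x hx hεx
    rw [V.coalg.mem_filt_succ] at hx
    -- By induction F_r lies in the image. The lift t is unique because `ofPrim` is injective, so it
    -- inherits from Δ̄x the counit and cocycle conditions `h1` and `h2`.
    obtain ⟨t, ht⟩ : ∃ t, TensorProduct.map V.ofPrim V.ofPrim t = V.coalg.redComul x := by
      refine tens_le (S := LinearMap.range (TensorProduct.map V.ofPrim V.ofPrim)) ?_ hx
      intro a ha b hb
      obtain ⟨a', rfl⟩ := ih ha
      obtain ⟨b', rfl⟩ := ih hb
      exact ⟨a' ⊗ₜ b', rfl⟩
    have h1 : (TensorAlgebra.algebraMapInv : TensorAlgebra K V.prim →ₐ[K] K).toLinearMap.rTensor _ t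
        = 0 := by
      refine tensor_map_injective (f := (LinearMap.id : K →ₗ[K] K)) (fun _ _ h => h)
        V.ofPrim_injective ?_
      have h2 : TensorProduct.map LinearMap.id V.ofPrim ∘ₗ
          (TensorAlgebra.algebraMapInv : TensorAlgebra K V.prim →ₐ[K] K).toLinearMap.rTensor _ =
          V.coalg.counit.rTensor V.coalg ∘ₗ TensorProduct.map V.ofPrim V.ofPrim := by
        refine TensorProduct.ext' fun a b => ?_
        have := hE.counit a
        change V.coalg.counit (V.ofPrim a) = TensorAlgebra.algebraMapInv a at this
        simp [this]
      rw [← LinearMap.comp_apply, h2, LinearMap.comp_apply, ht, V.coalg.redComul_apply, map_sub,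
        map_sub, V.coalg.rTensor_counit, LinearMap.rTensor_tmul, LinearMap.rTensor_tmul, hεx,
        show V.coalg.counit V.coalg.one = 1 from V.coalg.counit_one]
      simp
    have h2 : (deconc K V.prim).lTensor _ t =
        TensorProduct.assoc K _ _ _ ((deconc K V.prim).rTensor _ t) +
        TensorProduct.assoc K _ _ _ (t ⊗ₜ[K] (1 : TensorAlgebra K V.prim)) -
          (1 : TensorAlgebra K V.prim) ⊗ₜ[K] t := by
      refine tensor_map_injective V.ofPrim_injective
        (tensor_map_injective V.ofPrim_injective V.ofPrim_injective) ?_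
      have e1 : ∀ s, TensorProduct.map V.ofPrim (TensorProduct.map V.ofPrim V.ofPrim)
          ((deconc K V.prim).lTensor _ s) =
          V.coalg.comul.lTensor V.coalg (TensorProduct.map V.ofPrim V.ofPrim s) := by
        intro s
        induction s using TensorProduct.induction_on with
        | zero => simp
        | add a b ha hb => simp only [map_add, ha, hb]
        | tmul a b => simp [hcomul]
      have e2 : ∀ s : (TensorAlgebra K V.prim ⊗[K] TensorAlgebra K V.prim) ⊗[K]
          TensorAlgebra K V.prim, TensorProduct.map V.ofPrim (TensorProduct.map V.ofPrim V.ofPrim)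
          (TensorProduct.assoc K _ _ _ s) = TensorProduct.assoc K _ _ _
            (TensorProduct.map (TensorProduct.map V.ofPrim V.ofPrim) V.ofPrim s) := by
        refine DFunLike.congr_fun (f := TensorProduct.map V.ofPrim
          (TensorProduct.map V.ofPrim V.ofPrim) ∘ₗ (TensorProduct.assoc K _ _ _).toLinearMap)
          (g := (TensorProduct.assoc K _ _ _).toLinearMap ∘ₗ
            TensorProduct.map (TensorProduct.map V.ofPrim V.ofPrim) V.ofPrim) ?_
        exact TensorProduct.ext_threefold fun a b c => rfl
      have e3 : ∀ s, TensorProduct.map (TensorProduct.map V.ofPrim V.ofPrim) V.ofPrim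
          ((deconc K V.prim).rTensor _ s) =
          V.coalg.comul.rTensor V.coalg (TensorProduct.map V.ofPrim V.ofPrim s) := by
        intro s
        induction s using TensorProduct.induction_on with
        | zero => simp
        | add a b ha hb => simp only [map_add, ha, hb]
        | tmul a b => simp [hcomul]
      rw [map_sub, map_add, e1, e2, e2, e3, map_tmul, map_tmul, ht, ofPrim_one]
      exact V.coalg.lTensor_comul_redComul x
    obtain ⟨y, hy⟩ : ∃ y, y = LinearMap.mul' K _ (TensorProduct.map
      (TensorAlgebra.ι K ∘ₗ TensorAlgebra.ιInv) LinearMap.id t) := ⟨_, rfl⟩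
    have h3 := deconc_eq_of_cocycle h1 h2 hy
    have hεy : TensorAlgebra.algebraMapInv y = (0 : K) := by
      rw [hy]
      clear * -
      induction t using TensorProduct.induction_on with
      | zero => simp
      | add a b ha hb => simp only [map_add, ha, hb, add_zero]
      | tmul a b => simp [algebraMapInv_ι]
    -- y was built so that Δ̄ of its image is Δ̄x; the remaining difference is a letter of Prim(V).
    have hp : x - V.ofPrim y ∈ V.coalg.primitives := by
      constructor
      · change V.coalg.counit _ = 0
        rw [map_sub, hεx, hE.counit]
        exact (zero_sub _).trans (neg_eq_zero.2 hεy)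
      · change V.coalg.redComul _ = 0
        rw [map_sub, ← ht, V.coalg.redComul_apply (V.ofPrim y), hcomul, h3]
        simp only [map_add, map_tmul]
        erw [V.ofPrim_one]
        abel
    exact ⟨TensorAlgebra.ι K ⟨_, hp⟩ + y, by rw [map_add, ofPrim_ι]; exact sub_add_cancel _ _⟩

/-! ### The B-infinity structure on the primitive elements -/

/-- The image of `ofPrim` is the radical, which • and ∂ preserve: • after `ofPrim ⊗ ofPrim` is a
coalgebra map out of a coalgebra that equals its radical, and ∂ preserves each F_r. Pull both back
along `ofPrim`; all axioms hold because `ofPrim` and `ofPrim ⊗ ofPrim` are injective. -/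
theorem exists_primStr : ∃ P : BInfStr V.prim,
    (∀ x y, V.ofPrim (P.mul x y) = V.dg.mul (V.ofPrim x) (V.ofPrim y)) ∧
      ∀ x, V.ofPrim (P.d x) = V.dg.d (V.ofPrim x) := by
  let T := tensorCoalg V.prim
  have hE := V.ofPrim_isCoalgHom
  have hinj := V.ofPrim_injective
  have hT : T.radical = ⊤ := tensorCoalg_radical V.prim
  -- Any linear retraction will do: it is only evaluated on the radical, where it is the inverse.
  obtain ⟨σ, hσ⟩ := LinearMap.exists_leftInverse_of_injective V.ofPrim (LinearMap.ker_eq_bot.2 hinj)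
  have hσ' : ∀ z ∈ V.coalg.radical, V.ofPrim (σ z) = z := by
    intro z hz
    rw [← V.range_ofPrim] at hz
    obtain ⟨x, rfl⟩ := hz
    rw [← LinearMap.comp_apply σ, hσ, LinearMap.id_apply]
  have hm : ∀ x y, V.ofPrim (σ (V.dg.mul (V.ofPrim x) (V.ofPrim y))) =
      V.dg.mul (V.ofPrim x) (V.ofPrim y) := by
    intro x y
    refine hσ' _ ?_
    exact (V.dg.isCoalgHom_mul.comp (hE.tensor hE)).map_radical
      (x := x ⊗ₜ y) (GrCoalg.tensor_radical hT hT ▸ Submodule.mem_top)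
  have hd : ∀ x, V.ofPrim (σ (V.dg.d (V.ofPrim x))) = V.dg.d (V.ofPrim x) := by
    intro x
    refine hσ' _ (V.dg.d_mem_radical ?_)
    rw [← V.range_ofPrim]
    exact ⟨x, rfl⟩
  let μ : TensorAlgebra K V.prim →ₗ[K] TensorAlgebra K V.prim →ₗ[K] TensorAlgebra K V.prim :=
    (V.dg.mul.compl₁₂ V.ofPrim V.ofPrim).compr₂ σ
  let D : TensorAlgebra K V.prim →ₗ[K] TensorAlgebra K V.prim := σ ∘ₗ V.dg.d ∘ₗ V.ofPrim
  have hμ : ∀ x y, V.ofPrim (μ x y) = V.dg.mul (V.ofPrim x) (V.ofPrim y) := hm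
  have hD : ∀ x, V.ofPrim (D x) = V.dg.d (V.ofPrim x) := hd
  have hμ' : V.ofPrim ∘ₗ TensorProduct.lift μ =
      TensorProduct.lift V.dg.mul ∘ₗ TensorProduct.map V.ofPrim V.ofPrim :=
    TensorProduct.ext' hμ
  have hD' : V.ofPrim ∘ₗ D = V.dg.d ∘ₗ V.ofPrim := LinearMap.ext hD
  have hcomul : ∀ y, V.coalg.comul (V.ofPrim y) =
      TensorProduct.map V.ofPrim V.ofPrim (deconc K V.prim y) := hE.comul
  have hs : V.ofPrim ∘ₗ signOp (tensorVect V.prim) = signOp V.coalg.toGrVect ∘ₗ V.ofPrim :=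
    LinearMap.ext fun x => (signOp_comp_zero hE.degree x).symm
  have hinj2 := tensor_map_injective hinj hinj
  refine ⟨{
    mul := μ
    mul_mem := fun i j x hx y hy => by
      refine GrVect.mem_of_injective hE.degree hinj ?_
      rw [hμ]
      have hx' := hE.degree _ _ hx
      have hy' := hE.degree _ _ hy
      rw [add_zero] at hx' hy'
      exact V.dg.mul_mem _ _ _ hx' _ hy'
    one_mem := T.one_mem
    mul_assoc := fun x y z => hinj (by rw [hμ, hμ, hμ, hμ, V.dg.mul_assoc])
    one_mul := fun x => hinj (by
      rw [hμ]
      exact (congrArg₂ (fun a b => V.dg.mul a b) V.ofPrim_one rfl).trans (V.dg.one_mul _))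
    mul_one := fun x => hinj (by
      rw [hμ]
      exact (congrArg₂ (fun a b => V.dg.mul a b) rfl V.ofPrim_one).trans (V.dg.mul_one _))
    d := D
    d_degree := fun i x hx => by
      refine GrVect.mem_of_injective hE.degree hinj ?_
      rw [hD]
      have hx' := hE.degree _ _ hx
      rw [add_zero] at hx'
      exact V.dg.d_degree _ _ hx'
    d_d := fun x => hinj (by rw [hD, hD, V.dg.d_d, map_zero])
    d_mul := fun x y => hinj (by
      rw [map_add, hD, hμ, hμ, hμ, hD, hD, V.dg.d_mul, signOp_comp_zero hE.degree])
    comul_mul := fun x y => hinj2 (by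
      refine (hcomul (μ x y)).symm.trans ?_
      rw [hμ, V.dg.comul_mul, hcomul, hcomul, midSwap_eq_gswap]
      rw [gswap_map (V := tensorVect V.prim) (V' := tensorVect V.prim) (W := tensorVect V.prim)
        (W' := tensorVect V.prim) _ _ hE.degree hE.degree]
      rw [← LinearMap.comp_apply, ← TensorProduct.map_comp, ← hμ', TensorProduct.map_comp]
      rfl)
    counit_mul := fun x y => by
      refine (hE.counit _).symm.trans ?_
      rw [hμ, V.dg.counit_mul]
      exact congrArg₂ _ (hE.counit x) (hE.counit y)
    comul_d := fun x => hinj2 (by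
      refine (hcomul (D x)).symm.trans ?_
      rw [hD, V.dg.comul_d, hcomul, map_add]
      change _ = TensorProduct.map _ _ (LinearMap.rTensor _ _ (deconc K V.prim x)) +
        TensorProduct.map _ _ (TensorProduct.map _ _ (deconc K V.prim x))
      generalize deconc K V.prim x = r
      simp only [LinearMap.rTensor, ← LinearMap.comp_apply, ← TensorProduct.map_comp]
      rw [hD', hs]
      rfl) }, hμ, hD⟩

/-- The B-infinity structure on the primitive elements. -/
def primStr : BInfStr V.prim := V.exists_primStr.choose

theorem ofPrim_mul (x y : TensorAlgebra K V.prim) :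
    V.ofPrim (V.primStr.mul x y) = V.dg.mul (V.ofPrim x) (V.ofPrim y) :=
  V.exists_primStr.choose_spec.1 x y

theorem ofPrim_d (x : TensorAlgebra K V.prim) :
    V.ofPrim (V.primStr.d x) = V.dg.d (V.ofPrim x) :=
  V.exists_primStr.choose_spec.2 x

theorem ofPrim_isHom :
    DAsAlg.IsHom ((env K).obj ⟨V.prim, V.primStr⟩).toDAsAlg V.toDAsAlg V.ofPrim where
  degree := V.ofPrim_isCoalgHom.degree
  map_one := V.ofPrim_one
  map_bullet := V.ofPrim_mul
  map_circ := V.toDAsAlg.extend_mul _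
  map_d := V.ofPrim_d

/-- `ofPrim` is a homomorphism of 2-associative algebras from U(Prim V), and its restriction to
letters is the inclusion. -/
theorem primIncl_isBInfHom {S : BInfStr V.coalg.toGrVect} (hS : V.toDAsAlg.IsUnderlying S) :
    IsBInfHom V.primStr S V.primIncl := by
  have h := isBInfHom_of_isHom (A := ⟨V.prim, V.primStr⟩) hS V.ofPrim_isHom
  have h1 : V.ofPrim ∘ₗ TensorAlgebra.ι K = V.primIncl := LinearMap.ext V.ofPrim_ι
  exact h1 ▸ h

variable {V} in
theorem ofPrim_tensorMap_primMap {W : DAsBialg K} (f : V ⟶ W) (x : TensorAlgebra K V.prim) :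
    W.ofPrim (tensorMap (primMap f) x) = f.toLin (V.ofPrim x) := by
  induction x using tensor_left_induction with
  | one => rw [map_one, ofPrim_one, ofPrim_one]; exact f.isHom.map_one.symm
  | mul p x hx =>
    rw [map_mul, tensorMap_ι, ofPrim_ι_mul, ofPrim_ι_mul, hx]
    exact (f.isHom.map_circ _ _).symm
  | add x y hx hy => simp only [map_add, hx, hy]
  | smul r x hx => simp only [map_smul, hx]

variable {V} in
theorem primMap_degree {W : DAsBialg K} (f : V ⟶ W) :
    HasDegree (V := V.prim) (W := W.prim) 0 (primMap f) :=
  fun i x hx => f.isHom.degree i x hx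

variable {V} in
theorem primMap_isBInfHom {W : DAsBialg K} (f : V ⟶ W) :
    IsBInfHom V.primStr W.primStr (primMap f) where
  degree := primMap_degree f
  map_mul x y := W.ofPrim_injective (by
    rw [ofPrim_mul, ofPrim_tensorMap_primMap, ofPrim_tensorMap_primMap, ofPrim_tensorMap_primMap,
      ofPrim_mul]
    exact f.isHom.map_bullet _ _)
  map_d x := W.ofPrim_injective (by
    rw [ofPrim_d, ofPrim_tensorMap_primMap, ofPrim_tensorMap_primMap, ofPrim_d]
    exact f.isHom.map_d _)

end DAsBialg

end
end BInf

namespace BInf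
noncomputable section
variable {K : Type u} [Field K]

/-! ### Conilpotent coalgebras -/

section Kernel
variable {V W P Q : Type u} [AddCommGroup V] [Module K V] [AddCommGroup W] [Module K W]
  [AddCommGroup P] [Module K P] [AddCommGroup Q] [Module K Q]

/-- The form id − sq shows that π, tensored with an identity, fixes every tensor killed by q in that
factor. -/
theorem exists_ker_projection (q : V →ₗ[K] P) : ∃ (π : V →ₗ[K] V) (s : P →ₗ[K] V),
    (∀ v, π v ∈ LinearMap.ker q) ∧ π = LinearMap.id - s ∘ₗ q := by
  obtain ⟨σ, hσ⟩ := q.rangeRestrict.exists_rightInverse_of_surjective q.range_rangeRestrict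
  obtain ⟨ρ, hρ⟩ := LinearMap.exists_leftInverse_of_injective (LinearMap.range q).subtype
    (Submodule.ker_subtype _)
  refine ⟨_, σ ∘ₗ ρ, fun v => ?_, rfl⟩
  have h1 : ρ (q v) = q.rangeRestrict v := DFunLike.congr_fun hρ (q.rangeRestrict v)
  have h2 : q (σ (q.rangeRestrict v)) = q v :=
    congrArg Subtype.val (DFunLike.congr_fun hσ (q.rangeRestrict v))
  rw [LinearMap.mem_ker, LinearMap.sub_apply, LinearMap.comp_apply, LinearMap.comp_apply, h1,
    map_sub, h2, LinearMap.id_apply, sub_self]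

theorem mem_tens_ker {p : V →ₗ[K] P} {q : W →ₗ[K] Q} {t : V ⊗[K] W} (hp : p.rTensor W t = 0)
    (hq : q.lTensor V t = 0) : t ∈ tens (LinearMap.ker p) (LinearMap.ker q) := by
  obtain ⟨π, s, hπ, hs⟩ := exists_ker_projection p
  obtain ⟨ρ, r, hρ, hr⟩ := exists_ker_projection q
  have h1 : π.rTensor W t = t := by
    rw [hs, LinearMap.rTensor_sub, LinearMap.rTensor_comp, LinearMap.sub_apply,
      LinearMap.comp_apply, hp, map_zero, sub_zero, LinearMap.rTensor_id, LinearMap.id_apply]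
  have h2 : ρ.lTensor V t = t := by
    rw [hr, LinearMap.lTensor_sub, LinearMap.lTensor_comp, LinearMap.sub_apply,
      LinearMap.comp_apply, hq, map_zero, sub_zero, LinearMap.lTensor_id, LinearMap.id_apply]
  rw [← h1, ← h2]
  clear h1 h2 hp hq
  induction t using TensorProduct.induction_on with
  | zero => simp
  | tmul a b => exact tmul_mem_tens (hπ a) (hρ b)
  | add a b ha hb => rw [map_add, map_add]; exact Submodule.add_mem _ ha hb

end Kernel

/-- The left inverse deconcatenates and keeps the one-letter part on the left. It turns the
vanishing of `iterRedComul`, whose values are words, into the vanishing of a tensor. -/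
theorem mul'_map_ι_injective {M : Type u} [AddCommGroup M] [Module K M] :
    Function.Injective (LinearMap.mul' K (TensorAlgebra K M) ∘ₗ
      TensorProduct.map (TensorAlgebra.ι K) LinearMap.id) := by
  refine Function.LeftInverse.injective
    (g := TensorAlgebra.ιInv.rTensor (TensorAlgebra K M) ∘ₗ deconc K M) fun t => ?_
  have hy : ∀ y, (TensorAlgebra.algebraMapInv : TensorAlgebra K M →ₐ[K] K).toLinearMap.rTensor _
      (deconc K M y) = 1 ⊗ₜ y := fun y => DFunLike.congr_fun deconc_counit_left y
  induction t using TensorProduct.induction_on with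
  | zero => simp
  | add a b ha hb => rw [map_add, map_add, ha, hb]
  | tmul v y =>
    change TensorAlgebra.ιInv.rTensor _ (deconc K M (TensorAlgebra.ι K v * y)) = v ⊗ₜ y
    have h : ∀ r, TensorAlgebra.ιInv.rTensor (TensorAlgebra K M)
        ((LinearMap.mulLeft K (TensorAlgebra.ι K v)).rTensor (TensorAlgebra K M) r) =
        (LinearMap.toSpanSingleton K M v).rTensor _
          ((TensorAlgebra.algebraMapInv : TensorAlgebra K M →ₐ[K] K).toLinearMap.rTensor _ r) := by
      intro r
      induction r using TensorProduct.induction_on with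
      | zero => simp
      | add a b ha hb => simp only [map_add, ha, hb]
      | tmul a b =>
        simp only [LinearMap.rTensor_tmul, LinearMap.mulLeft_apply, ιInv_ι_mul,
          LinearMap.toSpanSingleton_apply, AlgHom.toLinearMap_apply]
    rw [deconc_ι_mul, map_add, h, hy]
    simp

/-! ### Iterated reduced comultiplications against the primitive filtration. -/

namespace GrCoalg
variable (C : GrCoalg K)

theorem redComul_coassoc (x : C) : C.redComul.lTensor C (C.redComul x) =
    TensorProduct.assoc K C C C (C.redComul.rTensor C (C.redComul x)) := by
  have h1 : ∀ t, C.redComul.lTensor C t = C.comul.lTensor C t -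
      TensorProduct.assoc K C C C (t ⊗ₜ C.one) - (TensorProduct.mk K C C C.one).lTensor C t := by
    intro t
    induction t using TensorProduct.induction_on with
    | zero => simp
    | add a b ha hb => simp only [map_add, ha, hb, add_tmul]; abel
    | tmul a b => simp [redComul_apply, tmul_sub]
  have h2 : ∀ t, TensorProduct.assoc K C C C (C.redComul.rTensor C t) =
      TensorProduct.assoc K C C C (C.comul.rTensor C t) -
        (TensorProduct.mk K C C C.one).lTensor C t - C.one ⊗ₜ t := by
    intro t
    induction t using TensorProduct.induction_on with
    | zero => simp
    | add a b ha hb => simp only [map_add, ha, hb, tmul_add]; abel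
    | tmul a b => simp [redComul_apply, sub_tmul]
  rw [h1, h2, C.lTensor_comul_redComul]
  abel

theorem lTensor_counit_redComul (x : C) :
    C.counit.lTensor C (C.redComul x) = -(C.one ⊗ₜ C.counit x) := by
  rw [C.redComul_apply, map_sub, map_sub, C.lTensor_counit, LinearMap.lTensor_tmul,
    LinearMap.lTensor_tmul, show C.counit C.one = 1 from C.counit_one]
  abel

/-- Control of the right factor suffices. By coassociativity, (Δ̄ ⊗ id)Δ̄x = (id ⊗ Δ̄)Δ̄x has its
middle factor one filtration step lower. So the left factors a of Δ̄x can be taken with Δ̄a in C ⊗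
F_{r−1}, and induction puts them in F_r. For r = 0 the counit identity gives Δ̄x = −ε(x) 1 ⊗ 1. -/
theorem mem_filt_succ_of_mem_tens_top (r : ℕ) {x : C} (hx : C.redComul x ∈ tens ⊤ (C.filt r)) :
    x ∈ C.filt (r + 1) := by
  induction r generalizing x with
  | zero =>
    have h : (LinearMap.toSpanSingleton K C C.one ∘ₗ C.counit).lTensor C (C.redComul x) =
        (LinearMap.id : C ⊗[K] C →ₗ[K] C ⊗[K] C) (C.redComul x) := by
      refine eq_of_mem_tens (fun a _ b hb => ?_) hx
      obtain ⟨c, rfl⟩ := C.mem_filt_zero.1 hb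
      simp [show C.counit C.one = 1 from C.counit_one]
    rw [LinearMap.lTensor_comp, LinearMap.comp_apply, C.lTensor_counit_redComul,
      LinearMap.id_apply] at h
    rw [C.mem_filt_succ, ← h, map_neg, LinearMap.lTensor_tmul]
    exact Submodule.neg_mem _ (tmul_mem_tens (C.one_mem_filt 0)
      (Submodule.smul_mem _ _ (C.one_mem_filt 0)))
  | succ r ih =>
    let p := (tens (⊤ : Submodule K C) (C.filt r)).mkQ
    have h1 : (p ∘ₗ C.redComul).rTensor C (C.redComul x) = 0 := by
      have h := congrArg (TensorProduct.assoc K C C C).symm (C.redComul_coassoc x)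
      rw [LinearEquiv.symm_apply_apply] at h
      rw [LinearMap.rTensor_comp, LinearMap.comp_apply, ← h]
      refine eq_of_mem_tens (f := p.rTensor C ∘ₗ (TensorProduct.assoc K C C C).symm.toLinearMap ∘ₗ
        C.redComul.lTensor C) (g := 0) (fun a _ b hb => ?_) hx
      rw [C.mem_filt_succ] at hb
      refine eq_of_mem_tens (f := p.rTensor C ∘ₗ (TensorProduct.assoc K C C C).symm.toLinearMap ∘ₗ
        TensorProduct.mk K C (C ⊗[K] C) a) (g := 0) (fun c hc d _ => ?_) hb
      have h3 : p (a ⊗ₜ c) = 0 :=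
        (Submodule.Quotient.mk_eq_zero _).2 (tmul_mem_tens Submodule.mem_top hc)
      simp [h3]
    have h2 : (C.filt (r + 1)).mkQ.lTensor C (C.redComul x) = 0 := by
      refine eq_of_mem_tens (f := (C.filt (r + 1)).mkQ.lTensor C) (g := 0) (fun a _ b hb => ?_) hx
      have h3 : (C.filt (r + 1)).mkQ b = 0 := (Submodule.Quotient.mk_eq_zero _).2 hb
      simp [h3]
    rw [C.mem_filt_succ]
    refine tens_mono (fun a ha => ih ?_) (Submodule.ker_mkQ _).le (mem_tens_ker h1 h2)
    exact (Submodule.Quotient.mk_eq_zero _).1 ha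

theorem iterRedComul_succ (r : ℕ) (x : C) : C.iterRedComul (r + 1) x =
    LinearMap.mul' K (TensorAlgebra K C)
      (TensorProduct.map (TensorAlgebra.ι K) (C.iterRedComul r) (C.redComul x)) := rfl

theorem iterRedComul_eq_zero (r : ℕ) {x : C} (hx : x ∈ C.filt r) (h : C.counit x = 0) :
    C.iterRedComul r x = 0 := by
  induction r generalizing x with
  | zero =>
    obtain ⟨c, rfl⟩ := C.mem_filt_zero.1 hx
    rw [map_smul, show C.counit C.one = 1 from C.counit_one, smul_eq_mul, mul_one] at h
    rw [h, zero_smul, map_zero]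
  | succ r ih =>
    -- Elements of F_r need not lie in ker ε, but ε(x) = 0 gives (id ⊗ ε)Δ̄x = 0, so the right
    -- factors may be projected to ker ε.
    let π : C →ₗ[K] C := LinearMap.id - LinearMap.toSpanSingleton K C C.one ∘ₗ C.counit
    have h1 : π.lTensor C (C.redComul x) = C.redComul x := by
      rw [LinearMap.lTensor_sub, LinearMap.lTensor_comp, LinearMap.sub_apply,
        LinearMap.comp_apply, C.lTensor_counit_redComul, h, tmul_zero, neg_zero, map_zero, sub_zero,
        LinearMap.lTensor_id, LinearMap.id_apply]
    rw [C.iterRedComul_succ, ← h1]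
    rw [C.mem_filt_succ] at hx
    refine eq_of_mem_tens (f := LinearMap.mul' K (TensorAlgebra K C) ∘ₗ TensorProduct.map
      (TensorAlgebra.ι K) (C.iterRedComul r) ∘ₗ π.lTensor C) (g := 0) (fun a _ b hb => ?_) hx
    have h2 : C.iterRedComul r (π b) = 0 := by
      refine ih (Submodule.sub_mem _ hb (Submodule.smul_mem _ _ (C.one_mem_filt r))) ?_
      simp [π, show C.counit C.one = 1 from C.counit_one]
    simp [h2]

theorem mem_filt_of_iterRedComul_eq_zero (r : ℕ) {x : C} (hx : C.iterRedComul r x = 0)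
    (h : C.counit x = 0) : x ∈ C.filt r := by
  induction r generalizing x with
  | zero =>
    have : x = 0 := by
      rw [← ιInv_ι (K := K) x]
      exact (congrArg _ hx).trans (map_zero _)
    rw [this]
    exact Submodule.zero_mem _
  | succ r ih =>
    have h1 : (C.iterRedComul r).lTensor C (C.redComul x) = 0 := by
      refine mul'_map_ι_injective ?_
      rw [map_zero, ← hx, C.iterRedComul_succ, LinearMap.comp_apply, ← LinearMap.comp_apply,
        LinearMap.lTensor, ← LinearMap.comp_apply, LinearMap.comp_assoc, ← TensorProduct.map_comp]
      rfl
    -- Pairing with ε makes the kernel consist of elements of ker ε, as the induction hypothesis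
    -- demands. The left factor stays unrestricted (p = 0), which `mem_filt_succ_of_mem_tens_top`
    -- allows.
    have h2 : ((C.iterRedComul r).prod C.counit).lTensor C (C.redComul x) = 0 := by
      have : (C.iterRedComul r).prod C.counit = LinearMap.inl K _ _ ∘ₗ C.iterRedComul r +
          LinearMap.inr K _ _ ∘ₗ C.counit := LinearMap.ext fun y => by simp
      rw [this, LinearMap.lTensor_add, LinearMap.lTensor_comp, LinearMap.lTensor_comp,
        LinearMap.add_apply, LinearMap.comp_apply, LinearMap.comp_apply, h1,
        C.lTensor_counit_redComul, h]
      simp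
    refine C.mem_filt_succ_of_mem_tens_top r ?_
    refine tens_mono le_top (fun b hb => ?_)
      (mem_tens_ker (p := (0 : C →ₗ[K] C)) (by rw [LinearMap.rTensor_zero, LinearMap.zero_apply]) h2)
    have hb' : (C.iterRedComul r b, C.counit b) = 0 := hb
    exact ih (congrArg Prod.fst hb') (congrArg Prod.snd hb')

theorem isConilpotent_iff : C.IsConilpotent ↔ C.radical = ⊤ := by
  constructor
  · intro h
    rw [eq_top_iff]
    rintro x -
    have hε : C.counit (x - C.counit x • C.one) = 0 := by
      simp [show C.counit C.one = 1 from C.counit_one]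
    obtain ⟨r, hr⟩ := h _ hε
    refine C.mem_radical.2 ⟨r, ?_⟩
    have := Submodule.add_mem _ (C.mem_filt_of_iterRedComul_eq_zero r hr hε)
      (Submodule.smul_mem _ (C.counit x) (C.one_mem_filt r))
    rwa [sub_add_cancel] at this
  · intro h x hx
    obtain ⟨r, hr⟩ := C.mem_radical.1 (h ▸ Submodule.mem_top : x ∈ C.radical)
    exact ⟨r, C.iterRedComul_eq_zero r hr hx⟩

end GrCoalg

end
end BInf

namespace BInf
noncomputable section
variable {K : Type u} [Field K]

/-! ### Isomorphisms -/

theorem HasDegree.symm {V W : GrVect K} {f : V →ₗ[K] W} (hf : HasDegree 0 f)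
    (h : Function.Bijective f) :
    HasDegree (V := W) (W := V) 0 (LinearEquiv.ofBijective f h).symm.toLinearMap := by
  intro i w hw
  refine GrVect.mem_of_injective hf h.1 ?_
  rw [add_zero]
  exact ((LinearEquiv.ofBijective f h).apply_symm_apply w).symm ▸ hw

theorem BInfAlg.isIso_of_bijective {A B : BInfAlg K} (f : A ⟶ B)
    (h : Function.Bijective f.toLin) : IsIso f := by
  let e := LinearEquiv.ofBijective f.toLin h
  have h1 : f.toLin ∘ₗ e.symm.toLinearMap = LinearMap.id :=
    LinearMap.ext fun x => e.apply_symm_apply x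
  have h2 : e.symm.toLinearMap ∘ₗ f.toLin = LinearMap.id :=
    LinearMap.ext fun x => e.symm_apply_apply x
  have h1' : ∀ x, tensorMap f.toLin (tensorMap e.symm.toLinearMap x) = x := fun x => by
    rw [← tensorMap_comp, h1, tensorMap_id]
  have h2' : ∀ x, tensorMap e.symm.toLinearMap (tensorMap f.toLin x) = x := fun x => by
    rw [← tensorMap_comp, h2, tensorMap_id]
  have hinj := Function.LeftInverse.injective h2'
  let g : B ⟶ A := ⟨e.symm.toLinearMap, f.isHom.degree.symm h,
    fun x y => hinj (by rw [f.isHom.map_mul, h1', h1', h1']),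
    fun x => hinj (by rw [f.isHom.map_d, h1', h1'])⟩
  exact ⟨g, BInfAlg.Hom.ext h2, BInfAlg.Hom.ext h1⟩

namespace DAsBialg

theorem isIso_of_bijective {V W : DAsBialg K} (f : V ⟶ W) (h : Function.Bijective f.toLin) :
    IsIso f := by
  let e := LinearEquiv.ofBijective f.toLin h
  have h1 : f.toLin ∘ₗ e.symm.toLinearMap = LinearMap.id :=
    LinearMap.ext fun x => e.apply_symm_apply x
  have h2 : e.symm.toLinearMap ∘ₗ f.toLin = LinearMap.id :=
    LinearMap.ext fun x => e.symm_apply_apply x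
  have h1' : ∀ x, f.toLin (e.symm x) = x := e.apply_symm_apply
  let g : W ⟶ V :=
    { toLin := e.symm.toLinearMap
      isHom :=
        { degree := f.isHom.degree.symm h
          map_one := h.1 ((h1' _).trans f.isHom.map_one.symm)
          map_bullet := fun x y => h.1 ((h1' _).trans (((f.isHom.map_bullet _ _).trans
            (congrArg₂ (fun a b => W.dg.mul a b) (h1' x) (h1' y))).symm))
          map_circ := fun x y => h.1 ((h1' _).trans (((f.isHom.map_circ _ _).trans
            (congrArg₂ (fun a b => W.circ.mul a b) (h1' x) (h1' y))).symm))
          map_d := fun x => h.1 ((h1' _).trans (((f.isHom.map_d _).trans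
            (congrArg W.dg.d (h1' x))).symm)) }
      map_comul := fun x => tensor_map_injective h.1 h.1 (by
        rw [← f.map_comul, ← LinearMap.comp_apply (TensorProduct.map f.toLin f.toLin),
          ← TensorProduct.map_comp, h1, TensorProduct.map_id, LinearMap.id_apply]
        exact congrArg W.coalg.comul (h1' x))
      map_counit := fun x => (f.map_counit _).symm.trans (congrArg W.coalg.counit (h1' x)) }
  exact ⟨g, Hom.ext h2, Hom.ext h1⟩

theorem surjective_of_isIso {V W : DAsBialg K} (f : V ⟶ W) [IsIso f] :
    Function.Surjective f.toLin := fun w =>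
  ⟨(inv f).toLin w, DFunLike.congr_fun (congrArg Hom.toLin (IsIso.inv_hom_id f)) w⟩

theorem mono_of_injective {V W : DAsBialg K} (f : V ⟶ W) (h : Function.Injective f.toLin) :
    Mono f :=
  ⟨fun _ _ hgk => Hom.ext (LinearMap.ext fun x =>
    h (DFunLike.congr_fun (congrArg Hom.toLin hgk) x))⟩

/-! ### The adjunction -/

variable (K) in
/-- The functor of primitive elements. -/
abbrev primFun : DAsBialg K ⥤ BInfAlg K := primFunctor primStr primMap_isBInfHom

/-- The inclusion of the letters into the primitive elements of the tensor coalgebra. -/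
def letter (A : BInfAlg K) : A.space →ₗ[K] ((env K).obj A).prim :=
  (TensorAlgebra.ι K).codRestrict _ (ι_mem_primitives A.space)

theorem letter_bijective (A : BInfAlg K) : Function.Bijective (letter A) := by
  constructor
  · intro a b h
    have h' : TensorAlgebra.ι K a = TensorAlgebra.ι K b := congrArg Subtype.val h
    rw [← ιInv_ι (K := K) a, h', ιInv_ι]
  · rintro ⟨x, hx⟩
    exact ⟨_, Subtype.ext (eq_ι_of_mem_primitives A.space hx).symm⟩

/-- A word is the concatenation of its letters. This is one triangle identity, and with injectivity
of `ofPrim` it also identifies the transported structure on Prim(U(A)) with that of A. -/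
theorem ofPrim_tensorMap_letter (A : BInfAlg K) (x : TensorAlgebra K A.space) :
    ((env K).obj A).ofPrim (tensorMap (letter A) x) = x := by
  induction x using tensor_left_induction with
  | one => rw [map_one, ofPrim_one]; rfl
  | mul p x hx =>
    rw [map_mul, tensorMap_ι, ofPrim_ι_mul, hx]
    rfl
  | add x y hx hy => rw [map_add, map_add, hx, hy]; rfl
  | smul r x hx => rw [map_smul, map_smul, hx]; rfl

theorem letter_isBInfHom (A : BInfAlg K) :
    IsBInfHom A.str ((env K).obj A).primStr (letter A) where
  degree i a ha := by
    have := ι_degree A.space i a ha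
    exact this
  map_mul x y := ((env K).obj A).ofPrim_injective (by
    rw [ofPrim_mul, ofPrim_tensorMap_letter, ofPrim_tensorMap_letter, ofPrim_tensorMap_letter]
    rfl)
  map_d x := ((env K).obj A).ofPrim_injective (by
    rw [ofPrim_d, ofPrim_tensorMap_letter, ofPrim_tensorMap_letter]
    rfl)

/-- The counit `U(Prim(V)) → V`. -/
def counitHom (V : DAsBialg K) : (env K).obj ((primFun K).obj V) ⟶ V where
  toLin := V.ofPrim
  isHom := V.ofPrim_isHom
  map_comul := V.ofPrim_isCoalgHom.comul
  map_counit := V.ofPrim_isCoalgHom.counit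

variable (K) in
/-- The adjunction between the universal enveloping bialgebra and the primitive elements. -/
def envAdj : env K ⊣ primFun K where
  unit :=
    { app := fun A => ⟨letter A, letter_isBInfHom A⟩
      naturality := fun _ _ f => BInfAlg.Hom.ext (LinearMap.ext fun a =>
        Subtype.ext (tensorMap_ι f.toLin a).symm) }
  counit :=
    { app := counitHom
      naturality := fun _ _ f => Hom.ext (LinearMap.ext fun x => ofPrim_tensorMap_primMap f x) }
  left_triangle_components A := Hom.ext (LinearMap.ext fun x => ofPrim_tensorMap_letter A x)
  right_triangle_components V := BInfAlg.Hom.ext (LinearMap.ext fun p =>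
    Subtype.ext (V.ofPrim_ι p))

theorem isIso_counit_iff (V : DAsBialg K) :
    IsIso ((envAdj K).counit.app V) ↔ V.coalg.IsConilpotent := by
  rw [V.coalg.isConilpotent_iff, ← V.range_ofPrim, LinearMap.range_eq_top]
  exact ⟨fun _ => surjective_of_isIso ((envAdj K).counit.app V),
    fun h => isIso_of_bijective _ ⟨V.ofPrim_injective, h⟩⟩

theorem isIso_unit (A : BInfAlg K) : IsIso ((envAdj K).unit.app A) :=
  BInfAlg.isIso_of_bijective _ (letter_bijective A)

theorem isConil_env (A : BInfAlg K) : isConil K ((env K).obj A) :=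
  (GrCoalg.isConilpotent_iff _).2 (tensorCoalg_radical A.space)

variable (K) in
/-- The restriction of the adjunction to the conilpotent bialgebras. -/
def conilAdj : (isConil K).lift (env K) isConil_env ⊣ (isConil K).ι ⋙ primFun K where
  unit := { app := fun A => (envAdj K).unit.app A
            naturality := fun _ _ f => (envAdj K).unit.naturality f }
  counit :=
    { app := fun V => ObjectProperty.homMk ((envAdj K).counit.app V.obj)
      naturality := fun _ _ f => ObjectProperty.hom_ext _ ((envAdj K).counit.naturality f.hom) }
  left_triangle_components A := ObjectProperty.hom_ext _
    ((envAdj K).left_triangle_components A)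
  right_triangle_components V := (envAdj K).right_triangle_components V.obj

theorem isIso_conilAdj_counit (V : (isConil K).FullSubcategory) :
    IsIso ((conilAdj K).counit.app V) :=
  (ObjectProperty.isIso_hom_iff _).1 ((isIso_counit_iff V.obj).2 V.property)

theorem mono_counit (V : DAsBialg K) : Mono ((envAdj K).counit.app V) :=
  mono_of_injective _ V.ofPrim_injective

-- The right adjoint of the inclusion is U ∘ Prim. Its counit is that of the original adjunction,
-- and its unit inverts the restricted counit, which is invertible on conilpotent objects.
variable (K) in
theorem nonempty_coreflective : Nonempty (Coreflective (isConil K).ι) := by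
  have := fun V => isIso_conilAdj_counit (K := K) V
  have : IsIso (conilAdj K).counit := NatIso.isIso_of_isIso_app _
  refine ⟨{
    R := primFun K ⋙ (isConil K).lift (env K) isConil_env
    adj :=
      { unit := inv (conilAdj K).counit
        counit := (envAdj K).counit
        left_triangle_components := fun V => ?_
        right_triangle_components := fun W => ?_ } }⟩
  · exact congrArg (isConil K).ι.map (congr_app (IsIso.inv_hom_id (conilAdj K).counit) V)
  · have h : (env K).map ((primFun K).map ((envAdj K).counit.app W)) =
        (envAdj K).counit.app ((env K).obj ((primFun K).obj W)) := by
      have := mono_counit W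
      rw [← cancel_mono ((envAdj K).counit.app W)]
      exact (envAdj K).counit.naturality ((envAdj K).counit.app W)
    refine Eq.trans ?_ (congr_app (IsIso.inv_hom_id (conilAdj K).counit)
      (((isConil K).lift (env K) isConil_env).obj ((primFun K).obj W)))
    congr 1
    exact ObjectProperty.hom_ext _ h

end DAsBialg

end
end BInf

theorem theorem3p3p3 (K : Type u) [Field K] :
    -- every 2-associative differential algebra has a unique underlying B-infinity structure
    (∀ V : DAsAlg K, ∃! S : BInfStr V.space, V.IsUnderlying S) ∧
    -- `U(A)` is the universal enveloping 2-associative differential algebra of `A`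
    (∀ (A : BInfAlg K) (V : DAsAlg K) (S : BInfStr V.space), V.IsUnderlying S →
      (∀ f : A.space →ₗ[K] V.space, IsBInfHom A.str S f →
        ∃! F : TensorAlgebra K A.space →ₗ[K] V.space,
          DAsAlg.IsHom ((env K).obj A).toDAsAlg V F ∧ F ∘ₗ TensorAlgebra.ι K = f) ∧
      (∀ F : TensorAlgebra K A.space →ₗ[K] V.space,
        DAsAlg.IsHom ((env K).obj A).toDAsAlg V F → IsBInfHom A.str S (F ∘ₗ TensorAlgebra.ι K))) ∧
    -- the underlying structure restricts to the primitives, functorially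
    ∃ (P : ∀ V : DAsBialg K, BInfStr V.prim)
      (hP : ∀ {V W : DAsBialg K} (f : V ⟶ W), IsBInfHom (P V) (P W) (DAsBialg.primMap f)),
      (∀ (V : DAsBialg K) (S : BInfStr V.coalg.toGrVect), V.toDAsAlg.IsUnderlying S →
        IsBInfHom (P V) S V.primIncl) ∧
      -- `Prim` is right adjoint to `U`, with unit `A → T^c(A)` and counit extending the inclusion
      ∃ adj : env K ⊣ primFunctor P hP,
        (∀ A : BInfAlg K, IsIso (adj.unit.app A) ∧
          ∀ a : A.space, DAsBialg.primIncl ((env K).obj A) ((adj.unit.app A).toLin a) =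
            TensorAlgebra.ι K a) ∧
        (∀ V : DAsBialg K,
          Mono (adj.counit.app V) ∧
          Function.Injective (adj.counit.app V).toLin ∧
          LinearMap.range (adj.counit.app V).toLin = V.coalg.radical ∧
          (∀ x : V.prim, (adj.counit.app V).toLin (TensorAlgebra.ι K x) = V.primIncl x) ∧
          (IsIso (adj.counit.app V) ↔ V.coalg.IsConilpotent)) ∧
        -- the adjoint equivalence with the full coreflective subcategory of conilpotent objects
        Nonempty (Coreflective (isConil K).ι) ∧
        ∃ (hU : ∀ A : BInfAlg K, isConil K ((env K).obj A))
          (adj' : (isConil K).lift (env K) hU ⊣ (isConil K).ι ⋙ primFunctor P hP),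
          (∀ A : BInfAlg K, IsIso (adj'.unit.app A) ∧ adj'.unit.app A = adj.unit.app A) ∧
          (∀ V : (isConil K).FullSubcategory, IsIso (adj'.counit.app V) ∧
            (isConil K).ι.map (adj'.counit.app V) = adj.counit.app V.obj) := by
  refine ⟨fun V => ?_, fun A V S hS => ⟨fun f hf => ?_, fun F hF => isBInfHom_of_isHom hS hF⟩,
    DAsBialg.primStr, DAsBialg.primMap_isBInfHom, fun V S hS => V.primIncl_isBInfHom hS,
    DAsBialg.envAdj K, fun A => ⟨DAsBialg.isIso_unit A, fun a => rfl⟩,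
    fun V => ⟨DAsBialg.mono_counit V, V.ofPrim_injective, V.range_ofPrim, V.ofPrim_ι,
      DAsBialg.isIso_counit_iff V⟩,
    DAsBialg.nonempty_coreflective K, DAsBialg.isConil_env, DAsBialg.conilAdj K,
    fun A => ⟨DAsBialg.isIso_unit A, rfl⟩, fun V => ⟨DAsBialg.isIso_conilAdj_counit V, rfl⟩⟩
  · obtain ⟨S, hS⟩ := exists_isUnderlying V
    exact ⟨S, hS, fun S' hS' => isUnderlying_unique V hS' hS⟩
  · refine ⟨V.extend f, ⟨isHom_extend hS hf, LinearMap.ext (V.extend_ι f)⟩, ?_⟩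
    rintro F ⟨hF, hFf⟩
    exact DAsAlg.eq_extend hF.map_one hF.map_circ (DFunLike.congr_fun hFf)
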